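/- For $\epsilon:\mathbb{N}\to[0,1]$, an $\epsilon$-one-way state generator ($\epsilon$-OWSG) is a triple of (uniform) quantum polynomial-time (QPT) algorithms $\mathsf{KeyGen}(1^\lambda)\to k$ (a classical key), $\mathsf{StateGen}(k)\to\phi_k$ (a possibly mixed quantum state) and $\mathsf{Ver}(k',\phi_k)\to\top/\bot$ such that * (correctness) $\Pr[\top\leftarrow\mathsf{Ver}(k,\phi_k): k\leftarrow\mathsf{KeyGen}(1^\lambda),\ \phi_k\leftarrow\mathsf{StateGen}(k)]\ge 1-\mathsf{negl}(\lambda)$; * ($\epsilon$-one-wayness) for every QPT adversary $\mathcal{A}$ and every polynomial $t$, $\Pr[\top\leftarrow\mathsf{Ver}(k',\phi_k): k\leftarrow\mathsf{KeyGen}(1^\lambda),\ \phi_k\leftarrow\mathsf{StateGen}(k),\ k'\leftarrow\mathcal{A}(1^\lambda,\phi_k^{\otimes t(\lambda)})]\le\epsilon(\lambda)$ for all sufficiently large $\lambda$. It has $m(\lambda)$-qubit outputs if $\phi_k$ is an $m(\lambda)$-qubit state for all $\lambda$ and all $k$ in the support of $\mathsf{KeyGen}(1^\lambda)$. 1. For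 every constant $0<\epsilon<1$ and every $m:\mathbb{N}\to\mathbb{N}$ with $m(\lambda)\le\frac12\log_2\log_2\lambda+O(1)$, there does not exist an $\epsilon$-OWSG with $m(\lambda)$-qubit outputs. 2. More generally, let $C\ge 1$ be a constant, $\Delta:\mathbb{N}\to(0,1]$ and $m:\mathbb{N}\to\mathbb{N}$. If $(6C/\Delta(\lambda))^{2^{2m(\lambda)}}$ is bounded by a polynomial in $\lambda$ for all sufficiently large $\lambda$, then there does not exist a $(1-\Delta)$-OWSG with $m(\lambda)$-qubit outputs. -/

import Mathlib

open Filter Asymptotics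

namespace QOWSG

/-! ### Quantum memory

The quantum memory consists of quantum stacks `0, 1, 2, …`.  The `j`-th qubit from the bottom of
stack `q` is the cell `(q, j)`; a cell that is not in use is in the state `|0⟩`. -/

/-- A qubit, addressed by a stack and a position in it. -/
abbrev Cell := ℕ × ℕ

/-- Computational basis states of the memory. -/
abbrev Basis := Cell → Bool

/-- Unnormalised density operators of the memory: the coefficient at `(x, y)` is `⟨x| ρ |y⟩`.
All of them are finitely supported, since only finitely many qubits are ever in use. -/
abbrev QState := (Basis × Basis) →₀ ℂ

/-- Operators on `n` qubits, as matrices in the computational basis. -/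
abbrev QMat (n : ℕ) := Matrix (Fin n → Bool) (Fin n → Bool) ℂ

/-- The map `ρ ↦ K ρ K†`, where the operator `K` is given by its action `x ↦ K |x⟩` on the
computational basis. -/
noncomputable def conjugate (K : Basis → (Basis →₀ ℂ)) (ρ : QState) : QState :=
  ρ.sum fun p c => (K p.1).sum fun x a => (K p.2).sum fun y b =>
    Finsupp.single (x, y) (a * c * star b)

/-- The one-qubit gate with matrix `U`, applied to the cell `i`. -/
noncomputable def gateOp (U : Matrix Bool Bool ℂ) (i : Cell) : Basis → (Basis →₀ ℂ) :=
  fun x => ∑ b : Bool, Finsupp.single (Function.update x i b) (U b (x i))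

/-- The Hadamard gate. -/
noncomputable def hadamard : Matrix Bool Bool ℂ :=
  fun b a => (if a && b then -1 else 1) / (Real.sqrt 2 : ℂ)

/-- The gate `T = diag(1, exp(iπ/4))`. -/
noncomputable def tGate : Matrix Bool Bool ℂ :=
  Matrix.diagonal fun b => if b then Complex.exp (Complex.I * Real.pi / 4) else 1

/-- The controlled-NOT gate with control `i` and target `j`. -/
noncomputable def cnotOp (i j : Cell) : Basis → (Basis →₀ ℂ) :=
  fun x => Finsupp.single (Function.update x j (xor (x j) (x i))) 1

/-- The exchange of two qubits. -/
noncomputable def swapOp (i j : Cell) : Basis → (Basis →₀ ℂ) :=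
  fun x => Finsupp.single (x ∘ Equiv.swap i j) 1

/-- The measurement of the cell `i` in the computational basis with outcome `o`, after which the
cell is reset to `|0⟩`. -/
noncomputable def measureOp (i : Cell) (o : Bool) : Basis → (Basis →₀ ℂ) :=
  fun x => if x i = o then Finsupp.single (Function.update x i false) 1 else 0

open Classical in
/-- The trace. -/
noncomputable def QState.tr (ρ : QState) : ℂ :=
  ρ.sum fun p c => if p.1 = p.2 then c else 0

/-- The basis state in which stack `0` holds the `n` bits of `u` and all other cells are `0`. -/
def basisOf {n : ℕ} (u : Fin n → Bool) : Basis :=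
  fun i => if h : i.1 = 0 ∧ i.2 < n then u ⟨i.2, h.2⟩ else false

/-- The memory whose stack `0` holds `n` qubits in the state `ρ`. -/
noncomputable def QState.ofMat {n : ℕ} (ρ : QMat n) : QState :=
  ∑ u : Fin n → Bool, ∑ v : Fin n → Bool, Finsupp.single (basisOf u, basisOf v) (ρ u v)

open Classical in
/-- The reduced state of the lowest `n` qubits of stack `0` (all other qubits are traced out). -/
noncomputable def QState.reduce (n : ℕ) (ρ : QState) : QMat n := fun u v =>
  ρ.sum fun p c =>
    if (∀ j : Fin n, p.1 (0, j) = u j) ∧ (∀ j : Fin n, p.2 (0, j) = v j) ∧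
      (∀ i : Cell, ¬ (i.1 = 0 ∧ i.2 < n) → p.1 i = p.2 i) then c else 0

/-- `t` copies of `ρ`: the tensor power `ρ^{⊗ t}`. -/
def tensorPow {m : ℕ} (ρ : QMat m) (t : ℕ) : QMat (t * m) := fun u v =>
  ∏ i : Fin t, ρ (fun j => u (finProdFinEquiv (i, j))) (fun j => v (finProdFinEquiv (i, j)))

/-! ### Programs

A quantum algorithm is a program for a machine with finitely many classical stacks of bits and
finitely many stacks of qubits, with the universal gate set `{H, T, CNOT}`. -/

inductive Prog : Type
  | skip : Prog
  | seq : Prog → Prog → Prog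
  /-- push the bit `b` on the classical stack `v` -/
  | push (v : ℕ) (b : Bool) : Prog
  /-- remove the top bit of the classical stack `v` -/
  | pop (v : ℕ) : Prog
  /-- continue according to whether `v` is empty, has top bit `0`, or has top bit `1` -/
  | branch (v : ℕ) (pEmpty p0 p1 : Prog) : Prog
  /-- repeat the body as long as the classical stack `v` is nonempty -/
  | loop (v : ℕ) (body : Prog) : Prog
  /-- push a fresh qubit `|0⟩` on the quantum stack `q` -/
  | qnew (q : ℕ) : Prog
  /-- apply the Hadamard gate to the top qubit of `q` -/
  | had (q : ℕ) : Prog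
  /-- apply the gate `T` to the top qubit of `q` -/
  | phase (q : ℕ) : Prog
  /-- apply CNOT to the top qubits of `q` (control) and `r` (target), `q ≠ r` -/
  | cnot (q r : ℕ) : Prog
  /-- move the top qubit of `q` to the top of `r`, `q ≠ r` -/
  | qmove (q r : ℕ) : Prog
  /-- measure and remove the top qubit of `q`, and push the outcome on the classical stack `v` -/
  | meas (q v : ℕ) : Prog
  /-- continue according to whether the quantum stack `q` is empty -/
  | qbranch (q : ℕ) (pEmpty pNonempty : Prog) : Prog

/-- Machine configurations: what is left to be executed, the contents of the classical stacks
(top first), the heights of the quantum stacks, and the unnormalised state of the quantum memory,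
whose trace is the probability of the measurement outcomes that have led here. -/
structure Config where
  ctrl : List Prog
  cl : ℕ → List Bool
  ht : ℕ → ℕ
  qu : QState

/-- One step of the machine.  A measurement has two possible successors, all other instructions
have one; a quantum instruction that needs a qubit of an empty stack does nothing. -/
noncomputable def step (c : Config) : List Config :=
  match c.ctrl with
  | [] => [c]
  | Prog.skip :: K => [{ c with ctrl := K }]
  | Prog.seq p p' :: K => [{ c with ctrl := p :: p' :: K }]
  | Prog.push v b :: K => [{ c with ctrl := K, cl := Function.update c.cl v (b :: c.cl v) }]
  | Prog.pop v :: K => [{ c with ctrl := K, cl := Function.update c.cl v (c.cl v).tail }]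
  | Prog.branch v pe p0 p1 :: K =>
      match c.cl v with
      | [] => [{ c with ctrl := pe :: K }]
      | false :: _ => [{ c with ctrl := p0 :: K }]
      | true :: _ => [{ c with ctrl := p1 :: K }]
  | Prog.loop v p :: K =>
      match c.cl v with
      | [] => [{ c with ctrl := K }]
      | _ :: _ => [{ c with ctrl := p :: Prog.loop v p :: K }]
  | Prog.qnew q :: K => [{ c with ctrl := K, ht := Function.update c.ht q (c.ht q + 1) }]
  | Prog.had q :: K =>
      if c.ht q = 0 then [{ c with ctrl := K }]
      else [{ c with ctrl := K, qu := conjugate (gateOp hadamard (q, c.ht q - 1)) c.qu }]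
  | Prog.phase q :: K =>
      if c.ht q = 0 then [{ c with ctrl := K }]
      else [{ c with ctrl := K, qu := conjugate (gateOp tGate (q, c.ht q - 1)) c.qu }]
  | Prog.cnot q r :: K =>
      if c.ht q = 0 ∨ c.ht r = 0 ∨ q = r then [{ c with ctrl := K }]
      else [{ c with
        ctrl := K
        qu := conjugate (cnotOp (q, c.ht q - 1) (r, c.ht r - 1)) c.qu }]
  | Prog.qmove q r :: K =>
      if c.ht q = 0 ∨ q = r then [{ c with ctrl := K }]
      else [{ c with
        ctrl := K
        ht := Function.update (Function.update c.ht q (c.ht q - 1)) r (c.ht r + 1)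
        qu := conjugate (swapOp (q, c.ht q - 1) (r, c.ht r)) c.qu }]
  | Prog.meas q v :: K =>
      if c.ht q = 0 then [{ c with ctrl := K }]
      else [false, true].map fun o =>
        { ctrl := K
          cl := Function.update c.cl v (o :: c.cl v)
          ht := Function.update c.ht q (c.ht q - 1)
          qu := conjugate (measureOp (q, c.ht q - 1) o) c.qu }
  | Prog.qbranch q pe pn :: K =>
      if c.ht q = 0 then [{ c with ctrl := pe :: K }] else [{ c with ctrl := pn :: K }]

/-- All configurations that can be reached in `N` steps, one for each sequence of measurement
outcomes (a configuration with nothing left to execute stays as it is). -/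
noncomputable def run (N : ℕ) (c : Config) : List Config :=
  (fun L : List Config => L.flatMap step)^[N] [c]

/-- The initial configuration of the program `p` on the classical input `w` (in the classical
stack `0`) and `n` input qubits in the state `ρ` (in the quantum stack `0`). -/
noncomputable def start (p : Prog) (w : List Bool) {n : ℕ} (ρ : QMat n) : Config where
  ctrl := [p]
  cl := fun v => if v = 0 then w else []
  ht := fun q => if q = 0 then n else 0
  qu := QState.ofMat ρ

/-- Quantum polynomial-time algorithms for inputs of the format `D`, a set of pairs (classical
input, number of input qubits): programs that halt after a number of steps that is polynomial in
the length of the input, whatever the outcomes of the measurements are. -/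
structure QPT (D : Set (List Bool × ℕ)) where
  prog : Prog
  time : Polynomial ℕ
  halts : ∀ (w : List Bool) (n : ℕ), (w, n) ∈ D → ∀ ρ : QMat n,
    ∀ c ∈ run (time.eval (w.length + n)) (start prog w ρ), c.ctrl = []

namespace QPT

variable {D : Set (List Bool × ℕ)}

/-- The final configurations, one for each sequence of measurement outcomes. -/
noncomputable def final (A : QPT D) (w : List Bool) {n : ℕ} (ρ : QMat n) : List Config :=
  run (A.time.eval (w.length + n)) (start A.prog w ρ)

/-- The expectation of `f y`, where `y` is the classical output (the final content of the
classical stack `0`). -/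
noncomputable def expect (A : QPT D) (w : List Bool) {n : ℕ} (ρ : QMat n)
    (f : List Bool → ℝ) : ℝ :=
  ((A.final w ρ).map fun c => c.qu.tr.re * f (c.cl 0)).sum

/-- The probability that the classical output is `y`. -/
noncomputable def prob (A : QPT D) (w : List Bool) {n : ℕ} (ρ : QMat n) (y : List Bool) : ℝ :=
  A.expect w ρ fun z => if z = y then 1 else 0

/-- The quantum output (the final content of the quantum stack `0`) consists of `m` qubits. -/
def OutputsQubits (A : QPT D) (w : List Bool) {n : ℕ} (ρ : QMat n) (m : ℕ) : Prop :=
  ∀ c ∈ A.final w ρ, c.qu.tr ≠ 0 → c.ht 0 = m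

/-- The state of the quantum output, when it consists of `m` qubits. -/
noncomputable def outState (A : QPT D) (w : List Bool) {n : ℕ} (ρ : QMat n) (m : ℕ) : QMat m :=
  ((A.final w ρ).map fun c => c.qu.reduce m).sum

end QPT

/-! ### One-way state generators -/

/-- The security parameter in unary, `1^n`. -/
def unary (n : ℕ) : List Bool := List.replicate n true

/-- The state of zero qubits. -/
def noQubits : QMat 0 := 1

/-- The syntax of one-way state generators: `KeyGen(1^n) → k`, `StateGen(k) → φ_k` and
`Ver(k', φ_k) → ⊤/⊥`. -/
structure Scheme where
  keyGen : QPT {x | ∃ n, x = (unary n, 0)}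
  stateGen : QPT {x | ∃ k, x = (k, 0)}
  ver : QPT Set.univ

/-- Adversaries `𝒜(1^n, ψ) → k'`. -/
abbrev Adversary := QPT {x | ∃ n r, x = (unary n, r)}

namespace Scheme

/-- `φ_k` is an `m n`-qubit state for all `k` in the support of `KeyGen(1^n)`. -/
def HasQubitOutputs (S : Scheme) (m : ℕ → ℕ) : Prop :=
  ∀ n k, 0 < S.keyGen.prob (unary n) noQubits k → S.stateGen.OutputsQubits k noQubits (m n)

/-- The state `φ_k` of `m` qubits. -/
noncomputable def state (S : Scheme) (m : ℕ) (k : List Bool) : QMat m :=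
  S.stateGen.outState k noQubits m

/-- `Pr[⊤ ← Ver(k', φ)]`; the output `⊤` is encoded as the bit string `1`. -/
noncomputable def accept (S : Scheme) {m : ℕ} (k' : List Bool) (φ : QMat m) : ℝ :=
  S.ver.prob k' φ [true]

/-- `Pr[⊤ ← Ver(k, φ_k) : k ← KeyGen(1^n), φ_k ← StateGen(k)]`. -/
noncomputable def correctProb (S : Scheme) (m : ℕ → ℕ) (n : ℕ) : ℝ :=
  S.keyGen.expect (unary n) noQubits fun k => S.accept k (S.state (m n) k)

/-- `Pr[⊤ ← Ver(k', φ_k) : k ← KeyGen(1^n), φ_k ← StateGen(k), k' ← 𝒜(1^n, φ_k^{⊗ t})]`. -/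
noncomputable def winProb (S : Scheme) (m : ℕ → ℕ) (A : Adversary) (t : ℕ) (n : ℕ) : ℝ :=
  S.keyGen.expect (unary n) noQubits fun k =>
    A.expect (unary n) (tensorPow (S.state (m n) k) t) fun k' =>
      S.accept k' (S.state (m n) k)

/-- Correctness up to a negligible error. -/
def Correct (S : Scheme) (m : ℕ → ℕ) : Prop :=
  ∃ ν : ℕ → ℝ, SuperpolynomialDecay atTop (fun n : ℕ => (n : ℝ)) ν ∧
    ∀ n, 1 - ν n ≤ S.correctProb m n

/-- `ε`-one-wayness: every adversary that gets polynomially many copies of `φ_k` wins with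
probability at most `ε(n)`, for all sufficiently large `n`. -/
def OneWay (S : Scheme) (m : ℕ → ℕ) (ε : ℕ → ℝ) : Prop :=
  ∀ (A : Adversary) (t : Polynomial ℕ), ∀ᶠ n in atTop, S.winProb m A (t.eval n) n ≤ ε n

/-- `S` is an `ε`-one-way state generator with `m`-qubit outputs. -/
def IsOWSG (S : Scheme) (ε : ℕ → ℝ) (m : ℕ → ℕ) : Prop :=
  S.HasQubitOutputs m ∧ S.Correct m ∧ S.OneWay m ε

end Scheme

end QOWSG

/-! The adversary samples `u` keys with `KeyGen`, tests each of them with `Ver` on `u` fresh copies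
of the unknown state, and outputs the key with the longest initial run of successes. Here `u` is a
polynomial in the security parameter, and `u * u` copies suffice.

Why this wins: for each key `k` the acceptance probability of `Ver(k, ·)` is a real linear
functional on the matrices on `m` qubits, a space of real dimension `2 * 4 ^ m`. So the vectors of
all acceptance probabilities of the states `φ_k` lie in the unit ball, for the supremum norm, of a
space of at most that dimension. A volume argument (`exists_cells`) splits the states into at most
`N = (1 + 64 / Δ) ^ (2 * 4 ^ m)` cells such that two states of one cell are accepted by every key
with probabilities that differ by at most `Δ / 16`. The growth hypothesis says that such an `N` is
bounded by a polynomial. By correctness and Markov's inequality, up to weight `Δ / 8` the secret key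
lies in a cell in which `KeyGen` hits, with probability at least `Δ / (16 * N)`, a key that opens
its own state (`heavy_cells`); such a key opens the given state with probability at least `1 - Δ /
8`. A key that opens it with probability below `1 - Δ / 2` almost never passes `R` tests in a row,
while some sampled good key almost surely does, for a suitable `R` (`exists_threshold`,
`trialsValue_ge`). The output therefore wins with probability at least `(1 - Δ / 8) ^ 2 * (1 - Δ /
2) > 1 - Δ` (`lt_expect_search`).

The rest shows that this search is a QPT algorithm of the machine model. Programs are described by
the list of their final data, weighted linearly by probabilities (`Yields`). `KeyGen` and `Ver` are
called as subroutines on shifted stacks, after which everything but the classical output is measured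
and erased, so that the caller's memory is only rescaled (`exists_runs_cleaned`, `Yields.call`).
Since the adversary is not told `m`, it obtains it by counting its input qubits. -/

namespace QOWSG

/-! ### Execution of programs -/

/-- The data of a machine: a configuration without its control. -/
structure Data where
  cl : ℕ → List Bool
  ht : ℕ → ℕ
  qu : QState

/-- The configuration with data `s` and control `P`. -/
def Data.cfg (s : Data) (P : List Prog) : Config := ⟨P, s.cl, s.ht, s.qu⟩

/-- Branches evolve independently; hence a run can be split off at its first step as well as at its
last. -/
theorem iterate_flatMap {α : Type*} (f : α → List α) (N : ℕ) (L : List α) :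
    (fun L : List α => L.flatMap f)^[N] L =
      L.flatMap fun c => (fun L : List α => L.flatMap f)^[N] [c] := by
  induction N generalizing L with
  | zero => simp
  | succ N ih =>
    simp only [Function.iterate_succ, Function.comp]
    rw [ih, List.flatMap_assoc]
    congr 1; funext c
    rw [ih ([c].flatMap f)]; simp

theorem run_zero (c : Config) : run 0 c = [c] := rfl

theorem run_succ (N : ℕ) (c : Config) : run (N + 1) c = (step c).flatMap (run N) := by
  unfold run
  rw [Function.iterate_succ, Function.comp, iterate_flatMap]; simp

theorem run_halted (N : ℕ) (c : Config) (h : c.ctrl = []) : run N c = [c] := by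
  induction N with
  | zero => rfl
  | succ N ih =>
    rw [run_succ]
    have : step c = [c] := by unfold step; rw [h]
    rw [this]; simpa using ih

theorem run_succ' (N : ℕ) (c : Config) : run (N + 1) c = (run N c).flatMap step := by
  unfold run
  rw [Function.iterate_succ', Function.comp]

theorem run_add (M N : ℕ) (c : Config) : run (M + N) c = (run M c).flatMap (run N) := by
  induction M generalizing c with
  | zero => simp [run_zero]
  | succ M ih =>
    rw [Nat.add_right_comm, run_succ, run_succ, List.flatMap_assoc]
    congr 1; funext c; exact ih c

/-- Started on the data `s`, the control `P` halts after at most `N` steps, and `D` lists the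
final data, one for each sequence of measurement outcomes. -/
def Runs (P : List Prog) (s : Data) (N : ℕ) (D : List Data) : Prop :=
  run N (s.cfg P) = D.map fun s' => s'.cfg []

/-- Halted configurations are fixed by `step`, so `N` matters only as an upper bound. -/
theorem Runs.mono {P : List Prog} {s : Data} {N M : ℕ} {D : List Data} (h : Runs P s N D)
    (hNM : N ≤ M) : Runs P s M D := by
  obtain ⟨K, rfl⟩ := Nat.exists_eq_add_of_le hNM
  unfold Runs at *
  rw [run_add, h, List.flatMap_map]
  simp only [fun s' : Data => run_halted K (s'.cfg []) rfl]
  rw [← List.map_eq_flatMap]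

theorem Runs.nil (s : Data) (N : ℕ) : Runs [] s N [s] := by
  unfold Runs; rw [run_halted _ _ rfl]; rfl

theorem Runs.of_step {P P' : List Prog} {s s' : Data} {N : ℕ} {D : List Data}
    (hs : step (s.cfg P) = [s'.cfg P']) (h : Runs P' s' N D) : Runs P s (N + 1) D := by
  unfold Runs at *
  rw [run_succ, hs]; simpa using h

theorem step_append (p : Prog) (P K : List Prog) (s : Data) :
    step (s.cfg (p :: P ++ K)) =
      (step (s.cfg (p :: P))).map fun c => ⟨c.ctrl ++ K, c.cl, c.ht, c.qu⟩ := by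
  obtain ⟨cl, ht, qu⟩ := s
  cases p with
  | branch v pe p0 p1 =>
    simp only [step, Data.cfg, List.cons_append]
    split <;> rfl
  | loop v p =>
    simp only [step, Data.cfg, List.cons_append]
    split <;> rfl
  | had q => by_cases h : ht q = 0 <;> simp [step, Data.cfg, h]
  | phase q => by_cases h : ht q = 0 <;> simp [step, Data.cfg, h]
  | cnot q r =>
    by_cases h : ht q = 0 ∨ ht r = 0 ∨ q = r <;> simp [step, Data.cfg, h]
  | qmove q r => by_cases h : ht q = 0 ∨ q = r <;> simp [step, Data.cfg, h]
  | meas q v => by_cases h : ht q = 0 <;> simp [step, Data.cfg, h]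
  | qbranch q pe pn => by_cases h : ht q = 0 <;> simp [step, Data.cfg, h]
  | _ => rfl

/-- The branches may finish their control at different times, which leaves different amounts of time
for `K`. This is why `hF` asks for the same result after every `M' ≥ M` steps. -/
theorem run_append (K : List Prog) (N : ℕ) (M : ℕ) (c : Config) (hN : ∀ c' ∈ run N c, c'.ctrl = [])
    (F : Config → List Config)
    (hF : ∀ c' ∈ run N c, ∀ M' ≥ M, run M' ⟨K, c'.cl, c'.ht, c'.qu⟩ = F c') :
    ∀ M' ≥ N + M, run M' ⟨c.ctrl ++ K, c.cl, c.ht, c.qu⟩ = (run N c).flatMap F := by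
  induction N generalizing c with
  | zero =>
    intro M' hM'
    have h1 := hN c (by simp [run_zero])
    have h2 := hF c (by simp [run_zero]) M' (by omega)
    simp [run_zero, h1, h2]
  | succ N ih =>
    intro M' hM'
    obtain ⟨P, cl, ht, qu⟩ := c
    cases P with
    | nil =>
      have h0 : run (N + 1) ⟨[], cl, ht, qu⟩ = [⟨[], cl, ht, qu⟩] := run_halted _ _ rfl
      have h2 := hF ⟨[], cl, ht, qu⟩ (by simp [h0]) M' (by omega)
      simp only [h0, List.nil_append, h2]; simp
    | cons p P =>
      obtain ⟨M', rfl⟩ : ∃ M'', M' = M'' + 1 := ⟨M' - 1, by omega⟩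
      have h1 := step_append p P K ⟨cl, ht, qu⟩
      simp only [Data.cfg] at h1
      rw [run_succ, run_succ, h1, List.flatMap_map, List.flatMap_assoc]
      apply List.flatMap_congr
      intro c' hc'
      have hsub : ∀ d ∈ run N c', d ∈ run (N + 1) ⟨p :: P, cl, ht, qu⟩ := by
        intro d hd; rw [run_succ]; exact List.mem_flatMap.2 ⟨c', hc', hd⟩
      exact ih c' (fun d hd => hN d (hsub d hd)) (fun d hd => hF d (hsub d hd)) M' (by omega)

theorem Runs.append {P K : List Prog} {s : Data} {N M : ℕ} {D : List Data} {F : Data → List Data}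
    (h : Runs P s N D) (hK : ∀ s' ∈ D, Runs K s' M (F s')) :
    Runs (P ++ K) s (N + M) (D.flatMap F) := by
  have hmem : ∀ c ∈ run N (s.cfg P), ∃ s' ∈ D, c = s'.cfg [] := by
    intro c hc; rw [h] at hc
    obtain ⟨s', h1, h2⟩ := List.mem_map.1 hc
    exact ⟨s', h1, h2.symm⟩
  have := run_append K N M (s.cfg P) (by rintro c hc; obtain ⟨s', -, rfl⟩ := hmem c hc; rfl)
    (fun c => (F ⟨c.cl, c.ht, c.qu⟩).map fun s' => s'.cfg []) (by
      rintro c hc M' hM'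
      obtain ⟨s', h1, rfl⟩ := hmem c hc
      exact (hK s' h1).mono hM') (N + M) le_rfl
  unfold Runs
  rw [h, List.flatMap_map] at this
  rw [List.map_flatMap]
  exact this

theorem Runs.cons {p : Prog} {K : List Prog} {s : Data} {N M : ℕ} {D : List Data}
    {F : Data → List Data} (h : Runs [p] s N D) (hK : ∀ s' ∈ D, Runs K s' M (F s')) :
    Runs (p :: K) s (N + M) (D.flatMap F) :=
  Runs.append h hK

theorem Runs.seq {p q : Prog} {s : Data} {N M : ℕ} {D : List Data} {F : Data → List Data}
    (h : Runs [p] s N D) (hK : ∀ s' ∈ D, Runs [q] s' M (F s')) :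
    Runs [p.seq q] s (N + M + 1) (D.flatMap F) :=
  Runs.of_step (s' := s) (P' := [p, q]) rfl (h.cons hK)

theorem Runs.of_forall_halted {P : List Prog} {s : Data} {N : ℕ}
    (h : ∀ c ∈ run N (s.cfg P), c.ctrl = []) :
    Runs P s N ((run N (s.cfg P)).map fun c => ⟨c.cl, c.ht, c.qu⟩) := by
  unfold Runs
  rw [List.map_map]
  conv_lhs => rw [← List.map_id (run N (s.cfg P))]
  apply List.map_congr_left
  intro c hc
  have := h c hc
  cases c; simp_all [Data.cfg]

theorem Runs.halted {P : List Prog} {s : Data} {N : ℕ} {D : List Data} (h : Runs P s N D) :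
    ∀ c ∈ run N (s.cfg P), c.ctrl = [] := by
  intro c hc; rw [h] at hc
  obtain ⟨s', -, rfl⟩ := List.mem_map.1 hc; rfl

/-! ### Linearity in the quantum memory -/

/-- The linear map `ρ ↦ K ρ K†`. -/
noncomputable def conjugateₗ (K : Basis → (Basis →₀ ℂ)) : QState →ₗ[ℂ] QState :=
  Finsupp.lsum ℂ fun p => LinearMap.toSpanSingleton ℂ QState
    ((K p.1).sum fun x a => (K p.2).sum fun y b => Finsupp.single (x, y) (a * star b))

theorem conjugateₗ_apply (K : Basis → (Basis →₀ ℂ)) (ρ : QState) :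
    conjugateₗ K ρ = conjugate K ρ := by
  unfold conjugateₗ conjugate
  rw [Finsupp.lsum_apply]
  apply Finsupp.sum_congr
  intro p _
  rw [LinearMap.toSpanSingleton_apply, Finsupp.smul_sum]
  apply Finsupp.sum_congr
  intro x _
  rw [Finsupp.smul_sum]
  apply Finsupp.sum_congr
  intro y _
  rw [Finsupp.smul_single, smul_eq_mul]
  congr 1; ring

theorem conjugate_single (K : Basis → (Basis →₀ ℂ)) (x y : Basis) (c : ℂ) :
    conjugate K (Finsupp.single (x, y) c) =
      c • (K x).sum fun x' a => (K y).sum fun y' b => Finsupp.single (x', y') (a * star b) := by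
  rw [← conjugateₗ_apply]; unfold conjugateₗ
  rw [Finsupp.lsum_single, LinearMap.toSpanSingleton_apply]

theorem conjugate_zero (K : Basis → (Basis →₀ ℂ)) : conjugate K 0 = 0 := by
  rw [← conjugateₗ_apply, map_zero]

/-- Classical part of a configuration. -/
structure Shape where
  ctrl : List Prog
  cl : ℕ → List Bool
  ht : ℕ → ℕ

/-- The configuration with classical part `sh` and memory `q`. -/
def Shape.cfg (sh : Shape) (q : QState) : Config := ⟨sh.ctrl, sh.cl, sh.ht, q⟩

/-- Control flow only looks at the classical stacks and the heights, and each gate or measurement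
branch is linear in the memory. So a single list `L` serves all memories. -/
theorem exists_step_linear (sh : Shape) : ∃ L : List (Shape × (QState →ₗ[ℂ] QState)),
    ∀ q, step (sh.cfg q) = L.map fun x => x.1.cfg (x.2 q) := by
  obtain ⟨P, cl, ht⟩ := sh
  have key : ∀ (sh' : Shape) (Φ : QState →ₗ[ℂ] QState),
      (∀ q, step (Shape.cfg ⟨P, cl, ht⟩ q) = [sh'.cfg (Φ q)]) →
      ∃ L : List (Shape × (QState →ₗ[ℂ] QState)),
        ∀ q, step (Shape.cfg ⟨P, cl, ht⟩ q) = L.map fun x => x.1.cfg (x.2 q) :=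
    fun sh' Φ h => ⟨[(sh', Φ)], fun q => by rw [h q]; rfl⟩
  match P with
  | [] => exact key ⟨[], cl, ht⟩ LinearMap.id fun q => rfl
  | .skip :: K => exact key ⟨K, cl, ht⟩ LinearMap.id fun q => rfl
  | .seq p p' :: K => exact key ⟨p :: p' :: K, cl, ht⟩ LinearMap.id fun q => rfl
  | .push v b :: K => exact key ⟨K, Function.update cl v (b :: cl v), ht⟩ LinearMap.id fun q => rfl
  | .pop v :: K => exact key ⟨K, Function.update cl v (cl v).tail, ht⟩ LinearMap.id fun q => rfl
  | .branch v pe p0 p1 :: K =>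
    rcases h : cl v with _ | ⟨_ | _, l⟩
    · exact key ⟨pe :: K, cl, ht⟩ LinearMap.id fun q => by simp [step, Shape.cfg, h]
    · exact key ⟨p0 :: K, cl, ht⟩ LinearMap.id fun q => by simp [step, Shape.cfg, h]
    · exact key ⟨p1 :: K, cl, ht⟩ LinearMap.id fun q => by simp [step, Shape.cfg, h]
  | .loop v p :: K =>
    rcases h : cl v with _ | ⟨b, l⟩
    · exact key ⟨K, cl, ht⟩ LinearMap.id fun q => by simp [step, Shape.cfg, h]
    · exact key ⟨p :: .loop v p :: K, cl, ht⟩ LinearMap.id fun q => by simp [step, Shape.cfg, h]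
  | .qnew r :: K => exact key ⟨K, cl, Function.update ht r (ht r + 1)⟩ LinearMap.id fun q => rfl
  | .had r :: K =>
    by_cases h : ht r = 0
    · exact key ⟨K, cl, ht⟩ LinearMap.id fun q => by simp [step, Shape.cfg, h]
    · exact key ⟨K, cl, ht⟩ (conjugateₗ (gateOp hadamard (r, ht r - 1))) fun q => by
        simp [step, Shape.cfg, h, conjugateₗ_apply]
  | .phase r :: K =>
    by_cases h : ht r = 0
    · exact key ⟨K, cl, ht⟩ LinearMap.id fun q => by simp [step, Shape.cfg, h]
    · exact key ⟨K, cl, ht⟩ (conjugateₗ (gateOp tGate (r, ht r - 1))) fun q => by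
        simp [step, Shape.cfg, h, conjugateₗ_apply]
  | .cnot r r' :: K =>
    by_cases h : ht r = 0 ∨ ht r' = 0 ∨ r = r'
    · exact key ⟨K, cl, ht⟩ LinearMap.id fun q => by simp [step, Shape.cfg, h]
    · exact key ⟨K, cl, ht⟩ (conjugateₗ (cnotOp (r, ht r - 1) (r', ht r' - 1))) fun q => by
        simp only [step, Shape.cfg, h, conjugateₗ_apply, if_false]
  | .qmove r r' :: K =>
    by_cases h : ht r = 0 ∨ r = r'
    · exact key ⟨K, cl, ht⟩ LinearMap.id fun q => by simp [step, Shape.cfg, h]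
    · exact key ⟨K, cl, Function.update (Function.update ht r (ht r - 1)) r' (ht r' + 1)⟩
        (conjugateₗ (swapOp (r, ht r - 1) (r', ht r'))) fun q => by
        simp only [step, Shape.cfg, h, conjugateₗ_apply, if_false]
  | .meas r v :: K =>
    by_cases h : ht r = 0
    · exact key ⟨K, cl, ht⟩ LinearMap.id fun q => by simp [step, Shape.cfg, h]
    · exact ⟨[false, true].map fun o => (⟨K, Function.update cl v (o :: cl v),
        Function.update ht r (ht r - 1)⟩, conjugateₗ (measureOp (r, ht r - 1) o)), fun q => by
        simp [step, Shape.cfg, h, conjugateₗ_apply]⟩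
  | .qbranch r pe pn :: K =>
    by_cases h : ht r = 0
    · exact key ⟨pe :: K, cl, ht⟩ LinearMap.id fun q => by simp [step, Shape.cfg, h]
    · exact key ⟨pn :: K, cl, ht⟩ LinearMap.id fun q => by simp [step, Shape.cfg, h]

/-- The classical data do not depend on the quantum memory, on which the machine acts linearly. -/
theorem exists_run_linear (N : ℕ) (sh : Shape) : ∃ L : List (Shape × (QState →ₗ[ℂ] QState)),
    ∀ q, run N (sh.cfg q) = L.map fun x => x.1.cfg (x.2 q) := by
  induction N generalizing sh with
  | zero => exact ⟨[(sh, LinearMap.id)], fun q => rfl⟩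
  | succ N ih =>
    obtain ⟨L, hL⟩ := exists_step_linear sh
    choose F hF using ih
    refine ⟨L.flatMap fun x => (F x.1).map fun y => (y.1, y.2.comp x.2), fun q => ?_⟩
    rw [run_succ, hL, List.flatMap_map, List.map_flatMap]
    congr 1; funext x
    rw [hF, List.map_map]; rfl

/-- A `QPT` has to halt on every matrix, not only on density matrices; this reduces halting to one
conveniently chosen memory. -/
theorem run_halted_of_shape {N : ℕ} {sh : Shape} {q q' : QState}
    (h : ∀ c ∈ run N (sh.cfg q), c.ctrl = []) : ∀ c ∈ run N (sh.cfg q'), c.ctrl = [] := by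
  obtain ⟨L, hL⟩ := exists_run_linear N sh
  rw [hL] at h ⊢
  intro c hc
  obtain ⟨x, hx, rfl⟩ := List.mem_map.1 hc
  exact h (x.1.cfg (x.2 q)) (List.mem_map.2 ⟨x, hx, rfl⟩)

/-! ### Traces -/

theorem conjugate_add (K : Basis → (Basis →₀ ℂ)) (ρ σ : QState) :
    conjugate K (ρ + σ) = conjugate K ρ + conjugate K σ := by
  simp only [← conjugateₗ_apply, map_add]

theorem conjugate_smul (K : Basis → (Basis →₀ ℂ)) (a : ℂ) (ρ : QState) :
    conjugate K (a • ρ) = a • conjugate K ρ := by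
  simp only [← conjugateₗ_apply, map_smul]

/-- The linear functional on the memory with values `f x y` on `|x⟩⟨y|`. -/
noncomputable def pairing (f : Basis → Basis → ℂ) : QState →ₗ[ℂ] ℂ :=
  Finsupp.lsum ℂ fun p => LinearMap.toSpanSingleton ℂ ℂ (f p.1 p.2)

theorem pairing_apply (f : Basis → Basis → ℂ) (ρ : QState) :
    pairing f ρ = ρ.sum fun p c => c * f p.1 p.2 := by
  rw [pairing, Finsupp.lsum_apply]; rfl

theorem pairing_single (f : Basis → Basis → ℂ) (p : Basis × Basis) (c : ℂ) :
    pairing f (Finsupp.single p c) = c * f p.1 p.2 := by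
  simp [pairing_apply]

/-- The Heisenberg picture: `K` acts on the functional instead of the state, so that trace
preservation and positivity become identities between functions on pairs of basis states. -/
theorem pairing_conjugate (f : Basis → Basis → ℂ) (K : Basis → (Basis →₀ ℂ)) (ρ : QState) :
    pairing f (conjugate K ρ) = pairing (fun x y =>
      (K x).sum fun x' a => (K y).sum fun y' b => a * star b * f x' y') ρ := by
  rw [← conjugateₗ_apply, ← LinearMap.comp_apply]
  congr 1
  apply Finsupp.lhom_ext
  rintro ⟨x, y⟩ c
  rw [LinearMap.comp_apply, conjugateₗ_apply, conjugate_single, map_smul, pairing_single,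
    map_finsuppSum]
  simp only [map_finsuppSum, pairing_single, smul_eq_mul]

open Classical in
theorem tr_eq_pairing (ρ : QState) : ρ.tr = pairing (fun x y => if x = y then 1 else 0) ρ := by
  rw [pairing_apply]; unfold QState.tr
  simp

theorem tr_add (ρ σ : QState) : (ρ + σ).tr = ρ.tr + σ.tr := by simp [tr_eq_pairing]

theorem tr_smul (a : ℂ) (ρ : QState) : (a • ρ).tr = a * ρ.tr := by simp [tr_eq_pairing]

theorem tr_zero : (0 : QState).tr = 0 := by simp [tr_eq_pairing]

theorem tr_single (x : Basis) (a : ℂ) : QState.tr (Finsupp.single (x, x) a) = a := by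
  simp [tr_eq_pairing, pairing_single]

theorem gateOp_sum (U : Matrix Bool Bool ℂ) (i : Cell) (x : Basis) (h : Basis → ℂ → ℂ)
    (h0 : ∀ y, h y 0 = 0) (ha : ∀ y a b, h y (a + b) = h y a + h y b) :
    (gateOp U i x).sum h = ∑ b : Bool, h (Function.update x i b) (U b (x i)) := by
  unfold gateOp
  rw [← Finsupp.sum_finsetSum_index h0 ha]
  simp [h0]

theorem update_eq_update_iff {x y : Basis} {i : Cell} {b b' : Bool} :
    Function.update x i b = Function.update y i b' ↔ b = b' ∧ ∀ j, j ≠ i → x j = y j := by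
  constructor
  · intro h
    refine ⟨by simpa using congrFun h i, fun j hj => by simpa [hj] using congrFun h j⟩
  · rintro ⟨rfl, h⟩
    funext j
    by_cases hj : j = i
    · subst hj; simp
    · simp [hj, h j hj]

theorem eq_iff_of_cell {x y : Basis} (i : Cell) :
    x = y ↔ x i = y i ∧ ∀ j, j ≠ i → x j = y j := by
  constructor
  · rintro rfl; simp
  · rintro ⟨h1, h2⟩
    funext j
    by_cases hj : j = i
    · rw [hj, h1]
    · exact h2 j hj

/-- Only pairs of basis states that agree off the cell `i` contribute, and for these the sum is the
orthonormality of the columns of `U`. -/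
theorem tr_conjugate_gateOp (U : Matrix Bool Bool ℂ) (i : Cell) (ρ : QState)
    (hU : ∀ a a', ∑ b, U b a * star (U b a') = if a = a' then 1 else 0) :
    (conjugate (gateOp U i) ρ).tr = ρ.tr := by
  classical
  rw [tr_eq_pairing, tr_eq_pairing, pairing_conjugate]
  congr 2
  funext x y
  have h1 : ∀ (x' : Basis) (a : ℂ), ((gateOp U i y).sum fun y' b =>
      a * star b * if x' = y' then 1 else 0) =
      ∑ b' : Bool, a * star (U b' (y i)) * if x' = Function.update y i b' then 1 else 0 :=
    fun x' a => gateOp_sum U i y _ (by simp) (by intros; simp only [star_add]; ring)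
  simp only [h1]
  rw [gateOp_sum U i x _ (by simp) (by
    intros; simp only [add_mul, Finset.sum_add_distrib])]
  simp only [update_eq_update_iff]
  rw [eq_iff_of_cell i]
  by_cases h : ∀ j, j ≠ i → x j = y j
  · have := hU (x i) (y i)
    refine Eq.trans ?_ (this.trans ?_)
    · apply Finset.sum_congr rfl
      intro b _
      simp only [and_iff_left h, mul_ite, mul_one, mul_zero, Finset.sum_ite_eq, Finset.mem_univ,
        if_true]
    · congr 1; exact propext (and_iff_left h).symm
  · simp only [h, and_false, if_false, mul_zero, Finset.sum_const_zero]

theorem hadamard_unitary (a a' : Bool) :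
    ∑ b, hadamard b a * star (hadamard b a') = if a = a' then 1 else 0 := by
  have h2 : ((Real.sqrt 2 : ℝ) : ℂ) * (Real.sqrt 2 : ℝ) = 2 := by
    rw [← Complex.ofReal_mul, Real.mul_self_sqrt (by norm_num)]; norm_num
  have h0 : ((Real.sqrt 2 : ℝ) : ℂ) ≠ 0 := by
    intro h; rw [h] at h2; norm_num at h2
  cases a <;> cases a' <;> simp [hadamard, Complex.conj_ofReal] <;> field_simp <;>
    (try rw [pow_two, h2]) <;> norm_num

theorem tGate_unitary (a a' : Bool) :
    ∑ b, tGate b a * star (tGate b a') = if a = a' then 1 else 0 := by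
  have h : Complex.exp (Complex.I * Real.pi / 4) *
      star (Complex.exp (Complex.I * Real.pi / 4)) = 1 := by
    rw [Complex.star_def, Complex.mul_conj, Complex.normSq_eq_norm_sq, Complex.norm_exp]
    simp
  cases a <;> cases a' <;> simp [tGate, Matrix.diagonal_apply]
  simpa using h

theorem pairing_conjugate_single (f : Basis → Basis → ℂ) (g : Basis → Basis) (ρ : QState) :
    pairing f (conjugate (fun x => Finsupp.single (g x) 1) ρ) =
      pairing (fun x y => f (g x) (g y)) ρ := by
  rw [pairing_conjugate]
  simp

theorem tr_conjugate_of_injective (g : Basis → Basis) (hg : Function.Injective g) (ρ : QState) :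
    (conjugate (fun x => Finsupp.single (g x) 1) ρ).tr = ρ.tr := by
  classical
  rw [tr_eq_pairing, tr_eq_pairing, pairing_conjugate_single]
  simp only [hg.eq_iff]

theorem tr_conjugate_cnotOp {i j : Cell} (hij : i ≠ j) (ρ : QState) :
    (conjugate (cnotOp i j) ρ).tr = ρ.tr := by
  apply tr_conjugate_of_injective
  have : Function.Involutive fun x : Basis => Function.update x j (xor (x j) (x i)) := by
    intro x; funext k
    by_cases hk : k = j
    · subst hk; simp [hij]
    · simp [hk]
  exact this.injective

theorem tr_conjugate_swapOp (i j : Cell) (ρ : QState) :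
    (conjugate (swapOp i j) ρ).tr = ρ.tr := by
  apply tr_conjugate_of_injective
  exact (Equiv.swap i j).surjective.injective_comp_right

theorem tr_conjugate_measureOp (i : Cell) (ρ : QState) :
    (conjugate (measureOp i false) ρ).tr + (conjugate (measureOp i true) ρ).tr = ρ.tr := by
  classical
  simp only [tr_eq_pairing]
  rw [pairing_conjugate, pairing_conjugate, pairing_apply, pairing_apply, pairing_apply,
    ← Finsupp.sum_add]
  apply Finsupp.sum_congr
  rintro ⟨x, y⟩ _
  rw [← mul_add]
  congr 1
  dsimp only
  rw [eq_iff_of_cell i]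
  cases hx : x i <;> cases hy : y i <;> 
    simp [measureOp, hx, hy, Finsupp.single_apply, update_eq_update_iff, eq_comm]

theorem sum_tr_step (c : Config) : ((step c).map fun c' => c'.qu.tr).sum = c.qu.tr := by
  obtain ⟨P, cl, ht, qu⟩ := c
  match P with
  | [] => simp [step]
  | .skip :: K => simp [step]
  | .seq p p' :: K => simp [step]
  | .push v b :: K => simp [step]
  | .pop v :: K => simp [step]
  | .branch v pe p0 p1 :: K =>
    rcases h : cl v with _ | ⟨_ | _, l⟩ <;> simp [step, h]
  | .loop v p :: K => rcases h : cl v with _ | ⟨b, l⟩ <;> simp [step, h]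
  | .qnew r :: K => simp [step]
  | .had r :: K =>
    by_cases h : ht r = 0 <;> simp [step, h, tr_conjugate_gateOp _ _ _ hadamard_unitary]
  | .phase r :: K =>
    by_cases h : ht r = 0 <;> simp [step, h, tr_conjugate_gateOp _ _ _ tGate_unitary]
  | .cnot r r' :: K =>
    by_cases h : ht r = 0 ∨ ht r' = 0 ∨ r = r'
    · simp [step, h]
    · have : (r, ht r - 1) ≠ (r', ht r' - 1) := by
        intro e; exact h (Or.inr (Or.inr (Prod.ext_iff.1 e).1))
      simp [step, h, tr_conjugate_cnotOp this]
  | .qmove r r' :: K =>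
    by_cases h : ht r = 0 ∨ r = r' <;> simp [step, h, tr_conjugate_swapOp]
  | .meas r v :: K =>
    by_cases h : ht r = 0 <;> simp [step, h, tr_conjugate_measureOp]
  | .qbranch r pe pn :: K => by_cases h : ht r = 0 <;> simp [step, h]

theorem sum_map_flatMap {α β : Type*} (L : List α) (F : α → List β) (f : β → ℂ) :
    ((L.flatMap F).map f).sum = (L.map fun a => ((F a).map f).sum).sum := by
  induction L with
  | nil => simp
  | cons a L ih => simp [ih]

/-- Conservation of probability over all sequences of outcomes. -/
theorem sum_tr_run (N : ℕ) (c : Config) : ((run N c).map fun c' => c'.qu.tr).sum = c.qu.tr := by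
  induction N generalizing c with
  | zero => simp [run_zero]
  | succ N ih =>
    rw [run_succ, sum_map_flatMap]
    simp only [ih]
    exact sum_tr_step c

/-! ### Invariants -/

/-- The index lets the invariant weaken with time, as needed for stack heights, which grow by at
most one per step. -/
theorem run_invariant (I : ℕ → Config → Prop)
    (hI : ∀ i c, I i c → ∀ c' ∈ step c, I (i + 1) c') (N i : ℕ) (c : Config) (hc : I i c) :
    ∀ c' ∈ run N c, I (i + N) c' := by
  induction N with
  | zero => intro c' h; simp [run_zero] at h; simpa [h] using hc
  | succ N ih =>
    intro c' h
    rw [run_succ'] at h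
    obtain ⟨d, hd, hd'⟩ := List.mem_flatMap.1 h
    exact hI _ d (ih d hd) c' hd'

/-! ### Positivity -/

open scoped ComplexOrder

/-- Positive semidefinite states of the memory. -/
def QState.Pos (ρ : QState) : Prop := ∀ w : Basis → ℂ, 0 ≤ pairing (fun x y => star (w x) * w y) ρ

theorem QState.Pos.conjugate {ρ : QState} (h : ρ.Pos) (K : Basis → (Basis →₀ ℂ)) :
    (conjugate K ρ).Pos := by
  intro w
  rw [pairing_conjugate]
  -- The test vector is `K† w`.
  convert h (fun x => star ((K x).sum fun x' a => a * star (w x'))) using 2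
  congr 1
  funext x y
  rw [star_star, Finsupp.sum_mul]
  apply Finsupp.sum_congr
  intro x' _
  simp only [Finsupp.sum, star_sum, Finset.mul_sum]
  apply Finset.sum_congr rfl
  intro y' _
  simp only [star_mul, star_star]
  ring

theorem QState.Pos.zero : (0 : QState).Pos := fun w => by simp

theorem QState.Pos.add {ρ σ : QState} (h : ρ.Pos) (h' : σ.Pos) : (ρ + σ).Pos := fun w => by
  rw [map_add]; exact add_nonneg (h w) (h' w)

theorem QState.Pos.tr_nonneg {ρ : QState} (h : ρ.Pos) : 0 ≤ ρ.tr := by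
  classical
  -- The trace is the sum of the quadratic form over the basis vectors that meet the finite support.
  have : ρ.tr = ∑ z ∈ ρ.support.image Prod.fst,
      pairing (fun x y => star (if x = z then (1 : ℂ) else 0) * if y = z then 1 else 0) ρ := by
    simp only [pairing_apply, QState.tr, Finsupp.sum]
    rw [Finset.sum_comm]
    apply Finset.sum_congr rfl
    rintro ⟨x, y⟩ hp
    rw [← Finset.mul_sum]
    have : ∀ z, (star (if x = z then (1 : ℂ) else 0) * if y = z then 1 else 0) =
        if x = z then (if y = z then 1 else 0) else 0 := by
      intro z; split_ifs <;> simp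
    simp only [this, Finset.sum_ite_eq]
    rw [if_pos (Finset.mem_image_of_mem Prod.fst hp)]
    simp only [mul_ite, mul_one, mul_zero]
    simp [eq_comm]
  rw [this]
  exact Finset.sum_nonneg fun z _ => h _

theorem Pos.step {c : Config} (h : c.qu.Pos) : ∀ c' ∈ step c, c'.qu.Pos := by
  obtain ⟨P, cl, ht, qu⟩ := c
  have h : qu.Pos := h
  intro c' hc'
  match P with
  | [] => simp [QOWSG.step] at hc'; subst hc'; exact h
  | .skip :: K => simp [QOWSG.step] at hc'; subst hc'; exact h
  | .seq p p' :: K => simp [QOWSG.step] at hc'; subst hc'; exact h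
  | .push v b :: K => simp [QOWSG.step] at hc'; subst hc'; exact h
  | .pop v :: K => simp [QOWSG.step] at hc'; subst hc'; exact h
  | .branch v pe p0 p1 :: K =>
    rcases e : cl v with _ | ⟨_ | _, l⟩ <;> simp [QOWSG.step, e] at hc' <;> subst hc' <;> exact h
  | .loop v p :: K =>
    rcases e : cl v with _ | ⟨b, l⟩ <;> simp [QOWSG.step, e] at hc' <;> subst hc' <;> exact h
  | .qnew r :: K => simp [QOWSG.step] at hc'; subst hc'; exact h
  | .had r :: K =>
    by_cases e : ht r = 0 <;> simp [QOWSG.step, e] at hc' <;> subst hc'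
    exacts [h, h.conjugate _]
  | .phase r :: K =>
    by_cases e : ht r = 0 <;> simp [QOWSG.step, e] at hc' <;> subst hc'
    exacts [h, h.conjugate _]
  | .cnot r r' :: K =>
    by_cases e : ht r = 0 ∨ ht r' = 0 ∨ r = r' <;> simp [QOWSG.step, e] at hc' <;> subst hc'
    exacts [h, h.conjugate _]
  | .qmove r r' :: K =>
    by_cases e : ht r = 0 ∨ r = r' <;> simp [QOWSG.step, e] at hc' <;> subst hc'
    exacts [h, h.conjugate _]
  | .meas r v :: K =>
    by_cases e : ht r = 0 <;> simp [QOWSG.step, e] at hc'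
    · subst hc'; exact h
    · rcases hc' with rfl | rfl <;> exact h.conjugate _
  | .qbranch r pe pn :: K =>
    by_cases e : ht r = 0 <;> simp [QOWSG.step, e] at hc' <;> subst hc' <;> exact h

theorem Pos.run {c : Config} (h : c.qu.Pos) (N : ℕ) : ∀ c' ∈ run N c, c'.qu.Pos :=
  run_invariant (fun _ c => c.qu.Pos) (fun _ _ h => Pos.step h) N 0 c h

/-! ### Density matrices and reduced states. -/

/-- Density matrices. -/
def IsDensity {n : ℕ} (φ : QMat n) : Prop :=
  (∀ w : (Fin n → Bool) → ℂ, 0 ≤ ∑ u, ∑ v, φ u v * (star (w u) * w v)) ∧ ∑ u, φ u u = 1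

theorem pairing_ofMat (f : Basis → Basis → ℂ) {n : ℕ} (φ : QMat n) :
    pairing f (QState.ofMat φ) = ∑ u, ∑ v, φ u v * f (basisOf u) (basisOf v) := by
  simp [QState.ofMat, pairing_single]

theorem basisOf_injective {n : ℕ} : Function.Injective (basisOf (n := n)) := by
  intro u v h; funext j
  have := congrFun h (0, (j : ℕ))
  simpa [basisOf] using this

theorem tr_ofMat {n : ℕ} (φ : QMat n) : (QState.ofMat φ).tr = ∑ u, φ u u := by
  classical
  rw [tr_eq_pairing, pairing_ofMat]
  simp [basisOf_injective.eq_iff]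

theorem IsDensity.pos {n : ℕ} {φ : QMat n} (h : IsDensity φ) : (QState.ofMat φ).Pos := by
  intro w
  rw [pairing_ofMat]
  exact h.1 fun u => w (basisOf u)

theorem isDensity_noQubits : IsDensity noQubits := by
  constructor
  · intro w
    simp only [Finset.univ_unique, Finset.sum_singleton, noQubits, Matrix.one_apply_eq, one_mul]
    exact star_mul_self_nonneg _
  · simp [noQubits]

/-- The part of a basis state that is traced out by `QState.reduce`. -/
def envOf (n : ℕ) (x : Basis) : Basis := fun i => if i.1 = 0 ∧ i.2 < n then false else x i

/-- The part of a basis state that is kept by `QState.reduce`. -/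
def bitsOf (n : ℕ) (x : Basis) : Fin n → Bool := fun j => x (0, j)

theorem envOf_eq_iff {n : ℕ} {x y : Basis} :
    envOf n x = envOf n y ↔ ∀ i : Cell, ¬ (i.1 = 0 ∧ i.2 < n) → x i = y i := by
  constructor
  · intro h i hi
    simpa [envOf, hi] using congrFun h i
  · intro h; funext i
    by_cases hi : i.1 = 0 ∧ i.2 < n
    · simp [envOf, hi]
    · simpa [envOf, hi] using h i hi

theorem eq_iff_bits_env {n : ℕ} {x y : Basis} :
    x = y ↔ bitsOf n x = bitsOf n y ∧ envOf n x = envOf n y := by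
  constructor
  · rintro rfl; simp
  · rintro ⟨h1, h2⟩
    rw [envOf_eq_iff] at h2
    funext i
    by_cases hi : i.1 = 0 ∧ i.2 < n
    · obtain ⟨q, j⟩ := i
      obtain ⟨rfl, hj⟩ := hi
      exact congrFun h1 ⟨j, hj⟩
    · exact h2 i hi

open Classical in
theorem reduce_eq_pairing (n : ℕ) (ρ : QState) (u v : Fin n → Bool) :
    ρ.reduce n u v = pairing (fun x y =>
      if bitsOf n x = u ∧ bitsOf n y = v ∧ envOf n x = envOf n y then 1 else 0) ρ := by
  rw [pairing_apply]
  unfold QState.reduce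
  apply Finsupp.sum_congr
  rintro ⟨x, y⟩ _
  simp only [envOf_eq_iff, mul_ite, mul_one, mul_zero]
  congr 1
  simp only [funext_iff, bitsOf]

-- The partial trace is dual to extending a functional by the identity on the environment.
open Classical in
theorem sum_reduce (n : ℕ) (ρ : QState) (g : (Fin n → Bool) → (Fin n → Bool) → ℂ) :
    ∑ u, ∑ v, ρ.reduce n u v * g u v = pairing (fun x y =>
      if envOf n x = envOf n y then g (bitsOf n x) (bitsOf n y) else 0) ρ := by
  simp only [reduce_eq_pairing, pairing_apply, Finsupp.sum, Finset.sum_mul]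
  have : ∀ (F : (Fin n → Bool) → (Fin n → Bool) → Basis × Basis → ℂ),
      ∑ u, ∑ v, ∑ p ∈ ρ.support, F u v p = ∑ p ∈ ρ.support, ∑ u, ∑ v, F u v p := by
    intro F
    exact (Finset.sum_congr rfl fun u _ => Finset.sum_comm).trans Finset.sum_comm
  rw [this]
  apply Finset.sum_congr rfl
  rintro ⟨x, y⟩ _
  by_cases h : envOf n x = envOf n y
  · simp only [h, and_true, ite_and, mul_ite, mul_one, mul_zero, ite_mul, zero_mul, if_true]
    simp
  · simp [h]

/-- Sorting by the environment `e` writes the form as a sum of values of the form of `ρ`, each at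
the vector `w` placed over one fixed `e`. -/
theorem QState.Pos.reduce {ρ : QState} (h : ρ.Pos) (n : ℕ) (w : (Fin n → Bool) → ℂ) :
    0 ≤ ∑ u, ∑ v, ρ.reduce n u v * (star (w u) * w v) := by
  classical
  rw [sum_reduce n ρ fun u v => star (w u) * w v]
  have : pairing (fun x y => if envOf n x = envOf n y then
      star (w (bitsOf n x)) * w (bitsOf n y) else 0) ρ =
      ∑ e ∈ ρ.support.image fun p => envOf n p.1, pairing (fun x y =>
        star (if envOf n x = e then w (bitsOf n x) else 0) *
          if envOf n y = e then w (bitsOf n y) else 0) ρ := by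
    simp only [pairing_apply, Finsupp.sum]
    rw [Finset.sum_comm]
    apply Finset.sum_congr rfl
    rintro ⟨x, y⟩ hp
    rw [← Finset.mul_sum]
    have : ∀ e, (star (if envOf n x = e then w (bitsOf n x) else 0) *
        if envOf n y = e then w (bitsOf n y) else 0) =
        if envOf n x = e then (if envOf n y = e then
          star (w (bitsOf n x)) * w (bitsOf n y) else 0) else 0 := by
      intro z; split_ifs <;> simp
    simp only [this, Finset.sum_ite_eq]
    rw [if_pos (Finset.mem_image_of_mem (fun p : Basis × Basis => envOf n p.1) hp)]
    simp only [eq_comm]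
  rw [this]
  exact Finset.sum_nonneg fun z _ => h _

theorem trace_reduce (n : ℕ) (ρ : QState) : ∑ u, ρ.reduce n u u = ρ.tr := by
  classical
  have := sum_reduce n ρ fun u v => if u = v then 1 else 0
  simp only [mul_ite, mul_one, mul_zero, Finset.sum_ite_eq, Finset.mem_univ, if_true] at this
  rw [this, tr_eq_pairing]
  congr 2
  funext x y
  by_cases h1 : envOf n x = envOf n y <;> by_cases h2 : bitsOf n x = bitsOf n y <;>
    simp [eq_iff_bits_env (n := n) (x := x) (y := y), h1, h2]

/-! ### Unused qubits -/

/-- `ρ` only involves basis states with the property `S`. -/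
def QState.On (S : Basis → Prop) (ρ : QState) : Prop :=
  ρ ∈ Finsupp.supported ℂ ℂ {p : Basis × Basis | S p.1 ∧ S p.2}

theorem QState.On.conjugate {S S' : Basis → Prop} {ρ : QState} (h : ρ.On S)
    {K : Basis → (Basis →₀ ℂ)}
    (hK : ∀ x, S x → K x ∈ Finsupp.supported ℂ ℂ {x | S' x}) : (conjugate K ρ).On S' := by
  unfold QState.On QOWSG.conjugate Finsupp.sum
  refine Submodule.sum_mem _ fun p hp => Submodule.sum_mem _ fun x hx =>
    Submodule.sum_mem _ fun y hy => ?_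
  have hp' := h hp
  exact Finsupp.single_mem_supported ℂ _ ⟨hK _ hp'.1 hx, hK _ hp'.2 hy⟩

/-- In the basis state `x`, the stacks with heights `ht` are surrounded by zeros. -/
def ZeroAbove (ht : ℕ → ℕ) (x : Basis) : Prop := ∀ q j, ht q ≤ j → x (q, j) = false

theorem ZeroAbove.update_top {ht : ℕ → ℕ} {x : Basis} (h : ZeroAbove ht x) {q : ℕ}
    (hq : ht q ≠ 0) (b : Bool) : ZeroAbove ht (Function.update x (q, ht q - 1) b) := by
  intro q' j hj
  have : (q', j) ≠ (q, ht q - 1) := by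
    rintro ⟨⟩; omega
  rw [Function.update_of_ne this]
  exact h q' j hj

theorem gateOp_mem {ht : ℕ → ℕ} {x : Basis} (h : ZeroAbove ht x) {q : ℕ} (hq : ht q ≠ 0)
    (U : Matrix Bool Bool ℂ) :
    gateOp U (q, ht q - 1) x ∈ Finsupp.supported ℂ ℂ {x | ZeroAbove ht x} :=
  Submodule.sum_mem _ fun b _ => Finsupp.single_mem_supported ℂ _ (h.update_top hq b)

/-- A measurement resets the cell that it vacates, and `qmove` exchanges a qubit with an unused cell
in state `|0⟩`; so cells outside the stacks always stay in state `|0⟩`. -/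
theorem On.step {c : Config} (h : c.qu.On (ZeroAbove c.ht)) :
    ∀ c' ∈ step c, c'.qu.On (ZeroAbove c'.ht) := by
  obtain ⟨P, cl, ht, qu⟩ := c
  have h : qu.On (ZeroAbove ht) := h
  intro c' hc'
  match P with
  | [] => simp [QOWSG.step] at hc'; subst hc'; exact h
  | .skip :: K => simp [QOWSG.step] at hc'; subst hc'; exact h
  | .seq p p' :: K => simp [QOWSG.step] at hc'; subst hc'; exact h
  | .push v b :: K => simp [QOWSG.step] at hc'; subst hc'; exact h
  | .pop v :: K => simp [QOWSG.step] at hc'; subst hc'; exact h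
  | .branch v pe p0 p1 :: K =>
    rcases e : cl v with _ | ⟨_ | _, l⟩ <;> simp [QOWSG.step, e] at hc' <;> subst hc' <;> exact h
  | .loop v p :: K =>
    rcases e : cl v with _ | ⟨b, l⟩ <;> simp [QOWSG.step, e] at hc' <;> subst hc' <;> exact h
  | .qnew r :: K =>
    simp [QOWSG.step] at hc'; subst hc'
    refine Finsupp.supported_mono ?_ h
    have : ∀ x, ZeroAbove ht x → ZeroAbove (Function.update ht r (ht r + 1)) x := by
      intro x hx q j hj
      apply hx
      by_cases e : q = r
      · subst e; simp at hj; omega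
      · simpa [e] using hj
    exact fun p hp => ⟨this _ hp.1, this _ hp.2⟩
  | .had r :: K =>
    by_cases e : ht r = 0 <;> simp [QOWSG.step, e] at hc' <;> subst hc'
    exacts [h, h.conjugate fun x hx => gateOp_mem hx e _]
  | .phase r :: K =>
    by_cases e : ht r = 0 <;> simp [QOWSG.step, e] at hc' <;> subst hc'
    exacts [h, h.conjugate fun x hx => gateOp_mem hx e _]
  | .cnot r r' :: K =>
    by_cases e : ht r = 0 ∨ ht r' = 0 ∨ r = r'
    · simp [QOWSG.step, e] at hc'; subst hc'; exact h
    · simp [QOWSG.step, e] at hc'; subst hc'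
      refine h.conjugate fun x hx => Finsupp.single_mem_supported ℂ _ ?_
      exact ZeroAbove.update_top hx (by tauto) _
  | .qmove r r' :: K =>
    by_cases e : ht r = 0 ∨ r = r'
    · simp [QOWSG.step, e] at hc'; subst hc'; exact h
    · simp [QOWSG.step, e] at hc'; subst hc'
      refine h.conjugate fun x hx => Finsupp.single_mem_supported ℂ _ ?_
      push Not at e
      have hx : ZeroAbove ht x := hx
      intro q j hj
      dsimp only at hj
      simp only [Function.comp]
      by_cases e1 : (q, j) = (r, ht r - 1)
      · rw [e1, Equiv.swap_apply_left]; exact hx _ _ le_rfl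
      by_cases e2 : (q, j) = (r', ht r')
      · obtain ⟨rfl, rfl⟩ := Prod.mk.inj e2
        simp at hj
      rw [Equiv.swap_apply_of_ne_of_ne e1 e2]
      apply hx
      by_cases e3 : q = r'
      · subst e3; simp at hj; omega
      · by_cases e4 : q = r
        · subst e4
          simp [e3] at hj e1; omega
        · simpa [e3, e4] using hj
  | .meas r v :: K =>
    by_cases e : ht r = 0
    · simp [QOWSG.step, e] at hc'
      subst hc'; exact h
    · have key : ∀ o, (conjugate (measureOp (r, ht r - 1) o) qu).On
          (ZeroAbove (Function.update ht r (ht r - 1))) := by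
        intro o
        refine h.conjugate fun x (hx : ZeroAbove ht x) => ?_
        unfold measureOp
        split
        · refine Finsupp.single_mem_supported ℂ _ ?_
          intro q j hj
          by_cases e1 : (q, j) = (r, ht r - 1)
          · rw [e1]; simp
          · rw [Function.update_of_ne e1]
            apply hx
            by_cases e4 : q = r
            · subst e4
              simp at hj e1; omega
            · simpa [e4] using hj
        · exact Submodule.zero_mem _
      simp [QOWSG.step, e] at hc'
      rcases hc' with rfl | rfl
      exacts [key _, key _]
  | .qbranch r pe pn :: K =>
    by_cases e : ht r = 0 <;> simp [QOWSG.step, e] at hc' <;> subst hc' <;> exact h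

theorem On.run {c : Config} (h : c.qu.On (ZeroAbove c.ht)) (N : ℕ) :
    ∀ c' ∈ run N c, c'.qu.On (ZeroAbove c'.ht) :=
  run_invariant (fun _ c => c.qu.On (ZeroAbove c.ht)) (fun _ _ h => On.step h) N 0 c h

theorem On.ofMat {n : ℕ} (φ : QMat n) :
    (QState.ofMat φ).On (ZeroAbove fun q => if q = 0 then n else 0) := by
  have : ∀ u : Fin n → Bool, ZeroAbove (fun q => if q = 0 then n else 0) (basisOf u) := by
    intro u q j hj
    unfold basisOf
    split_ifs with h
    · dsimp only at h hj; rw [if_pos h.1] at hj; omega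
    · rfl
  exact Submodule.sum_mem _ fun u _ => Submodule.sum_mem _ fun v _ =>
    Finsupp.single_mem_supported ℂ _ ⟨this u, this v⟩

/-- The basis state in which all cells are `0`. -/
def zeroBasis : Basis := fun _ => false

/-- Once all quantum stacks are empty the memory carries nothing but a probability. This is what
decouples a finished subroutine from its caller. -/
theorem eq_single_of_on {ρ : QState} {ht : ℕ → ℕ} (h : ρ.On (ZeroAbove ht))
    (hht : ∀ q, ht q = 0) : ρ = ρ.tr • Finsupp.single (zeroBasis, zeroBasis) 1 := by
  have hz : ∀ x, ZeroAbove ht x → x = zeroBasis := by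
    intro x hx; funext ⟨q, j⟩
    exact hx q j (by rw [hht]; omega)
  have : ρ = Finsupp.single (zeroBasis, zeroBasis) (ρ (zeroBasis, zeroBasis)) := by
    ext p
    by_cases hp : p ∈ ρ.support
    · have := h hp
      have e : p = (zeroBasis, zeroBasis) := Prod.ext (hz _ this.1) (hz _ this.2)
      rw [e, Finsupp.single_eq_same]
    · have h0 : ρ p = 0 := by simpa using hp
      rw [h0]
      by_cases e : p = (zeroBasis, zeroBasis)
      · rw [e, Finsupp.single_eq_same, ← e, h0]
      · rw [Finsupp.single_eq_of_ne e]
  rw [this, tr_single, Finsupp.smul_single, smul_eq_mul, mul_one]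

/-! ### The stacks that a program uses -/

/-- A bound on the stacks that occur in a program. -/
def Prog.width : Prog → ℕ
  | .skip => 0
  | .seq p q => max p.width q.width
  | .push v _ => v + 1
  | .pop v => v + 1
  | .branch v p q r => max (v + 1) (max p.width (max q.width r.width))
  | .loop v p => max (v + 1) p.width
  | .qnew q => q + 1
  | .had q => q + 1
  | .phase q => q + 1
  | .cnot q r => max (q + 1) (r + 1)
  | .qmove q r => max (q + 1) (r + 1)
  | .meas q v => max (q + 1) (v + 1)
  | .qbranch q p r => max (q + 1) (max p.width r.width)

/-- The stacks from number `W` on are empty and will not be used. -/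
def Config.Within (W : ℕ) (c : Config) : Prop :=
  (∀ p ∈ c.ctrl, p.width ≤ W) ∧ ∀ v, W ≤ v → c.cl v = [] ∧ c.ht v = 0

theorem Within.step {W : ℕ} {c : Config} (h : c.Within W) : ∀ c' ∈ step c, c'.Within W := by
  obtain ⟨P, cl, ht, qu⟩ := c
  obtain ⟨hP, hE⟩ := h
  dsimp only at hP hE
  have upd : ∀ (v : ℕ) (l : List Bool), v + 1 ≤ W → ∀ v', W ≤ v' →
      Function.update cl v l v' = [] := by
    intro v l hv v' hv'
    rw [Function.update_of_ne (by omega)]; exact (hE v' hv').1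
  have updh : ∀ (f : ℕ → ℕ) (v : ℕ) (l : ℕ), (∀ v', W ≤ v' → f v' = 0) → v + 1 ≤ W → ∀ v', W ≤ v' →
      Function.update f v l v' = 0 := by
    intro f v l hf hv v' hv'
    rw [Function.update_of_ne (by omega)]; exact hf v' hv'
  intro c' hc'
  match P with
  | [] => simp [QOWSG.step] at hc'; subst hc'; exact ⟨hP, hE⟩
  | .skip :: K =>
    simp [QOWSG.step] at hc'; subst hc'; exact ⟨fun p hp => hP p (by simp_all), hE⟩
  | .seq p p' :: K =>
    simp [QOWSG.step] at hc'; subst hc'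
    have := hP (.seq p p') (by simp)
    simp only [Prog.width, max_le_iff] at this
    exact ⟨by simp_all, hE⟩
  | .push v b :: K =>
    have := hP (.push v b) (by simp)
    simp only [Prog.width] at this
    simp [QOWSG.step] at hc'; subst hc'
    exact ⟨fun p hp => hP p (by simp_all), fun v' hv' => ⟨upd _ _ this _ hv', (hE _ hv').2⟩⟩
  | .pop v :: K =>
    have := hP (.pop v) (by simp)
    simp only [Prog.width] at this
    simp [QOWSG.step] at hc'; subst hc'
    exact ⟨fun p hp => hP p (by simp_all), fun v' hv' => ⟨upd _ _ this _ hv', (hE _ hv').2⟩⟩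
  | .branch v pe p0 p1 :: K =>
    have := hP (.branch v pe p0 p1) (by simp)
    simp only [Prog.width, max_le_iff] at this
    rcases e : cl v with _ | ⟨_ | _, l⟩ <;> simp [QOWSG.step, e] at hc' <;> subst hc' <;>
      exact ⟨by simp_all, hE⟩
  | .loop v p :: K =>
    have := hP (.loop v p) (by simp)
    simp only [Prog.width, max_le_iff] at this
    rcases e : cl v with _ | ⟨b, l⟩ <;> simp [QOWSG.step, e] at hc' <;> subst hc'
    · exact ⟨fun p hp => hP p (by simp_all), hE⟩
    · exact ⟨by simp_all [Prog.width], hE⟩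
  | .qnew r :: K =>
    have := hP (.qnew r) (by simp)
    simp only [Prog.width] at this
    simp [QOWSG.step] at hc'; subst hc'
    exact ⟨fun p hp => hP p (by simp_all), fun v' hv' =>
      ⟨(hE _ hv').1, updh _ _ _ (fun v hv => (hE v hv).2) this _ hv'⟩⟩
  | .had r :: K =>
    by_cases e : ht r = 0 <;> simp [QOWSG.step, e] at hc' <;> subst hc' <;>
      exact ⟨fun p hp => hP p (by simp_all), hE⟩
  | .phase r :: K =>
    by_cases e : ht r = 0 <;> simp [QOWSG.step, e] at hc' <;> subst hc' <;>
      exact ⟨fun p hp => hP p (by simp_all), hE⟩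
  | .cnot r r' :: K =>
    by_cases e : ht r = 0 ∨ ht r' = 0 ∨ r = r' <;> simp [QOWSG.step, e] at hc' <;> subst hc' <;>
      exact ⟨fun p hp => hP p (by simp_all), hE⟩
  | .qmove r r' :: K =>
    have := hP (.qmove r r') (by simp)
    simp only [Prog.width, max_le_iff] at this
    by_cases e : ht r = 0 ∨ r = r' <;> simp [QOWSG.step, e] at hc' <;> subst hc'
    · exact ⟨fun p hp => hP p (by simp_all), hE⟩
    · exact ⟨fun p hp => hP p (by simp_all), fun v' hv' => ⟨(hE _ hv').1,
        updh _ _ _ (updh _ _ _ (fun v hv => (hE v hv).2) this.1) this.2 _ hv'⟩⟩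
  | .meas r v :: K =>
    have := hP (.meas r v) (by simp)
    simp only [Prog.width, max_le_iff] at this
    by_cases e : ht r = 0 <;> simp [QOWSG.step, e] at hc'
    · subst hc'; exact ⟨fun p hp => hP p (by simp_all), hE⟩
    · rcases hc' with rfl | rfl <;>
      exact ⟨fun p hp => hP p (by simp_all), fun v' hv' => ⟨upd _ _ this.2 _ hv',
        updh _ _ _ (fun v hv => (hE v hv).2) this.1 _ hv'⟩⟩
  | .qbranch r pe pn :: K =>
    have := hP (.qbranch r pe pn) (by simp)
    simp only [Prog.width, max_le_iff] at this
    by_cases e : ht r = 0 <;> simp [QOWSG.step, e] at hc' <;> subst hc' <;>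
      exact ⟨by simp_all, hE⟩

theorem Within.run {W : ℕ} {c : Config} (h : c.Within W) (N : ℕ) : ∀ c' ∈ run N c, c'.Within W :=
  run_invariant (fun _ c => c.Within W) (fun _ _ h => Within.step h) N 0 c h

/-- All stacks have height at most `B`. -/
def Config.Bounded (B : ℕ) (c : Config) : Prop := ∀ v, (c.cl v).length ≤ B ∧ c.ht v ≤ B

theorem Bounded.step {B : ℕ} {c : Config} (h : c.Bounded B) :
    ∀ c' ∈ step c, c'.Bounded (B + 1) := by
  obtain ⟨P, cl, ht, qu⟩ := c
  have h' : Config.Bounded (B + 1) ⟨P, cl, ht, qu⟩ := fun v =>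
    ⟨(h v).1.trans (by omega), (h v).2.trans (by omega)⟩
  have upd : ∀ (v : ℕ) (l : List Bool), l.length ≤ B + 1 → ∀ v',
      (Function.update cl v l v').length ≤ B + 1 := by
    intro v l hl v'
    by_cases e : v' = v
    · subst e; simpa using hl
    · rw [Function.update_of_ne e]; exact (h' v').1
  have updh : ∀ (f : ℕ → ℕ) (v : ℕ) (l : ℕ), (∀ v', f v' ≤ B + 1) → l ≤ B + 1 → ∀ v',
      Function.update f v l v' ≤ B + 1 := by
    intro f v l hf hl v'
    by_cases e : v' = v
    · subst e; simpa using hl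
    · rw [Function.update_of_ne e]; exact hf v'
  have hh : ∀ v, ht v ≤ B + 1 := fun v => (h' v).2
  have hB : ∀ v, ht v ≤ B := fun v => (h v).2
  have hC : ∀ v, (cl v).length ≤ B := fun v => (h v).1
  intro c' hc'
  match P with
  | [] => simp [QOWSG.step] at hc'; subst hc'; exact h'
  | .skip :: K => simp [QOWSG.step] at hc'; subst hc'; exact h'
  | .seq p p' :: K => simp [QOWSG.step] at hc'; subst hc'; exact h'
  | .push v b :: K =>
    simp [QOWSG.step] at hc'; subst hc'
    exact fun v' => ⟨upd _ _ (by simpa using hC v) _, hh v'⟩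
  | .pop v :: K =>
    simp [QOWSG.step] at hc'; subst hc'
    exact fun v' => ⟨upd _ _ (by have := hC v; simp; omega) _, hh v'⟩
  | .branch v pe p0 p1 :: K =>
    rcases e : cl v with _ | ⟨_ | _, l⟩ <;> simp [QOWSG.step, e] at hc' <;> subst hc' <;> exact h'
  | .loop v p :: K =>
    rcases e : cl v with _ | ⟨b, l⟩ <;> simp [QOWSG.step, e] at hc' <;> subst hc' <;> exact h'
  | .qnew r :: K =>
    simp [QOWSG.step] at hc'; subst hc'
    exact fun v' => ⟨(h' v').1, updh _ _ _ hh (by have := hB r; omega) _⟩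
  | .had r :: K =>
    by_cases e : ht r = 0 <;> simp [QOWSG.step, e] at hc' <;> subst hc' <;> exact h'
  | .phase r :: K =>
    by_cases e : ht r = 0 <;> simp [QOWSG.step, e] at hc' <;> subst hc' <;> exact h'
  | .cnot r r' :: K =>
    by_cases e : ht r = 0 ∨ ht r' = 0 ∨ r = r' <;> simp [QOWSG.step, e] at hc' <;> subst hc' <;>
      exact h'
  | .qmove r r' :: K =>
    by_cases e : ht r = 0 ∨ r = r' <;> simp [QOWSG.step, e] at hc' <;> subst hc'
    · exact h'
    · exact fun v' => ⟨(h' v').1, updh _ _ _ (updh _ _ _ hh (by have := hB r; omega))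
        (by have := hB r'; omega) _⟩
  | .meas r v :: K =>
    by_cases e : ht r = 0 <;> simp [QOWSG.step, e] at hc'
    · subst hc'; exact h'
    · rcases hc' with rfl | rfl <;>
      exact fun v' => ⟨upd _ _ (by simpa using hC v) _, updh _ _ _ hh (by have := hB r; omega) _⟩
  | .qbranch r pe pn :: K =>
    by_cases e : ht r = 0 <;> simp [QOWSG.step, e] at hc' <;> subst hc' <;> exact h'

theorem Bounded.run {B : ℕ} {c : Config} (h : c.Bounded B) (N : ℕ) :
    ∀ c' ∈ run N c, c'.Bounded (B + N) :=
  run_invariant (fun i c => c.Bounded i) (fun _ _ h => Bounded.step h) N B c h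

/-! ### Cleaning up -/

/-- Started on `s`, the control `P` halts after at most `N` steps on data with the property `Q`. -/
def Leads (P : List Prog) (s : Data) (N : ℕ) (Q : Data → Prop) : Prop :=
  ∃ D, Runs P s N D ∧ ∀ s' ∈ D, Q s'

theorem Leads.mono {P : List Prog} {s : Data} {N M : ℕ} {Q Q' : Data → Prop} (h : Leads P s N Q)
    (hN : N ≤ M) (hQ : ∀ s', Q s' → Q' s') : Leads P s M Q' := by
  obtain ⟨D, h1, h2⟩ := h
  exact ⟨D, h1.mono hN, fun s' hs' => hQ _ (h2 s' hs')⟩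

theorem Leads.nil {s : Data} {Q : Data → Prop} (h : Q s) (N : ℕ) : Leads [] s N Q :=
  ⟨[s], Runs.nil s N, by simpa using h⟩

theorem Leads.of_step {P : List Prog} {s : Data} {N : ℕ} {Q : Data → Prop}
    (h : ∀ c ∈ step (s.cfg P), Leads c.ctrl ⟨c.cl, c.ht, c.qu⟩ N Q) : Leads P s (N + 1) Q := by
  classical
  have : ∀ c : Config, ∃ D, c ∈ step (s.cfg P) →
      Runs c.ctrl ⟨c.cl, c.ht, c.qu⟩ N D ∧ ∀ s' ∈ D, Q s' := by
    intro c
    by_cases hc : c ∈ step (s.cfg P)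
    · obtain ⟨D, hD⟩ := h c hc; exact ⟨D, fun _ => hD⟩
    · exact ⟨[], fun h => absurd h hc⟩
  choose F hF using this
  refine ⟨(step (s.cfg P)).flatMap F, ?_, ?_⟩
  · unfold Runs
    rw [run_succ, List.map_flatMap]
    exact List.flatMap_congr fun c hc => (hF c hc).1
  · intro s' hs'
    obtain ⟨c, hc, hs⟩ := List.mem_flatMap.1 hs'
    exact (hF c hc).2 s' hs

theorem Leads.cons {p : Prog} {K : List Prog} {s : Data} {N M : ℕ} {Q Q' : Data → Prop}
    (h : Leads [p] s N Q) (hK : ∀ s', Q s' → Leads K s' M Q') :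
    Leads (p :: K) s (N + M) Q' := by
  classical
  obtain ⟨D, h1, h2⟩ := h
  have : ∀ s' : Data, ∃ D', Q s' → Runs K s' M D' ∧ ∀ s'' ∈ D', Q' s'' := by
    intro s'
    by_cases hs : Q s'
    · obtain ⟨D', hD⟩ := hK s' hs; exact ⟨D', fun _ => hD⟩
    · exact ⟨[], fun h => absurd h hs⟩
  choose F hF using this
  refine ⟨D.flatMap F, h1.cons fun s' hs' => (hF s' (h2 s' hs')).1, ?_⟩
  intro s'' hs''
  obtain ⟨s', hs', hs⟩ := List.mem_flatMap.1 hs''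
  exact (hF s' (h2 s' hs')).2 s'' hs

theorem Leads.seq {p q : Prog} {s : Data} {N M : ℕ} {Q Q' : Data → Prop}
    (h : Leads [p] s N Q) (hK : ∀ s', Q s' → Leads [q] s' M Q') :
    Leads [p.seq q] s (N + M + 1) Q' := by
  apply Leads.of_step
  simp only [step, Data.cfg, List.mem_singleton, forall_eq]
  exact h.cons hK

/-- Empty the classical stack `v`. -/
def clear (v : ℕ) : Prog := .loop v (.pop v)

theorem runs_clear (v : ℕ) (cl : ℕ → List Bool) (ht : ℕ → ℕ) (qu : QState) :
    Runs [clear v] ⟨cl, ht, qu⟩ (2 * (cl v).length + 1) [⟨Function.update cl v [], ht, qu⟩] := by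
  generalize h : cl v = l
  induction l generalizing cl with
  | nil =>
    refine Runs.of_step (s' := ⟨cl, ht, qu⟩) (P' := [])
      (by simp [step, Data.cfg, clear, h]) ?_
    rw [← h, Function.update_eq_self]
    exact Runs.nil _ _
  | cons b l ih =>
    refine Runs.of_step (s' := ⟨cl, ht, qu⟩) (P' := [.pop v, clear v])
      (by simp [step, Data.cfg, clear, h]) ?_
    refine Runs.of_step (s' := ⟨Function.update cl v l, ht, qu⟩) (P' := [clear v])
      (by simp [step, Data.cfg, h]) ?_
    have := ih (Function.update cl v l) (by simp)
    rw [Function.update_idem] at this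
    exact this.mono (by simp)

/-- Measure and remove all qubits of the quantum stack `q`, using the empty classical
stack `w`. -/
def discard (q w : ℕ) : Prog :=
  .seq (.push w true) (.loop w (.qbranch q (.pop w) (.seq (.meas q w) (.pop w))))

/-- The bit pushed on `w` keeps the loop running; a measurement outcome lies on top of it only until
the next `pop`. The time is two steps to start, five for each qubit and four to notice that `q` is
empty. -/
theorem leads_discard (q w : ℕ) (s : Data) (hw : s.cl w = []) :
    Leads [discard q w] s (5 * s.ht q + 6) fun s' =>
      s'.cl = s.cl ∧ s'.ht = Function.update s.ht q 0 := by
  obtain ⟨cl, ht, qu⟩ := s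
  dsimp only at hw ⊢
  apply Leads.of_step
  simp only [step, Data.cfg, discard, List.mem_singleton, forall_eq]
  apply Leads.of_step
  simp only [step, Data.cfg, List.mem_singleton, forall_eq, hw]
  have key : ∀ k (ht' : ℕ → ℕ) (qu : QState), ht' q = k →
      Leads [.loop w (.qbranch q (.pop w) (.seq (.meas q w) (.pop w)))]
        ⟨Function.update cl w [true], ht', qu⟩ (5 * k + 4) fun s' =>
          s'.cl = cl ∧ s'.ht = Function.update ht' q 0 := by
    intro k
    induction k with
    | zero =>
      intro ht' qu hk
      apply Leads.of_step
      simp only [step, Data.cfg, List.mem_singleton, forall_eq, Function.update_self]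
      apply Leads.of_step
      simp only [step, Data.cfg, hk, if_true, List.mem_singleton, forall_eq]
      apply Leads.of_step
      simp only [step, Data.cfg, List.mem_singleton, forall_eq, Function.update_self,
        Function.update_idem, List.tail]
      apply Leads.of_step
      simp only [step, Data.cfg, List.mem_singleton, forall_eq, Function.update_self]
      refine Leads.nil ⟨?_, ?_⟩ _
      · simp [← hw]
      · simp [← hk]
    | succ k ih =>
      intro ht' qu hk
      have hk' : ht' q ≠ 0 := by omega
      refine Leads.mono (N := 5 * k + 4 + 1 + 1 + 1 + 1 + 1) ?_ (by omega) fun _ => id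
      apply Leads.of_step
      simp only [step, Data.cfg, List.mem_singleton, forall_eq, Function.update_self]
      apply Leads.of_step
      simp only [step, Data.cfg, hk', if_false, List.mem_singleton, forall_eq]
      apply Leads.of_step
      simp only [step, Data.cfg, List.mem_singleton, forall_eq]
      apply Leads.of_step
      simp only [step, Data.cfg, hk', if_false, List.mem_map]
      rintro c ⟨o, -, rfl⟩
      dsimp only
      apply Leads.of_step
      simp only [step, Data.cfg, List.mem_singleton, forall_eq, Function.update_self,
        Function.update_idem, List.tail]
      refine (ih _ _ (by simp [hk])).mono le_rfl ?_
      rintro s' ⟨h1, h2⟩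
      exact ⟨h1, by rw [h2, Function.update_idem]⟩
  exact (key (ht q) ht qu rfl).mono le_rfl fun _ => id

/-- Empty the quantum stacks below `k`. -/
def discardAll (w : ℕ) : ℕ → Prog
  | 0 => .skip
  | k + 1 => .seq (discardAll w k) (discard k w)

theorem leads_discardAll (w B : ℕ) (s : Data) (hw : s.cl w = []) (hB : ∀ q, s.ht q ≤ B) (k : ℕ) :
    Leads [discardAll w k] s (k * (5 * B + 7) + 1) fun s' =>
      s'.cl = s.cl ∧ ∀ q, s'.ht q = if q < k then 0 else s.ht q := by
  induction k with
  | zero =>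
    apply Leads.of_step
    simp only [step, Data.cfg, discardAll, List.mem_singleton, forall_eq]
    exact Leads.nil (by simp) _
  | succ k ih =>
    refine Leads.mono (Leads.seq ih (M := 5 * B + 6) ?_) (by ring_nf; omega) fun _ => id
    rintro s' ⟨h1, h2⟩
    have : s'.ht k ≤ B := by rw [h2]; simpa using hB k
    refine Leads.mono (leads_discard k w s' (by rw [h1, hw])) (by omega) ?_
    rintro s'' ⟨h3, h4⟩
    refine ⟨h3.trans h1, fun q => ?_⟩
    rw [h4]
    by_cases e : q = k
    · subst e; simp
    · rw [Function.update_of_ne e, h2]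
      congr 1
      exact propext ⟨fun h => by omega, fun h => by omega⟩

/-- Empty the classical stacks `1, …, k`. -/
def clearAll : ℕ → Prog
  | 0 => .skip
  | k + 1 => .seq (clearAll k) (clear (k + 1))

theorem leads_clearAll (B : ℕ) (s : Data) (hB : ∀ v, (s.cl v).length ≤ B) (k : ℕ) :
    Leads [clearAll k] s (k * (2 * B + 2) + 1) fun s' =>
      (∀ v, s'.cl v = if v = 0 ∨ k < v then s.cl v else []) ∧ s'.ht = s.ht := by
  induction k with
  | zero =>
    apply Leads.of_step
    simp only [step, Data.cfg, clearAll, List.mem_singleton, forall_eq]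
    refine Leads.nil ⟨fun v => ?_, rfl⟩ _
    rw [if_pos (by omega)]
  | succ k ih =>
    refine Leads.mono (Leads.seq ih (M := 2 * B + 1) ?_) (by ring_nf; omega) fun _ => id
    rintro ⟨cl, ht, qu⟩ ⟨h1, h2⟩
    dsimp only at h1 h2
    have : (cl (k + 1)).length ≤ B := by
      rw [h1, if_pos (Or.inr (Nat.lt_succ_self k))]; exact hB _
    refine ⟨_, (runs_clear (k + 1) cl ht qu).mono (by omega), ?_⟩
    simp only [List.mem_singleton, forall_eq]
    refine ⟨fun v => ?_, h2⟩
    by_cases e : v = k + 1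
    · subst e; simp
    · rw [Function.update_of_ne e, h1]
      congr 1
      exact propext ⟨fun h => by omega, fun h => by omega⟩

/-- Empty all stacks up to number `W` except for the classical output. -/
def cleanup (W : ℕ) : Prog := .seq (discardAll (W + 1) (W + 1)) (clearAll (W + 1))

/-- Run the program `p` and empty all stacks except for the classical output. -/
def cleaned (p : Prog) : Prog := .seq p (cleanup p.width)

/-- The data at the start of a program. -/
noncomputable def startData (w : List Bool) {n : ℕ} (ρ : QMat n) : Data :=
  ⟨fun v => if v = 0 then w else [], fun q => if q = 0 then n else 0, QState.ofMat ρ⟩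

/-- The data that only consist of a classical output `y`. -/
noncomputable def outputData (y : List Bool) (a : ℂ) : Data :=
  ⟨fun v => if v = 0 then y else [], fun _ => 0,
    a • Finsupp.single (zeroBasis, zeroBasis) 1⟩

/-- Time for the cleanup, where `W` bounds the number of stacks and `B` their heights. -/
def cleanupTime (W B : ℕ) : ℕ :=
  ((W + 1) * (5 * B + 7) + 1) + ((W + 1) * (2 * B + 2) + 1) + 1

/-- Stack `W + 1` is still unused and serves as the scratch stack for the measurements. -/
theorem leads_cleanup (W B : ℕ) (s : Data) (h1 : ∀ v, W + 1 ≤ v → s.cl v = [] ∧ s.ht v = 0)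
    (hB : ∀ v, (s.cl v).length ≤ B ∧ s.ht v ≤ B) :
    Leads [cleanup W] s (cleanupTime W B) fun s' =>
      (s'.cl = fun v => if v = 0 then s.cl 0 else []) ∧ ∀ q, s'.ht q = 0 := by
  refine Leads.seq (leads_discardAll (W + 1) B s (h1 _ le_rfl).1 (fun q => (hB q).2) (W + 1)) ?_
  rintro s' ⟨e1, e2⟩
  refine (leads_clearAll B s' (fun v => by rw [e1]; exact (hB v).1) (W + 1)).mono le_rfl ?_
  rintro s'' ⟨e3, e4⟩
  constructor
  · funext v
    rw [e3, e1]
    by_cases hv : v = 0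
    · simp [hv]
    · by_cases hv' : W + 1 < v
      · simp [hv, hv', (h1 v (by omega)).1]
      · simp [hv, hv']
  · intro q
    rw [e4, e2]
    split_ifs
    · rfl
    · exact (h1 q (by omega)).2

theorem sum_map_congr_list {α : Type*} {L : List α} {f g : α → ℝ} (h : ∀ a ∈ L, f a = g a) :
    (L.map f).sum = (L.map g).sum := by rw [List.map_congr_left h]

theorem sum_map_re {α : Type*} (L : List α) (f : α → ℂ) :
    (L.map fun a => (f a).re).sum = ((L.map f).sum).re := by
  induction L with
  | nil => simp
  | cons a L ih => simp [ih]

theorem sum_map_flatMap_real {α β : Type*} (L : List α) (F : α → List β) (f : β → ℝ) :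
    ((L.flatMap F).map f).sum = (L.map fun a => ((F a).map f).sum).sum := by
  induction L with
  | nil => simp
  | cons a L ih => simp [ih]

-- Measuring the leftover qubits splits the branch into several with the same classical output; `L`
-- lists their weights, which add up to the weight of the branch.
open scoped ComplexOrder in
theorem exists_runs_cleanup (W B : ℕ) (s : Data)
    (h1 : ∀ v, W + 1 ≤ v → s.cl v = [] ∧ s.ht v = 0)
    (hB : ∀ v, (s.cl v).length ≤ B ∧ s.ht v ≤ B) (hpos : s.qu.Pos)
    (hon : s.qu.On (ZeroAbove s.ht)) : ∃ L : List ℝ,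
      Runs [cleanup W] s (cleanupTime W B) (L.map fun a : ℝ => outputData (s.cl 0) a) ∧
      (∀ a ∈ L, 0 ≤ a) ∧ L.sum = s.qu.tr.re := by
  obtain ⟨E, hE, hE'⟩ := leads_cleanup W B s h1 hB
  have hEm : ∀ s' ∈ E, s'.cfg [] ∈ run (cleanupTime W B) (s.cfg [cleanup W]) := by
    intro s' hs
    rw [hE]; exact List.mem_map_of_mem hs
  have hposE : ∀ s' ∈ E, s'.qu.Pos := fun s' hs =>
    Pos.run (c := s.cfg [cleanup W]) hpos _ _ (hEm s' hs)
  have honE : ∀ s' ∈ E, s'.qu.On (ZeroAbove s'.ht) := fun s' hs =>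
    On.run (c := s.cfg [cleanup W]) hon _ _ (hEm s' hs)
  refine ⟨E.map fun s' => s'.qu.tr.re, ?_, ?_, ?_⟩
  · have : (E.map fun s' => s'.qu.tr.re).map (fun a : ℝ => outputData (s.cl 0) a) = E := by
      rw [List.map_map]
      conv_rhs => rw [← List.map_id E]
      apply List.map_congr_left
      intro s' hs
      obtain ⟨h1, h2⟩ := hE' s' hs
      have h3 := eq_single_of_on (honE s' hs) h2
      have h4 : ((s'.qu.tr.re : ℝ) : ℂ) = s'.qu.tr := by
        have := (hposE s' hs).tr_nonneg
        rw [Complex.nonneg_iff] at this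
        exact Complex.ext rfl (by simpa using this.2)
      obtain ⟨cl, ht, qu⟩ := s'
      dsimp only at h1 h2 h3 h4
      simp only [Function.comp, outputData, id, h4, ← h3, ← h1]
      congr
      funext q; exact (h2 q).symm
    rw [this]; exact hE
  · intro a ha
    obtain ⟨s', hs, rfl⟩ := List.mem_map.1 ha
    exact (Complex.nonneg_iff.1 (hposE s' hs).tr_nonneg).1
  · have := sum_tr_run (cleanupTime W B) (s.cfg [cleanup W])
    rw [hE, List.map_map] at this
    rw [sum_map_re]
    exact congrArg Complex.re this

namespace QPT

variable {D : Set (List Bool × ℕ)}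

/-- A bound on the heights of the stacks during the execution. -/
noncomputable def heightBound (A : QPT D) (l : ℕ) : ℕ := l + A.time.eval l

/-- A bound on the time for the execution of the program and the cleanup. -/
noncomputable def cleanTime (A : QPT D) (l : ℕ) : ℕ :=
  A.time.eval l + cleanupTime A.prog.width (A.heightBound l) + 1

/-- The cleaned program turns the input into a distribution of classical outputs. -/
theorem exists_runs_cleaned (A : QPT D) {w : List Bool} {n : ℕ} (h : (w, n) ∈ D) {φ : QMat n}
    (hφ : IsDensity φ) : ∃ L : List (ℝ × List Bool),
      Runs [cleaned A.prog] (startData w φ) (A.cleanTime (w.length + n))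
        (L.map fun x => outputData x.2 x.1) ∧
      (∀ x ∈ L, 0 ≤ x.1 ∧ x.2.length ≤ A.heightBound (w.length + n)) ∧
      (∀ f, (L.map fun x => x.1 * f x.2).sum = A.expect w φ f) ∧
      (L.map fun x => x.1).sum = 1 := by
  classical
  obtain ⟨N, hN⟩ : ∃ N, N = A.time.eval (w.length + n) := ⟨_, rfl⟩
  have hstart : start A.prog w φ = (startData w φ).cfg [A.prog] := rfl
  have hhalt := A.halts w n h φ
  rw [← hN] at hhalt
  have hfinal : A.final w φ = run N (start A.prog w φ) := by rw [hN]; rfl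
  have hfin : Runs [A.prog] (startData w φ) N ((A.final w φ).map fun c => ⟨c.cl, c.ht, c.qu⟩) :=
    hfinal ▸ Runs.of_forall_halted hhalt
  obtain ⟨W, hW⟩ : ∃ W, W = A.prog.width := ⟨_, rfl⟩
  have hwithin : ∀ c ∈ A.final w φ, c.Within (W + 1) := by
    rw [hfinal]
    apply Within.run
    constructor
    · simp [start]; omega
    · intro v hv
      simp [start, show v ≠ 0 by omega]
  have hbdd : ∀ c ∈ A.final w φ, c.Bounded (A.heightBound (w.length + n)) := by
    rw [hfinal, heightBound, ← hN]
    apply Bounded.run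
    intro v
    simp only [start]
    split_ifs <;> simp
  have hpos : ∀ c ∈ A.final w φ, c.qu.Pos := by
    rw [hfinal]; exact Pos.run (c := start A.prog w φ) hφ.pos N
  have hon : ∀ c ∈ A.final w φ, c.qu.On (ZeroAbove c.ht) := by
    rw [hfinal]; exact On.run (c := start A.prog w φ) (On.ofMat φ) N
  obtain ⟨M, hM⟩ : ∃ M, M = cleanupTime W (A.heightBound (w.length + n)) := ⟨_, rfl⟩
  have hclean : ∀ c ∈ A.final w φ, ∃ L : List ℝ,
      Runs [cleanup W] ⟨c.cl, c.ht, c.qu⟩ M (L.map fun a : ℝ => outputData (c.cl 0) a) ∧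
      (∀ a ∈ L, 0 ≤ a) ∧ L.sum = c.qu.tr.re := fun c hc => hM ▸
    exists_runs_cleanup W _ ⟨c.cl, c.ht, c.qu⟩ (hwithin c hc).2 (hbdd c hc) (hpos c hc) (hon c hc)
  have hclean' : ∀ c : Config, ∃ L : List ℝ, c ∈ A.final w φ →
      Runs [cleanup W] ⟨c.cl, c.ht, c.qu⟩ M (L.map fun a : ℝ => outputData (c.cl 0) a) ∧
      (∀ a ∈ L, 0 ≤ a) ∧ L.sum = c.qu.tr.re := by
    intro c
    by_cases hc : c ∈ A.final w φ
    · obtain ⟨L, hL⟩ := hclean c hc; exact ⟨L, fun _ => hL⟩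
    · exact ⟨[], fun h => absurd h hc⟩
  choose F hF using hclean'
  have hexp : ∀ f, (((A.final w φ).flatMap fun c => (F c).map fun a => (a, c.cl 0)).map
      fun x => x.1 * f x.2).sum = A.expect w φ f := by
    intro f
    rw [sum_map_flatMap_real]
    unfold expect
    apply sum_map_congr_list
    intro c hc
    rw [List.map_map]
    simp only [Function.comp_def]
    rw [List.sum_map_mul_right, List.map_id', (hF c hc).2.2]
  refine ⟨(A.final w φ).flatMap fun c => (F c).map fun a => (a, c.cl 0), ?_, ?_, hexp, ?_⟩
  -- `F` depends on configurations but `Runs.seq` needs a function of the data; on halted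
  -- configurations the two agree, since the control is `[]`.
  · have hG : ∀ s : Data, ∃ G : List Data, ∀ (c : Config), c ∈ A.final w φ →
        s = ⟨c.cl, c.ht, c.qu⟩ → G = (F c).map fun a : ℝ => outputData (c.cl 0) a := by
      intro s
      refine ⟨(F ⟨[], s.cl, s.ht, s.qu⟩).map fun a : ℝ => outputData (s.cl 0) a, ?_⟩
      rintro c hc rfl
      have : c.ctrl = [] := hhalt c (hfinal ▸ hc)
      cases c; simp_all
    choose G hG using hG
    have := Runs.seq hfin (q := cleanup W) (M := M) (F := G) (by
      intro s hs
      obtain ⟨c, hc, rfl⟩ := List.mem_map.1 hs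
      rw [hG _ c hc rfl]
      exact (hF c hc).1)
    rw [List.flatMap_map] at this
    rw [List.map_flatMap, cleanTime, ← hN, ← hW, ← hM, cleaned, ← hW]
    convert this using 1
    apply List.flatMap_congr
    intro c hc
    rw [hG _ c hc rfl, List.map_map]; rfl
  · intro x hx
    obtain ⟨c, hc, hx⟩ := List.mem_flatMap.1 hx
    obtain ⟨a, ha, rfl⟩ := List.mem_map.1 hx
    exact ⟨(hF c hc).2.1 a ha, (hbdd c hc 0).1⟩
  · have := hexp fun _ => 1
    simp only [mul_one] at this
    rw [this]
    unfold expect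
    simp only [mul_one]
    rw [sum_map_re]
    have h1 := sum_tr_run N (start A.prog w φ)
    have h2 : (start A.prog w φ).qu.tr = 1 := (tr_ofMat φ).trans hφ.2
    rw [h2, ← hfinal] at h1
    exact congrArg Complex.re h1

end QPT

/-! ### Subroutines -/

/-- The program that acts on the stacks `v + s` instead of `v`. -/
def Prog.shift (s : ℕ) : Prog → Prog
  | .skip => .skip
  | .seq p q => .seq (p.shift s) (q.shift s)
  | .push v b => .push (v + s) b
  | .pop v => .pop (v + s)
  | .branch v p q r => .branch (v + s) (p.shift s) (q.shift s) (r.shift s)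
  | .loop v p => .loop (v + s) (p.shift s)
  | .qnew q => .qnew (q + s)
  | .had q => .had (q + s)
  | .phase q => .phase (q + s)
  | .cnot q r => .cnot (q + s) (r + s)
  | .qmove q r => .qmove (q + s) (r + s)
  | .meas q v => .meas (q + s) (v + s)
  | .qbranch q p r => .qbranch (q + s) (p.shift s) (r.shift s)

/-- The sequence `b 0, …, b (s - 1), f 0, f 1, …`. -/
def glue {α : Type*} (s : ℕ) (b f : ℕ → α) : ℕ → α := fun v => if v < s then b v else f (v - s)

theorem glue_add {α : Type*} (s : ℕ) (b f : ℕ → α) (v : ℕ) : glue s b f (v + s) = f v := by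
  simp [glue]

theorem update_glue {α : Type*} (s : ℕ) (b f : ℕ → α) (v : ℕ) (a : α) :
    Function.update (glue s b f) (v + s) a = glue s b (Function.update f v a) := by
  funext v'
  by_cases h : v' = v + s
  · subst h; simp [glue]
  · rw [Function.update_of_ne h]
    unfold glue
    split_ifs with h'
    · rfl
    · rw [Function.update_of_ne (by omega)]

/-- The basis state with `x'` in the stacks below `s` and `x` in the other stacks. -/
def glueBasis (s : ℕ) (x' x : Basis) : Basis :=
  fun i => if i.1 < s then x' i else x (i.1 - s, i.2)

theorem glueBasis_add (s : ℕ) (x' x : Basis) (q j : ℕ) : glueBasis s x' x (q + s, j) = x (q, j) := by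
  simp [glueBasis]

theorem update_glueBasis (s : ℕ) (x' x : Basis) (q j : ℕ) (b : Bool) :
    Function.update (glueBasis s x' x) (q + s, j) b =
      glueBasis s x' (Function.update x (q, j) b) := by
  funext ⟨q', j'⟩
  by_cases h : (q', j') = (q + s, j)
  · rw [h]; simp [glueBasis]
  · rw [Function.update_of_ne h]
    unfold glueBasis
    split_ifs with h'
    · rfl
    · rw [Function.update_of_ne]
      intro e
      simp only [Prod.mk.injEq] at e h h'
      omega

theorem glueBasis_swap (s : ℕ) (x' x : Basis) (q j r k : ℕ) :
    glueBasis s x' x ∘ Equiv.swap (q + s, j) (r + s, k) =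
      glueBasis s x' (x ∘ Equiv.swap (q, j) (r, k)) := by
  funext ⟨q', j'⟩
  simp only [Function.comp, Equiv.swap_apply_def, glueBasis]
  split_ifs <;> simp_all <;> omega

/-- The tensor product of the memories `σ` (in the stacks below `s`) and `ρ` (in the
other stacks), as a linear map of `ρ`. -/
noncomputable def tensor (s : ℕ) (σ : QState) : QState →ₗ[ℂ] QState :=
  Finsupp.lsum ℂ fun p => LinearMap.toSpanSingleton ℂ QState
    (σ.mapDomain fun p' => (glueBasis s p'.1 p.1, glueBasis s p'.2 p.2))

theorem tensor_single (s : ℕ) (σ : QState) (p : Basis × Basis) (c : ℂ) :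
    tensor s σ (Finsupp.single p c) =
      c • σ.mapDomain fun p' => (glueBasis s p'.1 p.1, glueBasis s p'.2 p.2) := by
  unfold tensor
  rw [Finsupp.lsum_single, LinearMap.toSpanSingleton_apply]

theorem tensor_add_left (s : ℕ) (σ σ' ρ : QState) :
    tensor s (σ + σ') ρ = tensor s σ ρ + tensor s σ' ρ := by
  rw [← LinearMap.add_apply]
  congr 1
  apply Finsupp.lhom_ext
  intro p c
  simp only [LinearMap.add_apply, tensor_single, Finsupp.mapDomain_add, smul_add]

theorem tensor_smul_left (s : ℕ) (a : ℂ) (σ ρ : QState) :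
    tensor s (a • σ) ρ = a • tensor s σ ρ := by
  rw [← LinearMap.smul_apply]
  congr 1
  apply Finsupp.lhom_ext
  intro p c
  simp only [LinearMap.smul_apply, tensor_single, Finsupp.mapDomain_smul, smul_comm c a]

theorem tensor_zero_left (s : ℕ) (ρ : QState) : tensor s 0 ρ = 0 := by
  have := tensor_smul_left s 0 0 ρ
  simpa using this

/-- Both sides are bilinear in `σ` and `ρ`, so it suffices to compare them on single entries. -/
theorem conjugate_tensor (s : ℕ) (σ ρ : QState) {K K' : Basis → (Basis →₀ ℂ)}
    (hK : ∀ x' x, K' (glueBasis s x' x) = (K x).mapDomain (glueBasis s x')) :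
    conjugate K' (tensor s σ ρ) = tensor s σ (conjugate K ρ) := by
  induction σ using Finsupp.induction_linear with
  | zero => rw [tensor_zero_left, tensor_zero_left, conjugate_zero]
  | add σ σ' h h' => rw [tensor_add_left, tensor_add_left, conjugate_add, h, h']
  | single p' a =>
    induction ρ using Finsupp.induction_linear with
    | zero => rw [conjugate_zero, map_zero, conjugate_zero]
    | add ρ ρ' h h' => rw [map_add, conjugate_add, conjugate_add, map_add, h, h']
    | single p c =>
      rw [tensor_single, Finsupp.mapDomain_single, Finsupp.smul_single, conjugate_single, hK, hK,
        conjugate_single, map_smul, map_finsuppSum,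
        Finsupp.sum_mapDomain_index (by simp) (by
          intros; simp only [Finsupp.sum, add_mul, Finsupp.single_add, Finset.sum_add_distrib])]
      rw [smul_eq_mul, mul_smul]
      congr 1
      rw [Finsupp.smul_sum]
      apply Finsupp.sum_congr
      intro x _
      rw [map_finsuppSum, Finsupp.sum_mapDomain_index (by simp) (by
        intros; simp only [star_add, mul_add, Finsupp.single_add]), Finsupp.smul_sum]
      apply Finsupp.sum_congr
      intro y _
      rw [tensor_single, Finsupp.mapDomain_single, Finsupp.smul_single, Finsupp.smul_single]
      congr 1
      simp only [smul_eq_mul]; ring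

theorem gateOp_glueBasis (U : Matrix Bool Bool ℂ) (s q j : ℕ) (x' x : Basis) :
    gateOp U (q + s, j) (glueBasis s x' x) =
      (gateOp U (q, j) x).mapDomain (glueBasis s x') := by
  unfold gateOp
  rw [Finsupp.mapDomain_finsetSum]
  apply Finset.sum_congr rfl
  intro b _
  rw [Finsupp.mapDomain_single, update_glueBasis, glueBasis_add]

theorem cnotOp_glueBasis (s q j r k : ℕ) (x' x : Basis) :
    cnotOp (q + s, j) (r + s, k) (glueBasis s x' x) =
      (cnotOp (q, j) (r, k) x).mapDomain (glueBasis s x') := by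
  unfold cnotOp
  rw [Finsupp.mapDomain_single, update_glueBasis, glueBasis_add, glueBasis_add]

theorem swapOp_glueBasis (s q j r k : ℕ) (x' x : Basis) :
    swapOp (q + s, j) (r + s, k) (glueBasis s x' x) =
      (swapOp (q, j) (r, k) x).mapDomain (glueBasis s x') := by
  unfold swapOp
  rw [Finsupp.mapDomain_single, glueBasis_swap]

theorem measureOp_glueBasis (s q j : ℕ) (o : Bool) (x' x : Basis) :
    measureOp (q + s, j) o (glueBasis s x' x) =
      (measureOp (q, j) o x).mapDomain (glueBasis s x') := by
  unfold measureOp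
  rw [glueBasis_add, update_glueBasis]
  split_ifs
  · rw [Finsupp.mapDomain_single]
  · rw [Finsupp.mapDomain_zero]

/-- The data of a subroutine, which uses the stacks from `s` on, embedded into the
surrounding data `e`. -/
noncomputable def Data.embed (s : ℕ) (e d : Data) : Data :=
  ⟨glue s e.cl d.cl, glue s e.ht d.ht, tensor s e.qu d.qu⟩

/-- The configuration of a subroutine, embedded into the surrounding data `e`. -/
noncomputable def Config.embed (s : ℕ) (e : Data) (c : Config) : Config :=
  ⟨c.ctrl.map (Prog.shift s), glue s e.cl c.cl, glue s e.ht c.ht, tensor s e.qu c.qu⟩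

/-- A shifted program neither reads nor changes stacks below `s`, and each of its tests has the same
result as in the original, so embedding commutes with execution. -/
theorem step_embed (s : ℕ) (e : Data) (c : Config) :
    step (c.embed s e) = (step c).map (Config.embed s e) := by
  obtain ⟨P, cl, ht, qu⟩ := c
  match P with
  | [] => rfl
  | .skip :: K => rfl
  | .seq p p' :: K => rfl
  | .push v b :: K =>
    simp [step, Config.embed, Prog.shift, update_glue, glue_add]
  | .pop v :: K => simp [step, Config.embed, Prog.shift, update_glue, glue_add]
  | .branch v pe p0 p1 :: K =>
    rcases h : cl v with _ | ⟨_ | _, l⟩ <;> simp [step, Config.embed, Prog.shift, glue_add, h]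
  | .loop v p :: K =>
    rcases h : cl v with _ | ⟨b, l⟩ <;> simp [step, Config.embed, Prog.shift, glue_add, h]
  | .qnew r :: K => simp [step, Config.embed, Prog.shift, update_glue, glue_add]
  | .had r :: K =>
    by_cases h : ht r = 0
    · simp [step, Config.embed, Prog.shift, glue_add, h]
    · simp [step, Config.embed, Prog.shift, glue_add, h,
        conjugate_tensor s e.qu qu (gateOp_glueBasis hadamard s r (ht r - 1))]
  | .phase r :: K =>
    by_cases h : ht r = 0
    · simp [step, Config.embed, Prog.shift, glue_add, h]
    · simp [step, Config.embed, Prog.shift, glue_add, h,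
        conjugate_tensor s e.qu qu (gateOp_glueBasis tGate s r (ht r - 1))]
  | .cnot r r' :: K =>
    by_cases h : ht r = 0 ∨ ht r' = 0 ∨ r = r'
    · simp [step, Config.embed, Prog.shift, glue_add, h]
    · simp [step, Config.embed, Prog.shift, glue_add, h,
        conjugate_tensor s e.qu qu (cnotOp_glueBasis s r (ht r - 1) r' (ht r' - 1))]
  | .qmove r r' :: K =>
    by_cases h : ht r = 0 ∨ r = r'
    · simp [step, Config.embed, Prog.shift, glue_add, h]
    · simp [step, Config.embed, Prog.shift, glue_add, h, update_glue,
        conjugate_tensor s e.qu qu (swapOp_glueBasis s r (ht r - 1) r' (ht r'))]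
  | .meas r v :: K =>
    by_cases h : ht r = 0
    · simp [step, Config.embed, Prog.shift, glue_add, h]
    · simp [step, Config.embed, Prog.shift, glue_add, h, update_glue,
        conjugate_tensor s e.qu qu (measureOp_glueBasis s r (ht r - 1) _)]
  | .qbranch r pe pn :: K =>
    by_cases h : ht r = 0 <;> simp [step, Config.embed, Prog.shift, glue_add, h]

theorem run_embed (s : ℕ) (e : Data) (N : ℕ) (c : Config) :
    run N (c.embed s e) = (run N c).map (Config.embed s e) := by
  induction N generalizing c with
  | zero => rfl
  | succ N ih =>
    rw [run_succ, run_succ, step_embed, List.flatMap_map, List.map_flatMap]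
    congr 1; funext c'
    exact ih c'

theorem Runs.embed {p : Prog} {d : Data} {N : ℕ} {D : List Data} (h : Runs [p] d N D) (s : ℕ)
    (e : Data) : Runs [p.shift s] (e.embed s d) N (D.map (e.embed s)) := by
  have h1 := run_embed s e N (d.cfg [p])
  have h : run N (d.cfg [p]) = _ := h
  rw [h] at h1
  unfold Runs
  rw [List.map_map] at h1 ⊢
  exact h1

/-- After the cleanup of a subroutine the caller finds its own memory again, merely scaled by the
probability `a` of the branch. -/
theorem tensor_zeroBasis {s : ℕ} {σ : QState}
    (h : σ.On fun x => ∀ q j, s ≤ q → x (q, j) = false) (a : ℂ) :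
    tensor s σ (a • Finsupp.single (zeroBasis, zeroBasis) 1) = a • σ := by
  rw [map_smul, tensor_single, one_smul]
  congr 1
  conv_rhs => rw [← Finsupp.mapDomain_id (v := σ)]
  apply Finsupp.mapDomain_congr
  intro p hp
  have key : ∀ x : Basis, (∀ q j, s ≤ q → x (q, j) = false) → glueBasis s x zeroBasis = x := by
    intro x hx; funext ⟨q, j⟩
    unfold glueBasis
    split_ifs with h'
    · rfl
    · exact (hx q j (not_lt.1 h')).symm
  have := h hp
  exact Prod.ext (key _ this.1) (key _ this.2)

/-! ### Moving qubits -/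

/-- The basis state whose stacks `a` and `b` hold `h` and `l` bits, listed by `f` and `g`. -/
def stackBasis (a b h l : ℕ) (f g : ℕ → Bool) : Basis := fun i =>
  if i.1 = a ∧ i.2 < h then f i.2 else if i.1 = b ∧ i.2 < l then g i.2 else false

theorem stackBasis_swap {a b h l : ℕ} {f g : ℕ → Bool} (hab : a ≠ b) (hfg : g l = f h) :
    stackBasis a b (h + 1) l f g ∘ Equiv.swap (a, h) (b, l) = stackBasis a b h (l + 1) f g := by
  funext ⟨q, j⟩
  by_cases e1 : (q, j) = (a, h)
  · obtain ⟨rfl, rfl⟩ := Prod.mk.inj e1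
    simp [stackBasis, hab, hab.symm]
  by_cases e2 : (q, j) = (b, l)
  · obtain ⟨rfl, rfl⟩ := Prod.mk.inj e2
    simp [stackBasis, hab.symm, hfg]
  rw [Function.comp, Equiv.swap_apply_of_ne_of_ne e1 e2]
  simp only [Prod.mk.injEq, not_and] at e1 e2
  unfold stackBasis
  dsimp only
  by_cases ha : q = a
  · have := e1 ha
    have : j < h + 1 ↔ j < h := by omega
    simp [ha, this, hab]
  · by_cases hb : q = b
    · have := e2 hb
      have : j < l + 1 ↔ j < l := by omega
      simp [hb, this, hab.symm]
    · simp [ha, hb]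

/-- The memory with the qubits of `ρ` stored according to `β`. -/
noncomputable def spread {N : ℕ} (β : (Fin N → Bool) → Basis) (ρ : QMat N) : QState :=
  ∑ u, ∑ v, Finsupp.single (β u, β v) (ρ u v)

theorem conjugate_swap_spread {N : ℕ} (i j : Cell) (β : (Fin N → Bool) → Basis) (ρ : QMat N) :
    conjugate (swapOp i j) (spread β ρ) = spread (fun u => β u ∘ Equiv.swap i j) ρ := by
  unfold spread
  simp only [← conjugateₗ_apply, map_sum]
  simp only [conjugateₗ_apply, conjugate_single, swapOp]
  simp [-Finsupp.single_mul]

/-- The bits of `u`, continued by zeros. -/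
def extend {N : ℕ} (u : Fin N → Bool) (j : ℕ) : Bool := if h : j < N then u ⟨j, h⟩ else false

/-- The first stage of the transfer: `i` qubits are in stack `1`, in reverse order. -/
noncomputable def reversing {N : ℕ} (ρ : QMat N) (i : ℕ) : QState :=
  spread (fun u => stackBasis 0 1 (N - i) i (extend u) fun j => extend u (N - 1 - j)) ρ

theorem reversing_succ {N : ℕ} (ρ : QMat N) {i : ℕ} (hi : i < N) :
    conjugate (swapOp (0, N - i - 1) (1, i)) (reversing ρ i) = reversing ρ (i + 1) := by
  unfold reversing
  rw [conjugate_swap_spread]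
  congr 1; funext u
  have : N - i = (N - i - 1) + 1 := by omega
  rw [this, Nat.add_sub_cancel, stackBasis_swap (by norm_num) (by congr 1; omega)]
  congr 1

theorem ofMat_eq_reversing {N : ℕ} (ρ : QMat N) : QState.ofMat ρ = reversing ρ 0 := by
  have : ∀ u : Fin N → Bool,
      basisOf u = stackBasis 0 1 (N - 0) 0 (extend u) fun j => extend u (N - 1 - j) := by
    intro u; funext ⟨q, j⟩
    simp only [basisOf, stackBasis, extend]
    split_ifs <;> simp_all
  unfold reversing spread QState.ofMat
  simp only [this]

/-- The memory that holds `k` copies of `φ` in stack `1`, the first copy on top, and with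
`i` qubits already moved to stack `s`. -/
noncomputable def taking (s : ℕ) {m : ℕ} (φ : QMat m) (k i : ℕ) : QState :=
  spread (fun u => stackBasis 1 s (k * m - i) i (fun j => extend u (k * m - 1 - j)) (extend u))
    (tensorPow φ k)

/-- The memory that holds `k` copies of `φ` in stack `1`, the first copy on top. -/
noncomputable def copies (s : ℕ) {m : ℕ} (φ : QMat m) (k : ℕ) : QState := taking s φ k 0

theorem taking_succ {s m : ℕ} (hs : 1 < s) (φ : QMat m) {k i : ℕ} (hi : i < k * m) :
    conjugate (swapOp (1, k * m - i - 1) (s, i)) (taking s φ k i) = taking s φ k (i + 1) := by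
  unfold taking
  rw [conjugate_swap_spread]
  congr 1; funext u
  have : k * m - i = (k * m - i - 1) + 1 := by omega
  rw [this, Nat.add_sub_cancel, stackBasis_swap (by omega) (by congr 1; omega)]
  congr 1

/-- Moving everything from stack `0` to stack `1` reverses the qubits. The first copy then lies on
top with its first qubit uppermost, and moving a block on to stack `s` restores its order. -/
theorem reversing_eq_copies (s : ℕ) {m : ℕ} (φ : QMat m) (k : ℕ) :
    reversing (tensorPow φ k) (k * m) = copies s φ k := by
  unfold reversing copies taking
  congr 1; funext u; funext ⟨q, j⟩
  simp only [stackBasis]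
  split_ifs <;> simp_all; omega

theorem copies_on {s m : ℕ} (hs : 1 < s) (φ : QMat m) (k : ℕ) :
    (copies s φ k).On fun x => ∀ q j, s ≤ q → x (q, j) = false := by
  have : ∀ u : Fin (k * m) → Bool, ∀ q j, s ≤ q →
      stackBasis 1 s (k * m - 0) 0 (fun j => extend u (k * m - 1 - j)) (extend u) (q, j) =
        false := by
    intro u q j hq
    have : q ≠ 1 := by omega
    simp [stackBasis, this]
  exact Submodule.sum_mem _ fun u _ => Submodule.sum_mem _ fun v _ =>
    Finsupp.single_mem_supported ℂ _ ⟨this u, this v⟩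

theorem tr_copies_zero (s : ℕ) {m : ℕ} (φ : QMat m) : (copies s φ 0).tr = 1 := by
  have : IsEmpty (Fin (0 * m)) := by rw [zero_mul]; infer_instance
  simp [copies, taking, spread, tensorPow, tr_single]

/-- Concatenation of the bits of one block and of `k` further blocks. -/
def joinEquiv (m k : ℕ) :
    (Fin m → Bool) × (Fin (k * m) → Bool) ≃ (Fin ((k + 1) * m) → Bool) where
  toFun x j := if h : j < m then x.1 ⟨j, h⟩ else
    x.2 ⟨j - m, by have := j.2; have : (k + 1) * m = k * m + m := Nat.succ_mul k m; omega⟩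
  invFun u := (fun j => u ⟨j, by have := j.2; rw [Nat.succ_mul]; omega⟩,
    fun j => u ⟨m + j, by have := j.2; rw [Nat.succ_mul]; omega⟩)
  left_inv x := by
    ext j
    · simp
    · simp
  right_inv u := by
    ext j
    by_cases h : (j : ℕ) < m
    · simp [h]
    · simp only [h, dite_false]
      exact congrArg u (Fin.ext (by simp; omega))

theorem tensorPow_join {m : ℕ} (φ : QMat m) (k : ℕ) (x y : (Fin m → Bool) × (Fin (k * m) → Bool)) :
    tensorPow φ (k + 1) (joinEquiv m k x) (joinEquiv m k y) =
      φ x.1 y.1 * tensorPow φ k x.2 y.2 := by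
  unfold tensorPow
  rw [Fin.prod_univ_succ]
  have h0 : ∀ (x : (Fin m → Bool) × (Fin (k * m) → Bool)) (j : Fin m),
      joinEquiv m k x (finProdFinEquiv ((0 : Fin (k + 1)), j)) = x.1 j := by
    intro x j
    simp [joinEquiv, finProdFinEquiv]
  have h1 : ∀ (x : (Fin m → Bool) × (Fin (k * m) → Bool)) (i : Fin k) (j : Fin m),
      joinEquiv m k x (finProdFinEquiv (i.succ, j)) = x.2 (finProdFinEquiv (i, j)) := by
    intro x i j
    have : ¬ ((j : ℕ) + m * (i + 1) < m) := by rw [Nat.mul_succ]; omega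
    simp only [joinEquiv, finProdFinEquiv, Equiv.coe_fn_mk, Fin.val_succ, this, dite_false]
    exact congrArg x.2 (Fin.ext (by simp only [Nat.mul_succ]; omega))
  simp only [h0, h1]

theorem stackBasis_join {s m : ℕ} (hs : 1 < s) (k : ℕ)
    (x : (Fin m → Bool) × (Fin (k * m) → Bool)) :
    stackBasis 1 s ((k + 1) * m - m) m
      (fun j => extend (joinEquiv m k x) ((k + 1) * m - 1 - j)) (extend (joinEquiv m k x)) =
    glueBasis s (stackBasis 1 s (k * m - 0) 0
      (fun j => extend x.2 (k * m - 1 - j)) (extend x.2)) (basisOf x.1) := by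
  have hm : (k + 1) * m - m = k * m := by rw [Nat.succ_mul]; omega
  have hm' : (k + 1) * m = k * m + m := Nat.succ_mul k m
  funext ⟨q, j⟩
  simp only [stackBasis, glueBasis, hm, basisOf, Nat.sub_zero]
  by_cases h1 : q = 1
  · subst h1
    simp only [hs, true_and, if_true]
    have hs' : (1 : ℕ) ≠ s := by omega
    by_cases hj : j < k * m
    · simp only [hj, if_true]
      have e1 : (k + 1) * m - 1 - j < (k + 1) * m := by omega
      have e2 : k * m - 1 - j < k * m := by omega
      have e3 : ¬ ((k + 1) * m - 1 - j < m) := by omega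
      simp only [extend, e1, e2, dite_true, joinEquiv, Equiv.coe_fn_mk, e3, dite_false]
      exact congrArg x.2 (Fin.ext (by dsimp only; omega))
    · simp [hj, hs']
  · by_cases h2 : q = s
    · subst h2
      simp only [h1, false_and, if_false, true_and, lt_irrefl, Nat.sub_self]
      by_cases hj : j < m
      · have e1 : j < (k + 1) * m := by omega
        simp [hj, extend, e1, joinEquiv]
      · simp [hj]
    · by_cases h3 : q < s
      · simp [h1, h2, h3]
      · have : q - s ≠ 0 := by omega
        simp [h1, h2, h3, this]

/-- Since the input is a product state, a block of `m` qubits that has been moved is an independent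
copy of `φ`, exactly in the form of an input for a subroutine at `s`. -/
theorem taking_eq_tensor {s m : ℕ} (hs : 1 < s) (φ : QMat m) (k : ℕ) :
    taking s φ (k + 1) m = tensor s (copies s φ k) (QState.ofMat φ) := by
  unfold taking copies taking spread QState.ofMat
  simp only [map_sum, tensor_single, Finsupp.mapDomain_finsetSum, Finsupp.mapDomain_single,
    Finset.smul_sum, Finsupp.smul_single, smul_eq_mul]
  rw [← (joinEquiv m k).sum_comp, Fintype.sum_prod_type]
  apply Finset.sum_congr rfl
  intro u₀ _
  rw [Finset.sum_comm]
  rw [← (joinEquiv m k).sum_comp, Fintype.sum_prod_type]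
  apply Finset.sum_congr rfl
  intro v₀ _
  rw [Finset.sum_comm]
  apply Finset.sum_congr rfl
  intro u _
  apply Finset.sum_congr rfl
  intro v _
  rw [stackBasis_join hs, stackBasis_join hs, tensorPow_join]

/-! ### Distributions of data -/

/-- From the data `d`, the program `p` produces within `N` steps a distribution on the data
`enc x`, for certain `x : σ` with the property `I`, and the expectation of `g` is `val`.
The data depend linearly on a weight. -/
def Yields {σ : Type*} (p : Prog) (N : ℕ) (d : ℝ → Data) (enc : σ → ℝ → Data) (I : σ → Prop)
    (g : σ → ℝ) (val : ℝ) : Prop :=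
  ∃ D : List (ℝ × σ), (∀ w, Runs [p] (d w) N (D.map fun x => enc x.2 (w * x.1))) ∧
    (∀ x ∈ D, 0 ≤ x.1 ∧ I x.2) ∧ (D.map fun x => x.1 * g x.2).sum = val

section Yields

variable {σ τ : Type*} {p q : Prog} {N M : ℕ} {d d' : ℝ → Data} {enc : σ → ℝ → Data}
  {enc' : τ → ℝ → Data} {I : σ → Prop} {J : τ → Prop} {g : σ → ℝ} {h : τ → ℝ} {val : ℝ}

theorem Yields.mono (H : Yields p N d enc I g val) (hN : N ≤ M) : Yields p M d enc I g val := by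
  obtain ⟨D, h1, h2⟩ := H
  exact ⟨D, fun w => (h1 w).mono hN, h2⟩

theorem Yields.of_runs {x : σ} (H : ∀ w, Runs [p] (d w) N [enc x w]) (hx : I x) :
    Yields p N d enc I g (g x) :=
  ⟨[(1, x)], fun w => by simpa using H w, by simpa using hx, by simp⟩

/-- Composition of probabilistic programs. Weights multiply along a branch, which works because each
stage is known for every initial weight `w`. The value `g x` is the expectation of `h` conditioned
on `x`, so expectations compose backwards. -/
theorem exists_bind (D : List (ℝ × σ)) (hD : ∀ x ∈ D, 0 ≤ x.1 ∧ I x.2) {K : List Prog}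
    (H : ∀ x, I x → ∃ E : List (ℝ × τ),
      (∀ w, Runs K (enc x w) M (E.map fun y => enc' y.2 (w * y.1))) ∧
      (∀ y ∈ E, 0 ≤ y.1 ∧ J y.2) ∧ (E.map fun y => y.1 * h y.2).sum = g x)
    {P : List Prog} (hP : ∀ w, Runs P (d w) N (D.map fun x => enc x.2 (w * x.1))) :
    ∃ E : List (ℝ × τ), (∀ w, Runs (P ++ K) (d w) (N + M) (E.map fun y => enc' y.2 (w * y.1))) ∧
      (∀ y ∈ E, 0 ≤ y.1 ∧ J y.2) ∧
      (E.map fun y => y.1 * h y.2).sum = (D.map fun x => x.1 * g x.2).sum := by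
  classical
  have : ∀ x : σ, ∃ E : List (ℝ × τ), I x →
      (∀ w, Runs K (enc x w) M (E.map fun y => enc' y.2 (w * y.1))) ∧
      (∀ y ∈ E, 0 ≤ y.1 ∧ J y.2) ∧ (E.map fun y => y.1 * h y.2).sum = g x := by
    intro x
    by_cases hx : I x
    · obtain ⟨E, hE⟩ := H x hx; exact ⟨E, fun _ => hE⟩
    · exact ⟨[], fun h => absurd h hx⟩
  choose F hF using this
  refine ⟨D.flatMap fun x => (F x.2).map fun y => (x.1 * y.1, y.2), fun w => ?_, ?_, ?_⟩
  · have hmap : (D.flatMap fun x => (F x.2).map fun y => (x.1 * y.1, y.2)).map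
        (fun y => enc' y.2 (w * y.1)) =
        D.flatMap fun x => (F x.2).map fun y => enc' y.2 (w * x.1 * y.1) := by
      rw [List.map_flatMap]
      apply List.flatMap_congr
      intro x _
      rw [List.map_map]
      apply List.map_congr_left
      intro y _
      simp only [Function.comp, mul_assoc]
    rw [hmap]
    unfold Runs
    have hfin := hP w
    have := run_append K N M ((d w).cfg P) hfin.halted
      (fun c => run M ⟨K, c.cl, c.ht, c.qu⟩) (by
        intro c hc M' hM'
        rw [hfin] at hc
        obtain ⟨s, hs, rfl⟩ := List.mem_map.1 hc
        obtain ⟨x, hx, rfl⟩ := List.mem_map.1 hs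
        have h1 := (hF x.2 (hD x hx).2).1 (w * x.1)
        exact (h1.mono hM').trans h1.symm) (N + M) le_rfl
    rw [hfin, List.map_map, List.flatMap_map] at this
    refine this.trans ?_
    rw [List.map_flatMap]
    apply List.flatMap_congr
    intro x hx
    exact (hF x.2 (hD x hx).2).1 (w * x.1)
  · intro y hy
    obtain ⟨x, hx, hy⟩ := List.mem_flatMap.1 hy
    obtain ⟨y', hy', rfl⟩ := List.mem_map.1 hy
    have := (hF x.2 (hD x hx).2).2.1 y' hy'
    exact ⟨mul_nonneg (hD x hx).1 this.1, this.2⟩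
  · rw [sum_map_flatMap_real]
    apply sum_map_congr_list
    intro x hx
    rw [← (hF x.2 (hD x hx).2).2.2, List.map_map, ← List.sum_map_mul_left]
    congr 1
    apply List.map_congr_left
    intro y _
    simp only [Function.comp, mul_assoc]

theorem Yields.seq (H : Yields p N d enc I g val)
    (H' : ∀ x, I x → Yields q M (enc x) enc' J h (g x)) :
    Yields (p.seq q) (N + M + 1) d enc' J h val := by
  obtain ⟨D, h1, h2, h3⟩ := H
  obtain ⟨E, h4, h5, h6⟩ := exists_bind D h2 H' h1
  exact ⟨E, fun w => Runs.of_step (P' := [p, q]) rfl (h4 w), h5, h6.trans h3⟩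

theorem Yields.runs_seq (H : ∀ w, Runs [p] (d w) N [d' w]) (H' : Yields q M d' enc I g val) :
    Yields (p.seq q) (N + M + 1) d enc I g val := by
  have : Yields p N d (fun _ : Unit => d') (fun _ => True) (fun _ => val) val :=
    Yields.of_runs (x := ()) H trivial
  exact this.seq fun _ _ => H'

/-- Rule for loops, with an invariant that depends on the number `j` of rounds. -/
theorem Yields.loop {a : ℕ} (E : ℕ → σ → ℝ → Data) (r : ℕ) (I : ℕ → σ → Prop) (g : ℕ → σ → ℝ)
    (h1 : ∀ j < r, ∀ x w, (E j x w).cl a ≠ []) (h0 : ∀ x w, (E r x w).cl a = [])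
    (hp : ∀ j < r, ∀ x, I j x → Yields p N (E j x) (E (j + 1)) (I (j + 1)) (g (j + 1)) (g j x))
    (x : σ) (hx : I 0 x) :
    Yields (.loop a p) (r * (N + 1) + 1) (E 0 x) (E r) (I r) (g r) (g 0 x) := by
  -- Induction on the number `k` of rounds that remain.
  suffices ∀ k j, j + k = r → ∀ x, I j x →
      Yields (.loop a p) (k * (N + 1) + 1) (E j x) (E r) (I r) (g r) (g j x) from
    this r 0 (by omega) x hx
  intro k
  induction k with
  | zero =>
    intro j hj x hx
    obtain rfl : j = r := by omega
    refine Yields.of_runs (fun w => ?_) hx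
    refine Runs.of_step (s' := E j x w) (P' := []) ?_ (Runs.nil _ _)
    simp [step, Data.cfg, h0]
  | succ k ih =>
    intro j hj x hx
    obtain ⟨D, d1, d2, d3⟩ := hp j (by omega) x hx
    obtain ⟨F, f1, f2, f3⟩ := exists_bind D d2 (fun x' hx' => ih (j + 1) (by omega) x' hx') d1
    refine ⟨F, fun w => ?_, f2, f3.trans d3⟩
    have : Runs [p, .loop a p] (E j x w) (N + (k * (N + 1) + 1))
      (F.map fun y => E r y.2 (w * y.1)) := f1 w
    refine (Runs.of_step (s' := E j x w) (P' := [p, .loop a p]) ?_ this).mono (by ring_nf; omega)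
    have := h1 j (by omega) x w
    rcases e : (E j x w).cl a with _ | ⟨b, l⟩
    · exact absurd e this
    · simp [step, Data.cfg, e]

theorem Runs.loop {a : ℕ} (E : ℕ → ℝ → Data) (r : ℕ) (h1 : ∀ j < r, ∀ w, (E j w).cl a ≠ [])
    (h0 : ∀ w, (E r w).cl a = []) (hp : ∀ j < r, ∀ w, Runs [p] (E j w) N [E (j + 1) w]) :
    ∀ w, Runs [.loop a p] (E 0 w) (r * (N + 1) + 1) [E r w] := by
  suffices ∀ k j, j + k = r → ∀ w, Runs [.loop a p] (E j w) (k * (N + 1) + 1) [E r w] from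
    this r 0 (by omega)
  intro k
  induction k with
  | zero =>
    intro j hj w
    obtain rfl : j = r := by omega
    refine Runs.of_step (s' := E j w) (P' := []) ?_ (Runs.nil _ _)
    simp [step, Data.cfg, h0]
  | succ k ih =>
    intro j hj w
    have := (hp j (by omega) w).cons (K := [.loop a p]) (F := fun _ => [E r w])
      (M := k * (N + 1) + 1)
      (by simpa using ih (j + 1) (by omega) w)
    refine (Runs.of_step (s' := E j w) (P' := [p, .loop a p]) ?_ this).mono (by ring_nf; omega)
    have := h1 j (by omega) w
    rcases e : (E j w).cl a with _ | ⟨b, l⟩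
    · exact absurd e this
    · simp [step, Data.cfg, e]

end Yields

theorem Runs.seq_one {p q : Prog} {s s' : Data} {N M : ℕ} {D : List Data}
    (h : Runs [p] s N [s']) (h' : Runs [q] s' M D) : Runs [p.seq q] s (N + M + 1) D := by
  have := Runs.seq (F := fun _ => D) h (by simpa using h')
  simpa using this

theorem Runs.seq_le {p q : Prog} {s s' : Data} {N M T : ℕ} {D : List Data}
    (h : Runs [p] s N [s']) (h' : Runs [q] s' M D) (hT : N + M + 1 ≤ T) :
    Runs [p.seq q] s T D :=
  (Runs.seq_one h h').mono hT

theorem Runs.skip (s : Data) (N : ℕ) : Runs [.skip] s (N + 1) [s] :=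
  Runs.of_step (P' := []) rfl (Runs.nil s N)

theorem Runs.branch_nil {v : ℕ} {p p0 p1 : Prog} {s : Data} {N : ℕ} {D : List Data}
    (hv : s.cl v = []) (h : Runs [p] s N D) : Runs [.branch v p p0 p1] s (N + 1) D :=
  Runs.of_step (s' := s) (P' := [p]) (by simp [step, Data.cfg, hv]) h

theorem Runs.branch_false {v : ℕ} {p p0 p1 : Prog} {s : Data} {N : ℕ} {D : List Data}
    (l : List Bool) (hv : s.cl v = false :: l) (h : Runs [p0] s N D) :
    Runs [.branch v p p0 p1] s (N + 1) D :=
  Runs.of_step (s' := s) (P' := [p0]) (by simp [step, Data.cfg, hv]) h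

theorem Runs.branch_true {v : ℕ} {p p0 p1 : Prog} {s : Data} {N : ℕ} {D : List Data}
    (l : List Bool) (hv : s.cl v = true :: l) (h : Runs [p1] s N D) :
    Runs [.branch v p p0 p1] s (N + 1) D :=
  Runs.of_step (s' := s) (P' := [p1]) (by simp [step, Data.cfg, hv]) h

/-! ### Manipulation of classical stacks -/

/-- Classical stacks with the contents listed by `l`. -/
def stackList (l : List (List Bool)) : ℕ → List Bool := fun v => l.getD v []

theorem update_stackList (l : List (List Bool)) {v : ℕ} (hv : v < l.length) (x : List Bool) :
    Function.update (stackList l) v x = stackList (l.set v x) := by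
  funext v'
  unfold stackList
  by_cases h : v' = v
  · subst h; simp [hv]
  · rw [Function.update_of_ne h]
    simp [List.getD_eq_getElem?_getD, Ne.symm h]

theorem runs_push (l : List (List Bool)) (ht : ℕ → ℕ) (qu : QState) (v : ℕ) (b : Bool)
    (hv : v < l.length) : Runs [.push v b] ⟨stackList l, ht, qu⟩ 1
      [⟨stackList (l.set v (b :: l.getD v [])), ht, qu⟩] := by
  rw [← update_stackList l hv]
  exact Runs.of_step (P' := []) rfl (Runs.nil _ 0)

theorem runs_pop (l : List (List Bool)) (ht : ℕ → ℕ) (qu : QState) (v : ℕ)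
    (hv : v < l.length) : Runs [.pop v] ⟨stackList l, ht, qu⟩ 1
      [⟨stackList (l.set v (l.getD v []).tail), ht, qu⟩] := by
  rw [← update_stackList l hv]
  exact Runs.of_step (P' := []) rfl (Runs.nil _ 0)

theorem runs_clear_stackList (l : List (List Bool)) (ht : ℕ → ℕ) (qu : QState) (v : ℕ)
    (hv : v < l.length) : Runs [clear v] ⟨stackList l, ht, qu⟩ (2 * (l.getD v []).length + 1)
      [⟨stackList (l.set v []), ht, qu⟩] := by
  rw [← update_stackList l hv]
  exact runs_clear v (stackList l) ht qu

/-- Move the bits of stack `a` to stack `b`, which reverses their order. -/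
def transfer (a b : ℕ) : Prog :=
  .loop a (.branch a .skip (.seq (.pop a) (.push b false)) (.seq (.pop a) (.push b true)))

theorem runs_transfer (l : List (List Bool)) (ht : ℕ → ℕ) (qu : QState) {a b : ℕ}
    (ha : a < l.length) (hb : b < l.length) (hab : a ≠ b) :
    Runs [transfer a b] ⟨stackList l, ht, qu⟩ (5 * (l.getD a []).length + 1)
      [⟨stackList ((l.set a []).set b ((l.getD a []).reverse ++ l.getD b [])), ht, qu⟩] := by
  rw [← update_stackList _ (by simpa using hb), ← update_stackList l ha]
  change Runs _ _ _ [⟨Function.update (Function.update (stackList l) a []) b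
    ((stackList l a).reverse ++ stackList l b), ht, qu⟩]
  change Runs _ _ (5 * (stackList l a).length + 1) _
  generalize stackList l = cl
  generalize h : cl a = x
  induction x generalizing cl with
  | nil =>
    refine Runs.of_step (s' := ⟨cl, ht, qu⟩) (P' := []) (by simp [step, Data.cfg, transfer, h]) ?_
    rw [← h, Function.update_eq_self, h]
    simp only [List.reverse_nil, List.nil_append, Function.update_eq_self]
    exact Runs.nil _ _
  | cons o x ih =>
    have key : Runs [transfer a b] ⟨Function.update (Function.update cl a x) b (o :: cl b), ht, qu⟩
        (5 * x.length + 1)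
        [⟨Function.update (Function.update cl a []) b ((o :: x).reverse ++ cl b), ht, qu⟩] := by
      have := ih (Function.update (Function.update cl a x) b (o :: cl b)) (by simp [hab])
      refine Eq.mp (congrArg (fun c : ℕ → List Bool => Runs _ _ _ [⟨c, ht, qu⟩])
        (funext fun v => ?_)) this
      by_cases h2 : v = b
      · subst h2; simp
      by_cases h3 : v = a
      · subst h3; simp [h2]
      simp [h2, h3]
    have e : 5 * (o :: x).length + 1 = 5 * x.length + 1 + 1 + 1 + 1 + 1 + 1 := by simp; omega
    rw [e]
    refine Runs.of_step (s' := ⟨cl, ht, qu⟩)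
      (P' := [.branch a .skip (.seq (.pop a) (.push b false)) (.seq (.pop a) (.push b true)),
        transfer a b]) (by simp [step, Data.cfg, transfer, h]) ?_
    refine Runs.of_step (s' := ⟨cl, ht, qu⟩)
      (P' := [.seq (.pop a) (.push b o), transfer a b]) (by
        cases o <;> simp [step, Data.cfg, h]) ?_
    refine Runs.of_step (s' := ⟨cl, ht, qu⟩)
      (P' := [.pop a, .push b o, transfer a b]) rfl ?_
    refine Runs.of_step (s' := ⟨Function.update cl a x, ht, qu⟩)
      (P' := [.push b o, transfer a b]) (by simp [step, Data.cfg, h]) ?_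
    refine Runs.of_step (P' := [transfer a b]) ?_ key
    simp [step, Data.cfg, hab.symm]

/-- Move the bits of stack `a` to both stacks `b` and `c`, which reverses their order. -/
def fork (a b c : ℕ) : Prog :=
  .loop a (.branch a .skip (.seq (.pop a) (.seq (.push b false) (.push c false)))
    (.seq (.pop a) (.seq (.push b true) (.push c true))))

theorem runs_fork (l : List (List Bool)) (ht : ℕ → ℕ) (qu : QState) {a b c : ℕ}
    (ha : a < l.length) (hb : b < l.length) (hc : c < l.length) (hab : a ≠ b) (hac : a ≠ c)
    (hbc : b ≠ c) :
    Runs [fork a b c] ⟨stackList l, ht, qu⟩ (7 * (l.getD a []).length + 1)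
      [⟨stackList (((l.set a []).set b ((l.getD a []).reverse ++ l.getD b [])).set c
        ((l.getD a []).reverse ++ l.getD c [])), ht, qu⟩] := by
  rw [← update_stackList _ (by simpa using hc), ← update_stackList _ (by simpa using hb),
    ← update_stackList l ha]
  change Runs _ _ _ [⟨Function.update (Function.update (Function.update (stackList l) a []) b
    ((stackList l a).reverse ++ stackList l b)) c ((stackList l a).reverse ++ stackList l c), ht, qu⟩]
  change Runs _ _ (7 * (stackList l a).length + 1) _
  generalize stackList l = cl
  generalize h : cl a = x
  induction x generalizing cl with
  | nil =>
    refine Runs.of_step (s' := ⟨cl, ht, qu⟩) (P' := []) (by simp [step, Data.cfg, fork, h]) ?_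
    rw [← h, Function.update_eq_self, h]
    simp only [List.reverse_nil, List.nil_append, Function.update_eq_self]
    exact Runs.nil _ _
  | cons o x ih =>
    have key : Runs [fork a b c] ⟨Function.update (Function.update (Function.update cl a x) b
          (o :: cl b)) c (o :: cl c), ht, qu⟩ (7 * x.length + 1)
        [⟨Function.update (Function.update (Function.update cl a []) b
          ((o :: x).reverse ++ cl b)) c ((o :: x).reverse ++ cl c), ht, qu⟩] := by
      have := ih (Function.update (Function.update (Function.update cl a x) b
          (o :: cl b)) c (o :: cl c)) (by simp [hab, hac])
      refine Eq.mp (congrArg (fun c : ℕ → List Bool => Runs _ _ _ [⟨c, ht, qu⟩])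
        (funext fun v => ?_)) this
      by_cases h1 : v = c
      · subst h1; simp
      by_cases h2 : v = b
      · subst h2; simp [hbc]
      by_cases h3 : v = a
      · subst h3; simp [h1, h2]
      simp [h1, h2, h3]
    have e : 7 * (o :: x).length + 1 = 7 * x.length + 1 + 1 + 1 + 1 + 1 + 1 + 1 + 1 := by
      simp; omega
    rw [e]
    refine Runs.of_step (s' := ⟨cl, ht, qu⟩)
      (P' := [.branch a .skip (.seq (.pop a) (.seq (.push b false) (.push c false)))
        (.seq (.pop a) (.seq (.push b true) (.push c true))), fork a b c])
      (by simp [step, Data.cfg, fork, h]) ?_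
    refine Runs.of_step (s' := ⟨cl, ht, qu⟩)
      (P' := [.seq (.pop a) (.seq (.push b o) (.push c o)), fork a b c]) (by
        cases o <;> simp [step, Data.cfg, h]) ?_
    refine Runs.of_step (s' := ⟨cl, ht, qu⟩)
      (P' := [.pop a, .seq (.push b o) (.push c o), fork a b c]) rfl ?_
    refine Runs.of_step (s' := ⟨Function.update cl a x, ht, qu⟩)
      (P' := [.seq (.push b o) (.push c o), fork a b c]) (by simp [step, Data.cfg, h]) ?_
    refine Runs.of_step (s' := ⟨Function.update cl a x, ht, qu⟩)
      (P' := [.push b o, .push c o, fork a b c]) rfl ?_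
    refine Runs.of_step (s' := ⟨Function.update (Function.update cl a x) b (o :: cl b), ht, qu⟩)
      (P' := [.push c o, fork a b c]) (by simp [step, Data.cfg, hab.symm]) ?_
    refine Runs.of_step (P' := [fork a b c]) ?_ key
    simp [step, Data.cfg, hac.symm, hbc.symm]

theorem unary_succ (n : ℕ) : unary (n + 1) = true :: unary n := rfl

theorem length_unary (n : ℕ) : (unary n).length = n := List.length_replicate

theorem reverse_unary (n : ℕ) : (unary n).reverse = unary n := List.reverse_replicate

theorem unary_append (n m : ℕ) : unary n ++ unary m = unary (n + m) :=
  List.replicate_append_replicate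

/-- Repeat `p` as often as stack `a` has elements; `b` is an auxiliary stack. -/
def forLoop (a b : ℕ) (p : Prog) : Prog :=
  .seq (.loop a (.seq (.pop a) (.seq (.push b true) p))) (transfer b a)

/-- Data in which the classical stacks are given by a list. -/
structure ListData where
  l : List (List Bool)
  ht : ℕ → ℕ
  qu : QState

/-- The data described by `s`, with `i` and `j` in the counters `a` and `b`. -/
def ListData.ctr (s : ListData) (a b i j : ℕ) : Data :=
  ⟨stackList ((s.l.set a (unary i)).set b (unary j)), s.ht, s.qu⟩

theorem getD_set_set {l : List (List Bool)} {a b : ℕ} (ha : a < l.length) (hab : a ≠ b)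
    (x y : List Bool) : ((l.set a x).set b y).getD a [] = x := by
  simp [List.getD_eq_getElem?_getD, hab.symm, ha]

theorem getD_set_set' {l : List (List Bool)} {a b : ℕ} (hb : b < l.length)
    (x y : List Bool) : ((l.set a x).set b y).getD b [] = y := by
  simp [List.getD_eq_getElem?_getD, hb]

theorem set_set_set (l : List (List Bool)) {a b : ℕ} (hab : a ≠ b)
    (x y z : List Bool) : ((l.set a x).set b y).set a z = (l.set a z).set b y := by
  rw [List.set_comm _ _ hab.symm, List.set_set]

/-- Both counters are updated before the body, so in round `j` the body sees `r - j - 1` and `j +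
1`. The final transfer restores `a`, and the loop can be run again. -/
theorem Yields.forLoop {σ : Type*} {p : Prog} {N a b : ℕ} (E : ℕ → σ → ℝ → ListData) (r : ℕ)
    (I : ℕ → σ → Prop) (g : ℕ → σ → ℝ) (hab : a ≠ b)
    (hE : ∀ j x w, a < (E j x w).l.length ∧ b < (E j x w).l.length)
    (hp : ∀ j < r, ∀ x, I j x → Yields p N (fun w => (E j x w).ctr a b (r - j - 1) (j + 1))
      (fun x w => (E (j + 1) x w).ctr a b (r - j - 1) (j + 1)) (I (j + 1)) (g (j + 1)) (g j x))
    (x : σ) (hx : I 0 x) :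
    Yields (forLoop a b p) (r * (N + 10) + 3) (fun w => (E 0 x w).ctr a b r 0)
      (fun x w => (E r x w).ctr a b r 0) (I r) (g r) (g 0 x) := by
  have hloop := Yields.loop (a := a) (p := .seq (.pop a) (.seq (.push b true) p))
    (fun j x w => (E j x w).ctr a b (r - j) j) r I g (N := 1 + (1 + N + 1) + 1)
    (by
      intro j hj x w
      obtain ⟨i, hi⟩ : ∃ i, r - j = i + 1 := ⟨r - j - 1, by omega⟩
      simp only [ListData.ctr, stackList, getD_set_set (hE j x w).1 hab, hi, unary_succ]
      exact List.cons_ne_nil _ _)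
    (by
      intro x w
      simp only [ListData.ctr, stackList, getD_set_set (hE r x w).1 hab, Nat.sub_self]
      rfl)
    (by
      intro j hj x hx
      obtain ⟨i, hi⟩ : ∃ i, r - j = i + 1 := ⟨r - j - 1, by omega⟩
      have hp := hp j hj x hx
      have hi' : r - (j + 1) = i := by omega
      have hi'' : r - j - 1 = i := by omega
      simp only [hi, hi'] at hp ⊢
      refine Yields.runs_seq (d' := fun w => (E j x w).ctr a b i j) (fun w => ?_)
        (Yields.runs_seq (d' := fun w => (E j x w).ctr a b i (j + 1)) (fun w => ?_) hp)
      · have h1 := (hE j x w).1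
        have := runs_pop (((E j x w).l.set a (unary (i + 1))).set b (unary j)) (E j x w).ht
          (E j x w).qu a (by simpa using h1)
        rw [getD_set_set h1 hab, set_set_set _ hab] at this
        exact this
      · have h2 := (hE j x w).2
        have := runs_push (((E j x w).l.set a (unary i)).set b (unary j)) (E j x w).ht
          (E j x w).qu b true (by simpa using h2)
        rw [getD_set_set' h2, List.set_set] at this
        exact this)
    x hx
  have e : r * (N + 10) + 3 = (r * (1 + (1 + N + 1) + 1 + 1) + 1) + (5 * r + 1) + 1 := by ring
  rw [e]
  refine Yields.seq hloop fun x hx => Yields.of_runs (x := x) (fun w => ?_) hx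
  have h1 := (hE r x w).1
  have h2 := (hE r x w).2
  have := runs_transfer (a := b) (b := a) (((E r x w).l.set a (unary (r - r))).set b (unary r))
    (E r x w).ht (E r x w).qu (by simpa using h2) (by simpa using h1) hab.symm
  rw [getD_set_set' h2, getD_set_set h1 hab, List.set_set, set_set_set _ hab, reverse_unary,
    unary_append, length_unary, Nat.sub_self, Nat.add_zero] at this
  simp only [Nat.sub_self]
  exact this

/-! ### The adversary: a single test -/

theorem glue_stackList {s : ℕ} {l : List (List Bool)} (hl : l.length = s) (y : List Bool) :
    glue s (stackList l) (fun v => if v = 0 then y else []) = stackList (l ++ [y]) := by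
  subst hl
  funext v
  unfold glue stackList
  by_cases h : v < l.length
  · simp [h, List.getD_eq_getElem?_getD, List.getElem?_append_left h]
  · simp only [h, if_false, List.getD_eq_getElem?_getD, List.getElem?_append_right (not_lt.1 h)]
    by_cases h' : v - l.length = 0
    · simp [h']
    · obtain ⟨i, hi⟩ : ∃ i, v - l.length = i + 1 := ⟨v - l.length - 1, by omega⟩
      simp [hi]

/-- Rule for calls of subroutines. -/
theorem Yields.call {D : Set (List Bool × ℕ)} (A : QPT D) {y : List Bool} {n : ℕ}
    (h : (y, n) ∈ D) {φ : QMat n} (hφ : IsDensity φ) {s : ℕ} {l : List (List Bool)}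
    (hl : l.length = s) {ht : ℕ → ℕ} (hht : ∀ q, s ≤ q → ht q = 0) {σ : QState}
    (hσ : σ.On fun x => ∀ q j, s ≤ q → x (q, j) = false) (g : List Bool → ℝ) :
    Yields ((cleaned A.prog).shift s) (A.cleanTime (y.length + n))
      (fun w : ℝ => Data.embed s ⟨stackList l, ht, (w : ℂ) • σ⟩ (startData y φ))
      (fun (x : List Bool) (w : ℝ) => ⟨stackList (l ++ [x]), ht, (w : ℂ) • σ⟩)
      (fun x => x.length ≤ A.heightBound (y.length + n)) g (A.expect y φ g) := by
  obtain ⟨L, h1, h2, h3, -⟩ := A.exists_runs_cleaned h hφ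
  refine ⟨L, fun w => ?_, h2, h3 g⟩
  have := h1.embed s ⟨stackList l, ht, (w : ℂ) • σ⟩
  rw [List.map_map] at this
  convert this using 2
  funext x
  simp only [Function.comp, Data.embed, outputData, glue_stackList hl, tensor_smul_left,
    tensor_zeroBasis hσ]
  congr 1
  · funext q
    unfold glue
    split_ifs with hq
    · rfl
    · exact hht q (not_lt.1 hq)
  · rw [smul_smul]; push_cast; rfl

/-- Stack heights while `N` qubits are in stack `1` and `i` qubits in stack `13`. -/
def heights (N i : ℕ) : ℕ → ℕ := fun q => if q = 1 then N else if q = 13 then i else 0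

/-- Move a block of qubits from stack `1` to stack `13`. -/
def takeBlock : Prog := .loop 6 (.seq (.pop 6) (.seq (.push 7 true) (.qmove 1 13)))

/-- Evaluate the output in stack `13` of the verification. Stack `10` is nonempty as long as no
test has failed. -/
def judge : Prog :=
  .seq (.branch 13 (.pop 10) (.pop 10) (.seq (.pop 13) (.branch 13 .skip (.pop 10) (.pop 10))))
    (.seq (clear 13) (.branch 10 .skip .skip (.seq (.push 11 true) (.pop 12))))

/-- Run the verification of the key in stack `8` on a fresh copy of the state. -/
def testProg (ver : Prog) : Prog :=
  -- Two reversals give back the key, once in stack `8` for later tests and once in stack `13`,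
  -- which is stack `0` of the shifted subroutine.
  .seq (transfer 8 9) (.seq (fork 9 8 13) (.seq takeBlock (.seq (transfer 7 6)
    (.seq ((cleaned ver).shift 13) judge))))

/-- The flag in stack `10`. -/
def flag (f : Bool) : List Bool := if f then [true] else []

/-- The effect of a test with result `o` on the flag and the counters in stacks `11`, `12`. -/
def record (o : Bool) (x : Bool × ℕ × ℕ) : Bool × ℕ × ℕ :=
  if x.1 && o then (true, x.2.1 + 1, x.2.2 - 1) else (false, x.2)

theorem tail_unary (n : ℕ) : (unary n).tail = unary (n - 1) := List.tail_replicate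

variable (y₀ y₁ y₂ y₃ y₄ y₅ y₆ y₇ y₈ y₉ y₁₀ y₁₁ y₁₂ y : List Bool) (ht : ℕ → ℕ)

theorem record_eq (o f : Bool) (c b : ℕ) :
    record o (f, c, b) = (f && o, if f && o then c + 1 else c, if f && o then b - 1 else b) := by
  cases f <;> cases o <;> rfl

/-- Layout of the classical stacks during the search: `0` best key, `1` security parameter, `2`, `3`
and `4`, `5` loop counters, `6`, `7` number of qubits of a copy, `8` current key, `9` scratch, `10`
flag, `11` successes of the current key, `12` record still to be matched, `13` input and output of
subroutines. -/
theorem runs_judge (qu : QState) (x : Bool × ℕ × ℕ) :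
    Runs [judge] ⟨stackList [y₀, y₁, y₂, y₃, y₄, y₅, y₆, y₇, y₈, y₉, flag x.1, unary x.2.1,
        unary x.2.2, y], ht, qu⟩ (2 * y.length + 20)
      [⟨stackList [y₀, y₁, y₂, y₃, y₄, y₅, y₆, y₇, y₈, y₉, flag (record (y = [true]) x).1,
        unary (record (y = [true]) x).2.1, unary (record (y = [true]) x).2.2, []], ht, qu⟩] := by
  obtain ⟨f, c, b⟩ := x
  have second : ∀ (f : Bool) (y' : List Bool), y'.length ≤ y.length →
      Runs [.seq (clear 13) (.branch 10 .skip .skip (.seq (.push 11 true) (.pop 12)))]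
        ⟨stackList [y₀, y₁, y₂, y₃, y₄, y₅, y₆, y₇, y₈, y₉, flag f, unary c, unary b, y'], ht, qu⟩
        (2 * y.length + 10)
        [⟨stackList [y₀, y₁, y₂, y₃, y₄, y₅, y₆, y₇, y₈, y₉, flag f,
          unary (if f then c + 1 else c), unary (if f then b - 1 else b), []], ht, qu⟩] := by
    intro f y' hy'
    have h1 := runs_clear_stackList [y₀, y₁, y₂, y₃, y₄, y₅, y₆, y₇, y₈, y₉, flag f, unary c,
      unary b, y'] ht qu 13 (by simp)
    refine Runs.seq_le (h1.mono (M := 2 * y.length + 1) (by simpa using hy')) (M := 5) ?_ (by omega)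
    cases f with
    | false =>
      exact Runs.branch_nil rfl (Runs.skip _ _)
    | true =>
      refine Runs.branch_true [] rfl ?_
      have h2 := runs_push [y₀, y₁, y₂, y₃, y₄, y₅, y₆, y₇, y₈, y₉, [true], unary c,
        unary b, []] ht qu 11 true (by simp)
      have h3 := runs_pop [y₀, y₁, y₂, y₃, y₄, y₅, y₆, y₇, y₈, y₉, [true], unary (c + 1),
        unary b, []] ht qu 12 (by simp)
      have := Runs.seq_le (T := 4) h2 h3 (by omega)
      simp only [List.getD_cons_succ, List.getD_cons_zero, List.set_cons_succ, List.set_cons_zero,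
        tail_unary] at this
      exact this
  have fail : ∀ (y' : List Bool), Runs [.pop 10]
        ⟨stackList [y₀, y₁, y₂, y₃, y₄, y₅, y₆, y₇, y₈, y₉, flag f, unary c, unary b, y'], ht, qu⟩ 1
        [⟨stackList [y₀, y₁, y₂, y₃, y₄, y₅, y₆, y₇, y₈, y₉, flag false, unary c, unary b, y'],
          ht, qu⟩] := by
    intro y'
    have := runs_pop [y₀, y₁, y₂, y₃, y₄, y₅, y₆, y₇, y₈, y₉, flag f, unary c,
        unary b, y'] ht qu 10 (by simp)
    have e : (flag f).tail = flag false := by cases f <;> rfl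
    simp only [List.getD_cons_succ, List.getD_cons_zero, List.set_cons_succ, List.set_cons_zero,
      e] at this
    exact this
  have first : ∃ y' : List Bool, y'.length ≤ y.length ∧
      Runs [.branch 13 (.pop 10) (.pop 10) (.seq (.pop 13) (.branch 13 .skip (.pop 10) (.pop 10)))]
        ⟨stackList [y₀, y₁, y₂, y₃, y₄, y₅, y₆, y₇, y₈, y₉, flag f, unary c, unary b, y], ht, qu⟩ 6
        [⟨stackList [y₀, y₁, y₂, y₃, y₄, y₅, y₆, y₇, y₈, y₉, flag (f && decide (y = [true])),
          unary c, unary b, y'], ht, qu⟩] := by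
    rcases y with _ | ⟨_ | _, y⟩
    · refine ⟨[], le_rfl, Runs.branch_nil rfl ?_⟩
      simpa using (fail []).mono (by norm_num)
    · refine ⟨false :: y, le_rfl, Runs.branch_false y rfl ?_⟩
      simpa using (fail (false :: y)).mono (by norm_num)
    · refine ⟨y, by simp, Runs.branch_true y rfl ?_⟩
      refine Runs.seq_le (runs_pop [y₀, y₁, y₂, y₃, y₄, y₅, y₆, y₇, y₈, y₉, flag f, unary c,
        unary b, true :: y] ht qu 13 (by simp)) (M := 3) ?_ (by norm_num)
      rcases y with _ | ⟨_ | _, y⟩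
      · refine Runs.branch_nil rfl ?_
        simpa using Runs.skip _ _
      · refine Runs.branch_false y rfl ?_
        simpa using (fail (false :: y)).mono (by norm_num)
      · refine Runs.branch_true y rfl ?_
        simpa using (fail (true :: y)).mono (by norm_num)
  obtain ⟨y', hy', h1⟩ := first
  rw [record_eq]
  exact Runs.seq_le h1 (second _ y' hy') (by omega)

theorem update_heights_take (N i : ℕ) :
    Function.update (Function.update (heights (N + 1) i) 1 (heights (N + 1) i 1 - 1)) 13
      (heights (N + 1) i 13 + 1) = heights N (i + 1) := by
  funext q
  by_cases h : q = 13
  · subst h; simp [heights]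
  · rw [Function.update_of_ne h]
    by_cases h' : q = 1
    · subst h'; simp [heights]
    · rw [Function.update_of_ne h']; simp [heights, h, h']

theorem runs_takeBlock {m : ℕ} (φ : QMat m) (k : ℕ) (w : ℝ) :
    Runs [takeBlock] ⟨stackList [y₀, y₁, y₂, y₃, y₄, y₅, unary m, [], y₈, y₉, y₁₀, y₁₁, y₁₂, y],
        heights ((k + 1) * m) 0, (w : ℂ) • copies 13 φ (k + 1)⟩ (m * 10 + 1)
      [⟨stackList [y₀, y₁, y₂, y₃, y₄, y₅, [], unary m, y₈, y₉, y₁₀, y₁₁, y₁₂, y],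
        heights (k * m) m, tensor 13 ((w : ℂ) • copies 13 φ k) (QState.ofMat φ)⟩] := by
  have hm : (k + 1) * m = k * m + m := Nat.succ_mul k m
  have := Runs.loop (a := 6) (N := 9) (p := .seq (.pop 6) (.seq (.push 7 true) (.qmove 1 13)))
    (fun i w => ⟨stackList [y₀, y₁, y₂, y₃, y₄, y₅, unary (m - i), unary i, y₈, y₉, y₁₀, y₁₁, y₁₂,
      y], heights ((k + 1) * m - i) i, ((w : ℝ) : ℂ) • taking 13 φ (k + 1) i⟩) m
    (by
      intro j hj w
      obtain ⟨i, hi⟩ : ∃ i, m - j = i + 1 := ⟨m - j - 1, by omega⟩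
      simp [stackList, hi, unary_succ])
    (by intro w; simp [stackList, unary])
    (by
      intro j hj w
      obtain ⟨i, hi⟩ : ∃ i, m - j = i + 1 := ⟨m - j - 1, by omega⟩
      obtain ⟨N, hN⟩ : ∃ N, (k + 1) * m - j = N + 1 := ⟨(k + 1) * m - j - 1, by omega⟩
      have hi' : m - (j + 1) = i := by omega
      have hN' : (k + 1) * m - (j + 1) = N := by omega
      rw [hi, hN, hi', hN', unary_succ]
      refine Runs.seq_le (runs_pop _ _ _ 6 (by simp)) (M := 4) ?_ (by norm_num)
      refine Runs.seq_le (runs_push _ _ _ 7 true (by simp)) (M := 1) ?_ (by norm_num)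
      refine Runs.of_step (P' := []) ?_ (Runs.nil _ _)
      have h0 : heights (N + 1) j 1 = N + 1 := rfl
      have h13 : heights (N + 1) j 13 = j := rfl
      have ht := taking_succ (s := 13) (by norm_num) φ (k := k + 1) (i := j) (by omega)
      rw [hN, Nat.add_sub_cancel] at ht
      have hu := update_heights_take N j
      rw [h0, h13, Nat.add_sub_cancel] at hu
      simp only [step, Data.cfg, h0, h13, Nat.add_sub_cancel, conjugate_smul, ht, hu]
      simp [unary_succ]) w
  have e : (k + 1) * m - m = k * m := by omega
  rw [taking_eq_tensor (by norm_num), e, ← tensor_smul_left, Nat.sub_self, Nat.sub_zero] at this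
  exact this

namespace QPT

variable {D : Set (List Bool × ℕ)} (A : QPT D) {w : List Bool} {n : ℕ} {φ : QMat n}

theorem expect_add (f g : List Bool → ℝ) :
    A.expect w φ (fun y => f y + g y) = A.expect w φ f + A.expect w φ g := by
  unfold expect
  simp only [mul_add, List.sum_map_add]

theorem expect_mul (a : ℝ) (f : List Bool → ℝ) :
    A.expect w φ (fun y => a * f y) = a * A.expect w φ f := by
  unfold expect
  simp only [mul_left_comm, List.sum_map_mul_left]

theorem expect_one (h : (w, n) ∈ D) (hφ : IsDensity φ) : A.expect w φ (fun _ => 1) = 1 := by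
  obtain ⟨L, -, -, h3, h4⟩ := A.exists_runs_cleaned h hφ
  rw [← h3]; simpa using h4

theorem expect_mono (h : (w, n) ∈ D) (hφ : IsDensity φ) {f g : List Bool → ℝ}
    (hfg : ∀ y, y.length ≤ A.heightBound (w.length + n) → f y ≤ g y) :
    A.expect w φ f ≤ A.expect w φ g := by
  obtain ⟨L, -, h2, h3, -⟩ := A.exists_runs_cleaned h hφ
  rw [← h3, ← h3]
  exact List.sum_le_sum fun x hx => mul_le_mul_of_nonneg_left (hfg _ (h2 x hx).2) (h2 x hx).1

theorem prob_nonneg (h : (w, n) ∈ D) (hφ : IsDensity φ) (y : List Bool) : 0 ≤ A.prob w φ y := by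
  have := A.expect_mono h hφ (f := fun _ => 0) (g := fun z => if z = y then 1 else 0)
    (fun z _ => by split_ifs <;> norm_num)
  refine le_trans (le_of_eq ?_) this
  simp [expect]

theorem prob_le_one (h : (w, n) ∈ D) (hφ : IsDensity φ) (y : List Bool) : A.prob w φ y ≤ 1 := by
  rw [← A.expect_one h hφ]
  exact A.expect_mono h hφ fun z _ => by split_ifs <;> norm_num

theorem expect_ite (h : (w, n) ∈ D) (hφ : IsDensity φ) (y : List Bool) (a b : ℝ) :
    A.expect w φ (fun z => if z = y then a else b) =
      A.prob w φ y * a + (1 - A.prob w φ y) * b := by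
  have : (fun z => if z = y then a else b) =
      fun z => (a - b) * (if z = y then 1 else 0) + b * 1 := by
    funext z; split_ifs <;> ring
  rw [this, expect_add, expect_mul, expect_mul, A.expect_one h hφ]
  unfold prob; ring

end QPT

theorem glue_heights (N i : ℕ) :
    glue 13 (heights N 0) (fun q => if q = 0 then i else 0) = heights N i := by
  funext q
  simp only [glue, heights]
  split_ifs <;> first | rfl | omega

theorem heights_zero {N q : ℕ} (hq : 13 ≤ q) : heights N 0 q = 0 := by
  unfold heights; split_ifs <;> omega

variable (y₀ y₁ y₂ y₃ y₄ y₅ : List Bool)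

/-- A bound on the time for a test. -/
def testTime (L m T H : ℕ) : ℕ := 12 * L + 15 * m + T + 2 * H + 50

/-- One copy is used up whatever the result and the flag are. The heights thus never depend on
measurement outcomes, as the encoding of the data requires. -/
theorem yields_test (V : QPT Set.univ) {m : ℕ} {φ : QMat m} (hφ : IsDensity φ) (key : List Bool)
    (k : ℕ) (x : Bool × ℕ × ℕ) (g : Bool × ℕ × ℕ → ℝ) {L T H : ℕ} (hL : key.length ≤ L)
    (hT : V.cleanTime (key.length + m) ≤ T) (hH : V.heightBound (key.length + m) ≤ H) :
    Yields (testProg V.prog) (testTime L m T H)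
      (fun w : ℝ => ⟨stackList [y₀, y₁, y₂, y₃, y₄, y₅, unary m, [], key, [], flag x.1,
        unary x.2.1, unary x.2.2, []], heights ((k + 1) * m) 0, (w : ℂ) • copies 13 φ (k + 1)⟩)
      (fun x' (w : ℝ) => ⟨stackList [y₀, y₁, y₂, y₃, y₄, y₅, unary m, [], key, [], flag x'.1,
        unary x'.2.1, unary x'.2.2, []], heights (k * m) 0, (w : ℂ) • copies 13 φ k⟩)
      (fun x' => x' = record true x ∨ x' = record false x) g
      (V.prob key φ [true] * g (record true x) + (1 - V.prob key φ [true]) * g (record false x)) := by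
  have hcall := Yields.call V (y := key) (n := m) (Set.mem_univ _) hφ (s := 13)
    (l := [y₀, y₁, y₂, y₃, y₄, y₅, unary m, [], key, [], flag x.1, unary x.2.1, unary x.2.2])
    rfl (ht := heights (k * m) 0) (fun q hq => heights_zero hq)
    (copies_on (by norm_num) φ k) (fun y => g (record (y = [true]) x))
  have hval : V.expect key φ (fun y => g (record (y = [true]) x)) =
      V.prob key φ [true] * g (record true x) +
        (1 - V.prob key φ [true]) * g (record false x) := by
    rw [← V.expect_ite (Set.mem_univ _) hφ]
    congr 1; funext y
    by_cases h : y = [true] <;> simp [h]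
  rw [hval] at hcall
  refine Yields.mono (N := (5 * L + 1) + ((7 * L + 1) + ((m * 10 + 1) + ((5 * m + 1) +
    (T + (2 * H + 20) + 1) + 1) + 1) + 1) + 1) ?_ (by unfold testTime; omega)
  refine Yields.runs_seq (fun w => Runs.mono (runs_transfer (a := 8) (b := 9) _ _ _ (by simp)
    (by simp) (by norm_num)) (by simpa using hL)) ?_
  refine Yields.runs_seq (fun w => Runs.mono (runs_fork (a := 9) (b := 8) (c := 13) _ _ _ (by simp)
    (by simp) (by simp) (by norm_num) (by norm_num) (by norm_num)) (by simpa using hL)) ?_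
  simp only [List.getD_cons_succ, List.getD_cons_zero, List.set_cons_succ, List.set_cons_zero,
    List.append_nil, List.reverse_reverse]
  refine Yields.runs_seq (fun w => runs_takeBlock _ _ _ _ _ _ _ _ _ _ _ _ φ k w) ?_
  refine Yields.runs_seq (fun w => Runs.mono (runs_transfer (a := 7) (b := 6) _ _ _ (by simp)
    (by simp) (by norm_num)) (by simp [length_unary])) ?_
  simp only [List.getD_cons_succ, List.getD_cons_zero, List.set_cons_succ, List.set_cons_zero,
    List.append_nil, reverse_unary]
  have hstart : ∀ w : ℝ, Data.embed 13 ⟨stackList [y₀, y₁, y₂, y₃, y₄, y₅, unary m, [], key, [],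
      flag x.1, unary x.2.1, unary x.2.2], heights (k * m) 0, (w : ℂ) • copies 13 φ k⟩
      (startData key φ) = ⟨stackList [y₀, y₁, y₂, y₃, y₄, y₅, unary m, [], key, [],
      flag x.1, unary x.2.1, unary x.2.2, key], heights (k * m) m,
      tensor 13 ((w : ℂ) • copies 13 φ k) (QState.ofMat φ)⟩ := by
    intro w
    simp only [Data.embed, startData, glue_heights]
    rw [glue_stackList (s := 13) (l := [y₀, y₁, y₂, y₃, y₄, y₅, unary m, [], key, [],
      flag x.1, unary x.2.1, unary x.2.2]) rfl key]
    rfl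
  simp only [hstart] at hcall
  refine Yields.seq (hcall.mono hT) fun y hy => ?_
  refine Yields.of_runs (x := record (y = [true]) x) (fun w => ?_) ?_
  · exact (runs_judge _ _ _ _ _ _ _ _ _ _ y _ _ x).mono (by omega)
  · by_cases h : y = [true] <;> simp [h]

/-- The expectation of `h` for the number of successes before the first failure in at most `i`
attempts with success probability `a`. -/
def geo (a : ℝ) : ℕ → (ℕ → ℝ) → ℝ
  | 0, h => h 0
  | i + 1, h => a * geo a i (fun j => h (j + 1)) + (1 - a) * h 0

/-- The tests go on after a failure, but the flag stops the counting. So `u` copies are always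
consumed, and the count is the length of the initial run of successes. -/
theorem yields_tests (V : QPT Set.univ) {m : ℕ} {φ : QMat m} (hφ : IsDensity φ) (key : List Bool)
    (k u : ℕ) (b : ℕ) (G : ℕ → ℕ → ℝ) {L T H : ℕ} (hL : key.length ≤ L)
    (hT : V.cleanTime (key.length + m) ≤ T) (hH : V.heightBound (key.length + m) ≤ H) :
    Yields (forLoop 4 5 (testProg V.prog)) (u * (testTime L m T H + 10) + 3)
      (fun w : ℝ => ⟨stackList [y₀, y₁, y₂, y₃, unary u, [], unary m, [], key, [], [true],
        [], unary b, []], heights ((k + u) * m) 0, (w : ℂ) • copies 13 φ (k + u)⟩)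
      (fun (x : Bool × ℕ × ℕ) (w : ℝ) => ⟨stackList [y₀, y₁, y₂, y₃, unary u, [], unary m, [], key,
        [], flag x.1, unary x.2.1, unary x.2.2, []], heights (k * m) 0, (w : ℂ) • copies 13 φ k⟩)
      (fun x => x.2.1 ≤ u ∧ x.2.2 = b - x.2.1) (fun x => G x.2.1 x.2.2)
      (geo (V.prob key φ [true]) u fun j => G j (b - j)) := by
  have := Yields.forLoop (a := 4) (b := 5) (p := testProg V.prog) (N := testTime L m T H)
    (fun j (x : Bool × ℕ × ℕ) (w : ℝ) => ⟨[y₀, y₁, y₂, y₃, [], [], unary m, [], key, [], flag x.1,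
        unary x.2.1, unary x.2.2, []], heights ((k + (u - j)) * m) 0,
        (w : ℂ) • copies 13 φ (k + (u - j))⟩) u (fun j x => x.2.1 ≤ j ∧ x.2.2 = b - x.2.1)
    -- While the flag is up, `u - j` attempts are still to come; once it is down, the counters are
    -- final.
    (fun j x => if x.1 then geo (V.prob key φ [true]) (u - j) fun i => G (x.2.1 + i) (x.2.2 - i)
      else G x.2.1 x.2.2) (by norm_num) (by simp) (by
      rintro j hj ⟨f, c, b'⟩ ⟨hc, hb⟩
      obtain ⟨i, hi⟩ : ∃ i, u - j = i + 1 := ⟨u - j - 1, by omega⟩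
      have hi' : u - (j + 1) = i := by omega
      simp only [hi, hi', ← Nat.add_assoc, Nat.add_sub_cancel]
      have h := yields_test y₀ y₁ y₂ y₃ (unary i) (unary (j + 1)) V hφ key (k + i) (f, c, b')
        (fun x => if x.1 then geo (V.prob key φ [true]) i fun i => G (x.2.1 + i) (x.2.2 - i)
          else G x.2.1 x.2.2) hL hT hH
      have hval : (if f = true then geo (V.prob key φ [true]) (i + 1) fun i => G (c + i) (b' - i)
          else G c b') = V.prob key φ [true] * (if (record true (f, c, b')).1 then
            geo (V.prob key φ [true]) i fun i => G ((record true (f, c, b')).2.1 + i)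
              ((record true (f, c, b')).2.2 - i)
          else G (record true (f, c, b')).2.1 (record true (f, c, b')).2.2) +
          (1 - V.prob key φ [true]) * (if (record false (f, c, b')).1 then
            geo (V.prob key φ [true]) i fun i => G ((record false (f, c, b')).2.1 + i)
              ((record false (f, c, b')).2.2 - i)
          else G (record false (f, c, b')).2.1 (record false (f, c, b')).2.2) := by
        cases f
        · simp [record]; ring
        · simp [record, geo, Nat.add_right_comm, Nat.add_assoc, Nat.sub_sub, Nat.add_comm 1]
      rw [hval]
      obtain ⟨D, d1, d2, d3⟩ := h
      refine ⟨D, d1, fun x hx => ⟨(d2 x hx).1, ?_⟩, d3⟩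
      dsimp only at hc hb
      rcases (d2 x hx).2 with h | h <;> rw [h] <;> cases f <;> simp [record] <;> omega)
    (true, 0, b) ⟨le_rfl, rfl⟩
  simp only [Nat.sub_self, Nat.sub_zero, Nat.add_zero, if_true, Nat.zero_add, geo, ite_self]
    at this
  exact this

/-! ### The adversary: the search for a key -/

theorem ofMat_noQubits : QState.ofMat noQubits = Finsupp.single (zeroBasis, zeroBasis) 1 := by
  have (u : Fin 0 → Bool) : basisOf u = zeroBasis := by
    funext i; simp [basisOf, zeroBasis]
  simp only [QState.ofMat, noQubits, Finset.univ_unique, Finset.sum_singleton, this,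
    Matrix.one_apply_eq]

/-- Replace the best key, in stack `0`, by the key in stack `8`, unless stack `12` is nonempty. -/
def replaceBest : Prog :=
  .branch 12 (.seq (clear 0) (.seq (transfer 8 9) (transfer 9 0))) (clear 8) (clear 8)

/-- Generate a key, count the successful tests before the first failure, and compare with the
number of successes of the best key so far, which is in stack `12`. -/
def trialProg (kg ver : Prog) : Prog :=
  .seq (transfer 1 9) (.seq (fork 9 1 13) (.seq ((cleaned kg).shift 13) (.seq (transfer 13 9)
    (.seq (transfer 9 8) (.seq (.push 10 true) (.seq (forLoop 4 5 (testProg ver))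
      (.seq (clear 10) (.seq replaceBest (transfer 11 12)))))))))

/-- The expectation of `F` for the best key and its number of successes after a trial. -/
noncomputable def trialValue (K : QPT {x | ∃ n, x = (unary n, 0)}) (acc : List Bool → ℝ) (n u : ℕ)
    (F : List Bool → ℕ → ℝ) (best : List Bool) (b : ℕ) : ℝ :=
  K.expect (unary n) noQubits fun key =>
    geo (acc key) u fun j => if b ≤ j then F key j else F best b

/-- A bound on the time for a trial. -/
def trialTime (n u m L T₀ T H : ℕ) : ℕ :=
  12 * n + T₀ + 30 * L + 10 * u + u * (testTime L m T H + 10) + 100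

theorem runs_replaceBest (y₀ y₁ y₂ y₃ y₄ y₅ y₆ y₇ key y₁₀ y₁₁ y₁₃ : List Bool) (b : ℕ)
    (ht : ℕ → ℕ) (qu : QState) {L : ℕ} (hL : key.length ≤ L) (hL' : y₀.length ≤ L) :
    Runs [replaceBest] ⟨stackList [y₀, y₁, y₂, y₃, y₄, y₅, y₆, y₇, key, [], y₁₀, y₁₁, unary b,
        y₁₃], ht, qu⟩ (12 * L + 10)
      [⟨stackList [if b = 0 then key else y₀, y₁, y₂, y₃, y₄, y₅, y₆, y₇, [], [], y₁₀, y₁₁, unary b,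
        y₁₃], ht, qu⟩] := by
  rcases b with _ | b
  · refine (Runs.branch_nil rfl (N := (2 * L + 1) + ((5 * L + 1) + (5 * L + 1) + 1) + 1) ?_).mono
      (by omega)
    refine Runs.seq_one ((runs_clear_stackList _ _ _ 0 (by simp)).mono (by simpa using hL')) ?_
    refine Runs.seq_one ((runs_transfer (a := 8) (b := 9) _ _ _ (by simp)
      (by simp) (by norm_num)).mono (by simpa using hL)) ?_
    have := (runs_transfer (a := 9) (b := 0) [[], y₁, y₂, y₃, y₄, y₅, y₆, y₇, [], key.reverse, y₁₀,
      y₁₁, unary 0, y₁₃] ht qu (by simp) (by simp) (by norm_num)).mono (M := 5 * L + 1)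
      (by simpa using hL)
    simpa using this
  · refine (Runs.branch_true (unary b) rfl (N := 2 * L + 1) ?_).mono (by omega)
    exact (runs_clear_stackList [y₀, y₁, y₂, y₃, y₄, y₅, y₆, y₇, key, [], y₁₀, y₁₁, unary (b + 1),
      y₁₃] _ _ 8 (by simp)).mono (by simpa using hL)

/-- With `c` successes against a record of `b`, stack `12` ends with the truncated difference `b -
c`. It is empty exactly when the new key is at least as good, and adding stack `11` to it gives the
new record `max b c`. -/
theorem yields_trial (K : QPT {x | ∃ n, x = (unary n, 0)}) (V : QPT Set.univ) {m : ℕ} {φ : QMat m}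
    (hφ : IsDensity φ) (y₂ y₃ best : List Bool) (n k u b : ℕ) (F : List Bool → ℕ → ℝ)
    {T₀ T H : ℕ} (hT₀ : K.cleanTime n ≤ T₀) (hbest : best.length ≤ K.heightBound n) (hb : b ≤ u)
    (hT : ∀ l ≤ K.heightBound n, V.cleanTime (l + m) ≤ T)
    (hH : ∀ l ≤ K.heightBound n, V.heightBound (l + m) ≤ H) :
    Yields (trialProg K.prog V.prog) (trialTime n u m (K.heightBound n) T₀ T H)
      (fun w : ℝ => ⟨stackList [best, unary n, y₂, y₃, unary u, [], unary m, [], [], [], [],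
        [], unary b, []], heights ((k + u) * m) 0, (w : ℂ) • copies 13 φ (k + u)⟩)
      (fun (x : List Bool × ℕ) (w : ℝ) => ⟨stackList [x.1, unary n, y₂, y₃, unary u, [], unary m,
        [], [], [], [], [], unary x.2, []], heights (k * m) 0, (w : ℂ) • copies 13 φ k⟩)
      (fun x => x.1.length ≤ K.heightBound n ∧ x.2 ≤ u) (fun x => F x.1 x.2)
      (trialValue K (fun key => V.prob key φ [true]) n u F best b) := by
  have hcall := Yields.call K (y := unary n) (n := 0) ⟨n, rfl⟩ isDensity_noQubits (s := 13)
    (l := [best, unary n, y₂, y₃, unary u, [], unary m, [], [], [], [], [], unary b])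
    rfl (ht := heights ((k + u) * m) 0) (fun q hq => heights_zero hq)
    (copies_on (by norm_num) φ (k + u)) (fun key => geo (V.prob key φ [true]) u fun j =>
      if b ≤ j then F key j else F best b)
  have hstart : ∀ w : ℝ, Data.embed 13 ⟨stackList [best, unary n, y₂, y₃, unary u, [], unary m, [],
      [], [], [], [], unary b], heights ((k + u) * m) 0, (w : ℂ) • copies 13 φ (k + u)⟩
      (startData (unary n) noQubits) = ⟨stackList [best, unary n, y₂, y₃, unary u, [], unary m, [],
      [], [], [], [], unary b, unary n], heights ((k + u) * m) 0,
      (w : ℂ) • copies 13 φ (k + u)⟩ := by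
    intro w
    simp only [Data.embed, startData, glue_heights]
    rw [glue_stackList (s := 13) (l := [best, unary n, y₂, y₃, unary u, [], unary m, [], [], [],
      [], [], unary b]) rfl (unary n), tensor_smul_left, ofMat_noQubits]
    have := tensor_zeroBasis (copies_on (s := 13) (by norm_num) φ (k + u)) 1
    rw [one_smul, one_smul] at this
    rw [this]; rfl
  simp only [hstart, length_unary, Nat.add_zero] at hcall
  obtain ⟨L, hL⟩ : ∃ L, L = K.heightBound n := ⟨_, rfl⟩
  rw [← hL] at hcall hT hH hbest ⊢
  refine Yields.mono (N := (5 * n + 1) + ((7 * n + 1) + (T₀ + ((5 * L + 1) + ((5 * L + 1) + (1 +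
    ((u * (testTime L m T H + 10) + 3) + (3 + ((12 * L + 10) + (5 * u + 1) + 1) + 1) + 1) + 1) + 1)
    + 1) + 1) + 1) + 1) ?_ (by unfold trialTime; omega)
  refine Yields.runs_seq (fun w => Runs.mono (runs_transfer (a := 1) (b := 9) _ _ _ (by simp)
    (by simp) (by norm_num)) (by simp [length_unary])) ?_
  refine Yields.runs_seq (fun w => Runs.mono (runs_fork (a := 9) (b := 1) (c := 13) _ _ _ (by simp)
    (by simp) (by simp) (by norm_num) (by norm_num) (by norm_num)) (by simp [length_unary])) ?_
  simp only [List.getD_cons_succ, List.getD_cons_zero, List.set_cons_succ, List.set_cons_zero,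
    List.append_nil, reverse_unary]
  refine Yields.seq (hcall.mono hT₀) fun key hkey => ?_
  refine Yields.runs_seq (fun w => Runs.mono (runs_transfer (a := 13) (b := 9) _ _ _ (by simp)
    (by simp) (by norm_num)) (by simpa using hkey)) ?_
  refine Yields.runs_seq (fun w => Runs.mono (runs_transfer (a := 9) (b := 8) _ _ _ (by simp)
    (by simp) (by norm_num)) (by simpa using hkey)) ?_
  refine Yields.runs_seq (fun w => runs_push _ _ _ 10 true (by simp)) ?_
  simp only [List.cons_append, List.nil_append,
    List.getD_cons_succ, List.getD_cons_zero, List.set_cons_succ, List.set_cons_zero,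
    List.append_nil, List.reverse_reverse]
  have htests := yields_tests best (unary n) y₂ y₃ V hφ key k u b
    (fun c b' => if b' = 0 then F key c else F best (c + b')) hkey (hT _ hkey) (hH _ hkey)
  have hval : (fun j => if b - j = 0 then F key j else F best (j + (b - j))) =
      fun j => if b ≤ j then F key j else F best b := by
    funext j
    by_cases h : b ≤ j
    · simp [h, Nat.sub_eq_zero_of_le h]
    · have h1 : b - j ≠ 0 := by omega
      have h2 : j + (b - j) = b := by omega
      simp [h, h1, h2]
  rw [hval] at htests
  refine Yields.seq htests fun x hx => ?_
  obtain ⟨f, c, b'⟩ := x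
  dsimp only at hx ⊢
  refine Yields.runs_seq (fun w => Runs.mono (runs_clear_stackList _ _ _ 10 (by simp))
    (by cases f <;> simp [flag])) ?_
  refine Yields.runs_seq (fun w => runs_replaceBest _ _ _ _ _ _ _ _ _ _ _ _ _ _ _ hkey hbest) ?_
  have hx' : (if b' = 0 then F key c else F best (c + b')) =
      F (if b' = 0 then key else best) (c + b') := by
    split_ifs with h <;> simp [h]
  rw [hx']
  refine Yields.of_runs (x := (if b' = 0 then key else best, c + b')) (fun w => ?_) ?_
  · have := (runs_transfer (a := 11) (b := 12) [if b' = 0 then key else best, unary n, y₂, y₃,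
      unary u, [], unary m, [], [], [], [], unary c, unary b', []] (heights (k * m) 0)
      ((w : ℂ) • copies 13 φ k) (by simp) (by simp) (by norm_num)).mono (M := 5 * u + 1)
      (by simpa [length_unary] using hx.1)
    simpa [reverse_unary, unary_append] using this
  · refine ⟨?_, ?_⟩
    · dsimp only; split_ifs <;> assumption
    · dsimp only; omega

/-- The expectation of `F` for the best key and its number of successes after `i` trials. -/
noncomputable def trialsValue (K : QPT {x | ∃ n, x = (unary n, 0)}) (acc : List Bool → ℝ)
    (n u : ℕ) (F : List Bool → ℕ → ℝ) : ℕ → List Bool → ℕ → ℝ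
  | 0 => F
  | i + 1 => trialValue K acc n u (trialsValue K acc n u F i)

/-- Each of the `u` trials consumes `u` copies, hence the `u * u` copies at the start. -/
theorem yields_trials (K : QPT {x | ∃ n, x = (unary n, 0)}) (V : QPT Set.univ) {m : ℕ} {φ : QMat m}
    (hφ : IsDensity φ) (n u : ℕ) (f : List Bool → ℝ)
    {T₀ T H : ℕ} (hT₀ : K.cleanTime n ≤ T₀)
    (hT : ∀ l ≤ K.heightBound n, V.cleanTime (l + m) ≤ T)
    (hH : ∀ l ≤ K.heightBound n, V.heightBound (l + m) ≤ H) :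
    Yields (forLoop 2 3 (trialProg K.prog V.prog))
      (u * (trialTime n u m (K.heightBound n) T₀ T H + 10) + 3)
      (fun w : ℝ => ⟨stackList [[], unary n, unary u, [], unary u, [], unary m, [], [], [], [],
        [], [], []], heights (u * u * m) 0, (w : ℂ) • copies 13 φ (u * u)⟩)
      (fun (x : List Bool × ℕ) (w : ℝ) => ⟨stackList [x.1, unary n, unary u, [], unary u, [],
        unary m, [], [], [], [], [], unary x.2, []], heights 0 0, (w : ℂ) • copies 13 φ 0⟩)
      (fun _ => True) (fun x => f x.1)
      (trialsValue K (fun key => V.prob key φ [true]) n u (fun key _ => f key) u [] 0) := by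
  have := Yields.forLoop (a := 2) (b := 3) (p := trialProg K.prog V.prog)
    (N := trialTime n u m (K.heightBound n) T₀ T H)
    (fun j (x : List Bool × ℕ) (w : ℝ) => ⟨[x.1, unary n, [], [], unary u, [],
        unary m, [], [], [], [], [], unary x.2, []], heights ((u - j) * u * m) 0,
        (w : ℂ) • copies 13 φ ((u - j) * u)⟩) u
    (fun j x => x.1.length ≤ K.heightBound n ∧ x.2 ≤ u)
    (fun j x => trialsValue K (fun key => V.prob key φ [true]) n u (fun key _ => f key) (u - j)
      x.1 x.2) (by norm_num) (by simp) (by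
      rintro j hj ⟨best, b⟩ ⟨h1, h2⟩
      obtain ⟨i, hi⟩ : ∃ i, u - j = i + 1 := ⟨u - j - 1, by omega⟩
      have hi' : u - (j + 1) = i := by omega
      simp only [hi, hi', Nat.succ_mul i u]
      exact yields_trial K V hφ _ _ best n (i * u) u b _ hT₀ h1 h2 hT hH) ([], 0) (by simp)
  simp only [Nat.sub_self, Nat.sub_zero, Nat.zero_mul, trialsValue] at this
  obtain ⟨D, h1, h2, h3⟩ := this
  exact ⟨D, h1, fun x hx => ⟨(h2 x hx).1, trivial⟩, h3⟩

/-! ### The adversary: preparation -/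

theorem Runs.forLoop {p : Prog} {N a b : ℕ} (E : ℕ → ListData) (r : ℕ) (hab : a ≠ b)
    (hE : ∀ j, a < (E j).l.length ∧ b < (E j).l.length)
    (hp : ∀ j < r, Runs [p] ((E j).ctr a b (r - j - 1) (j + 1)) N
      [(E (j + 1)).ctr a b (r - j - 1) (j + 1)]) :
    Runs [forLoop a b p] ((E 0).ctr a b r 0) (r * (N + 10) + 3) [(E r).ctr a b r 0] := by
  have hloop := Runs.loop (a := a) (p := .seq (.pop a) (.seq (.push b true) p))
    (fun j _ => (E j).ctr a b (r - j) j) r (N := 1 + (1 + N + 1) + 1)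
    (by
      intro j hj w
      obtain ⟨i, hi⟩ : ∃ i, r - j = i + 1 := ⟨r - j - 1, by omega⟩
      simp only [ListData.ctr, stackList, getD_set_set (hE j).1 hab, hi, unary_succ]
      exact List.cons_ne_nil _ _)
    (by
      intro w
      simp only [ListData.ctr, stackList, getD_set_set (hE r).1 hab, Nat.sub_self]
      rfl)
    (by
      intro j hj w
      obtain ⟨i, hi⟩ : ∃ i, r - j = i + 1 := ⟨r - j - 1, by omega⟩
      have hp := hp j hj
      have hi' : r - (j + 1) = i := by omega
      have hi'' : r - j - 1 = i := by omega
      simp only [hi, hi'] at hp ⊢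
      have h1 := (hE j).1
      have h2 := (hE j).2
      have s1 := runs_pop (((E j).l.set a (unary (i + 1))).set b (unary j)) (E j).ht
        (E j).qu a (by simpa using h1)
      have s2 := runs_push (((E j).l.set a (unary i)).set b (unary j)) (E j).ht
        (E j).qu b true (by simpa using h2)
      rw [getD_set_set h1 hab, set_set_set _ hab] at s1
      rw [getD_set_set' h2, List.set_set] at s2
      exact Runs.seq_one s1 (Runs.seq_one s2 hp)) 0
  have e : r * (N + 10) + 3 = (r * (1 + (1 + N + 1) + 1 + 1) + 1) + (5 * r + 1) + 1 := by ring
  rw [e]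
  refine Runs.seq_one hloop ?_
  have h1 := (hE r).1
  have h2 := (hE r).2
  have := runs_transfer (a := b) (b := a) (((E r).l.set a (unary (r - r))).set b (unary r))
    (E r).ht (E r).qu (by simpa using h2) (by simpa using h1) hab.symm
  rw [getD_set_set' h2, getD_set_set h1 hab, List.set_set, set_set_set _ hab, reverse_unary,
    unary_append, length_unary, Nat.sub_self, Nat.add_zero] at this
  simp only [Nat.sub_self]
  exact this

/-- Multiply the number in stack `2` by `n + 1`, for the number `n` in stack `1`. -/
def scaleProg : Prog :=
  .seq (.loop 2 (.seq (.pop 2) (.seq (.push 9 true) (forLoop 1 3 (.push 9 true))))) (transfer 9 2)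

/-- The number `(n + 1) ^ c` in stack `2`, for the number `n` in stack `1`. -/
def powProg : ℕ → Prog
  | 0 => .push 2 true
  | c + 1 => .seq (powProg c) scaleProg

/-- The time for `powProg`. -/
def powTime (n : ℕ) : ℕ → ℕ
  | 0 => 1
  | c + 1 => powTime n c + ((n + 1) ^ c * (16 * n + 13) + 3) + 1

theorem runs_scaleProg (n x : ℕ) (ht : ℕ → ℕ) (qu : QState) :
    Runs [scaleProg] ⟨stackList [[], unary n, unary x, [], [], [], [], [], [], [], [], [], [], []],
      ht, qu⟩ (x * (16 * n + 13) + 3)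
      [⟨stackList [[], unary n, unary (x * (n + 1)), [], [], [], [], [], [], [], [], [], [], []],
        ht, qu⟩] := by
  have h1 : ∀ j y, Runs [forLoop 1 3 (.push 9 true)]
      ⟨stackList [[], unary n, unary j, [], [], [], [], [], [], unary y, [], [], [], []], ht, qu⟩
      (n * (1 + 10) + 3)
      [⟨stackList [[], unary n, unary j, [], [], [], [], [], [], unary (y + n), [], [], [], []],
        ht, qu⟩] := fun j y =>
    Runs.forLoop (a := 1) (b := 3) (fun i =>
      ⟨[[], unary n, unary j, [], [], [], [], [], [], unary (y + i), [], [], [], []], ht, qu⟩) n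
      (by norm_num) (by simp) fun i _ => runs_push _ _ _ 9 true (by simp)
  have h2 := Runs.loop (a := 2) (p := .seq (.pop 2) (.seq (.push 9 true)
    (forLoop 1 3 (.push 9 true)))) (N := 1 + (1 + (n * (1 + 10) + 3) + 1) + 1) (fun j _ =>
      ⟨stackList [[], unary n, unary (x - j), [], [], [], [], [], [], unary (j * (n + 1)), [], [],
        [], []], ht, qu⟩) x
    (by
      intro j hj w
      obtain ⟨i, hi⟩ : ∃ i, x - j = i + 1 := ⟨x - j - 1, by omega⟩
      simp [stackList, hi, unary_succ])
    (by intro w; simp [stackList, unary])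
    (by
      intro j hj w
      obtain ⟨i, hi⟩ : ∃ i, x - j = i + 1 := ⟨x - j - 1, by omega⟩
      have hi' : x - (j + 1) = i := by omega
      simp only [hi, hi']
      have e : (j + 1) * (n + 1) = j * (n + 1) + 1 + n := by ring
      rw [e]
      exact Runs.seq_one (runs_pop _ _ _ 2 (by simp))
        (Runs.seq_one (runs_push _ _ _ 9 true (by simp)) (h1 i (j * (n + 1) + 1)))) 0
  simp only [Nat.sub_zero, Nat.zero_mul, Nat.sub_self] at h2
  have h3 := runs_transfer (a := 9) (b := 2) [[], unary n, [], [], [], [], [], [], [],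
    unary (x * (n + 1)), [], [], [], []] ht qu (by simp) (by simp) (by norm_num)
  simp only [List.getD_cons_succ, List.getD_cons_zero, List.set_cons_succ, List.set_cons_zero,
    List.append_nil, reverse_unary, length_unary] at h3
  exact Runs.seq_le h2 h3 (by ring_nf; omega)

theorem runs_powProg (n c : ℕ) (ht : ℕ → ℕ) (qu : QState) :
    Runs [powProg c] ⟨stackList [[], unary n, [], [], [], [], [], [], [], [], [], [], [], []],
      ht, qu⟩ (powTime n c)
      [⟨stackList [[], unary n, unary ((n + 1) ^ c), [], [], [], [], [], [], [], [], [], [], []],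
        ht, qu⟩] := by
  induction c with
  | zero => exact runs_push _ _ _ 2 true (by simp)
  | succ c ih =>
    rw [pow_succ]
    exact Runs.seq_one ih (runs_scaleProg n _ ht qu)

/-- Move a qubit from stack `0` to stack `1`; if there is none, put a new qubit on stack `1`. -/
def moveOrNew : Prog := .qbranch 0 (.qnew 1) (.qmove 0 1)

/-- Move all qubits from stack `0` to stack `1`, in groups of `u ^ 2` qubits, where `u` is the
number in the stacks `2` and `4`; the last group is filled up with new qubits, and the number of
groups is written to stack `6`. -/
def gatherProg : Prog :=
  .seq (.push 9 true) (.loop 9 (.qbranch 0 (.pop 9)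
    (.seq (.push 6 true) (forLoop 2 3 (forLoop 4 5 moveOrNew)))))

/-- Stack heights when `i` qubits have been put on stack `1`, and `r` are to be moved. -/
def moveHeights (r i : ℕ) : ℕ → ℕ := fun q => if q = 0 then r - i else if q = 1 then i else 0

/-- The states `Q i` when `i` qubits have been put on stack `1`, and `r` are to be moved. -/
def IsMove (r : ℕ) (Q : ℕ → QState) : Prop :=
  (∀ i < r, conjugate (swapOp (0, r - i - 1) (1, i)) (Q i) = Q (i + 1)) ∧
    ∀ i, r ≤ i → Q (i + 1) = Q i

/-- A new qubit only changes a height, its cell being `|0⟩` already; this is the second clause of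
`IsMove`. -/
theorem runs_moveOrNew {r : ℕ} {Q : ℕ → QState} (hQ : IsMove r Q) (i : ℕ) (cl : ℕ → List Bool) :
    Runs [moveOrNew] ⟨cl, moveHeights r i, Q i⟩ 2 [⟨cl, moveHeights r (i + 1), Q (i + 1)⟩] := by
  have h0 : moveHeights r i 0 = r - i := rfl
  have h1 : moveHeights r i 1 = i := rfl
  by_cases hi : i < r
  · refine Runs.of_step (s' := ⟨cl, moveHeights r i, Q i⟩) (P' := [.qmove 0 1]) ?_ ?_
    · have : r - i ≠ 0 := by omega
      simp [step, Data.cfg, moveOrNew, h0, this]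
    · refine Runs.of_step (P' := []) ?_ (Runs.nil _ _)
      have h : r - i ≠ 0 := by omega
      have e : Function.update (Function.update (moveHeights r i) 0 (r - i - 1)) 1 (i + 1) =
          moveHeights r (i + 1) := by
        funext q
        by_cases q1 : q = 1
        · subst q1; simp [moveHeights]
        by_cases q0 : q = 0
        · subst q0; simp [moveHeights]; omega
        simp [moveHeights, q0, q1]
      simp only [step, Data.cfg, h0, h1, hQ.1 i hi, e]
      simp [h]
  · refine Runs.of_step (s' := ⟨cl, moveHeights r i, Q i⟩) (P' := [.qnew 1]) ?_ ?_
    · have : r - i = 0 := by omega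
      simp [step, Data.cfg, moveOrNew, h0, this]
    · refine Runs.of_step (P' := []) ?_ (Runs.nil _ _)
      have e : Function.update (moveHeights r i) 1 (i + 1) = moveHeights r (i + 1) := by
        funext q
        by_cases q1 : q = 1
        · subst q1; simp [moveHeights]
        by_cases q0 : q = 0
        · subst q0; simp [moveHeights]; omega
        simp [moveHeights, q0, q1]
      simp only [step, Data.cfg, h1, hQ.2 i (not_lt.1 hi), e]

/-- The time for `gatherProg` with `M` groups. -/
def gatherTime (u M : ℕ) : ℕ := (M + 1) * (u * (u * 12 + 13) + 8) + 3

/-- The hypotheses `h1` and `h2` express that `M` is `r / u ^ 2` rounded up. On `u ^ 2` copies of an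
`m`-qubit state this recovers `m`; the padding makes the later stages run, and hence halt, for every
number `r` of input qubits. -/
theorem runs_gatherProg {r : ℕ} {Q : ℕ → QState} (hQ : IsMove r Q) {u M : ℕ}
    (h1 : ∀ j < M, j * (u * u) < r) (h2 : r ≤ M * (u * u)) (y : List Bool) :
    Runs [gatherProg] ⟨stackList [[], y, unary u, [], unary u, [], [], [], [], [], [], [], [], []],
      moveHeights r 0, Q 0⟩ (gatherTime u M)
      [⟨stackList [[], y, unary u, [], unary u, [], unary M, [], [], [], [], [], [], []],
        heights (u * u * M) 0, Q (u * u * M)⟩] := by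
  have hin : ∀ (l₂ l₃ : List Bool) (z i : ℕ), Runs [forLoop 4 5 moveOrNew]
      ⟨stackList [[], y, l₂, l₃, unary u, [], unary z, [], [], [true], [], [], [], []],
        moveHeights r i, Q i⟩ (u * (2 + 10) + 3)
      [⟨stackList [[], y, l₂, l₃, unary u, [], unary z, [], [], [true], [], [], [], []],
        moveHeights r (i + u), Q (i + u)⟩] := fun l₂ l₃ z i =>
    Runs.forLoop (a := 4) (b := 5) (fun j =>
      ⟨[[], y, l₂, l₃, unary u, [], unary z, [], [], [true], [], [], [], []],
        moveHeights r (i + j), Q (i + j)⟩) u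
      (by norm_num) (by simp) fun j _ => runs_moveOrNew hQ (i + j) _
  have hout : ∀ (z i : ℕ), Runs [forLoop 2 3 (forLoop 4 5 moveOrNew)]
      ⟨stackList [[], y, unary u, [], unary u, [], unary z, [], [], [true], [], [], [], []],
        moveHeights r i, Q i⟩ (u * (u * (2 + 10) + 3 + 10) + 3)
      [⟨stackList [[], y, unary u, [], unary u, [], unary z, [], [], [true], [], [], [], []],
        moveHeights r (i + u * u), Q (i + u * u)⟩] := fun z i => by
    have := Runs.forLoop (a := 2) (b := 3) (fun j =>
      ⟨[[], y, unary u, [], unary u, [], unary z, [], [], [true], [], [], [], []],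
        moveHeights r (i + j * u), Q (i + j * u)⟩) u
      (by norm_num) (by simp) fun j _ => by
        have := hin (unary (u - j - 1)) (unary (j + 1)) z (i + j * u)
        rw [Nat.add_assoc, ← Nat.succ_mul] at this
        exact this
    rw [Nat.zero_mul] at this
    exact this
  refine Runs.seq_le (runs_push _ _ _ 9 true (by simp)) (M := (M + 1) *
    (1 + (u * (u * (2 + 10) + 3 + 10) + 3) + 1 + 1 + 1) + 1) ?_ (by unfold gatherTime; ring_nf; omega)
  -- There is one round more than there are groups: it finds stack `0` empty and removes the flag,
  -- whence `min j M`.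
  have := Runs.loop (a := 9) (p := .qbranch 0 (.pop 9)
    (.seq (.push 6 true) (forLoop 2 3 (forLoop 4 5 moveOrNew))))
    (N := 1 + (u * (u * (2 + 10) + 3 + 10) + 3) + 1 + 1) (fun j _ =>
      ⟨stackList [[], y, unary u, [], unary u, [], unary (min j M), [], [],
        if j ≤ M then [true] else [], [], [], [], []],
        moveHeights r (min j M * (u * u)), Q (min j M * (u * u))⟩) (M + 1)
    (by
      intro j hj w
      have : j ≤ M := by omega
      simp [stackList, this])
    (by intro w; simp [stackList])
    (by
      intro j hj w
      have hj' : j ≤ M := by omega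
      rcases Nat.lt_or_ge j M with h | h
      · have e1 : min (j + 1) M = j + 1 := by omega
        have e2 : min j M = j := by omega
        have e3 : j + 1 ≤ M := h
        have hr := h1 j h
        simp only [e1, e2, hj', e3, if_true]
        refine Runs.of_step (s' := ⟨stackList [[], y, unary u, [], unary u, [], unary j, [], [],
          [true], [], [], [], []], moveHeights r (j * (u * u)), Q (j * (u * u))⟩)
          (P' := [.seq (.push 6 true) (forLoop 2 3 (forLoop 4 5 moveOrNew))]) ?_ ?_
        · have : moveHeights r (j * (u * u)) 0 ≠ 0 := by
            change r - j * (u * u) ≠ 0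
            omega
          simp [step, Data.cfg, this]
        · refine Runs.seq_one (runs_push _ _ _ 6 true (by simp)) ?_
          rw [Nat.succ_mul]
          exact hout (j + 1) (j * (u * u))
      · obtain rfl : j = M := by omega
        have e1 : min (j + 1) j = j := by omega
        have e3 : ¬ (j + 1 ≤ j) := by omega
        simp only [e1, min_self, le_refl, e3, if_true, if_false]
        refine Runs.of_step (s' := ⟨stackList [[], y, unary u, [], unary u, [], unary j, [], [],
          [true], [], [], [], []], moveHeights r (j * (u * u)), Q (j * (u * u))⟩)
          (P' := [.pop 9]) ?_ ?_
        · have : moveHeights r (j * (u * u)) 0 = 0 := by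
            change r - j * (u * u) = 0
            omega
          simp [step, Data.cfg, this]
        · exact (runs_pop _ _ _ 9 (by simp)).mono (by omega)) 0
  have e1 : min (M + 1) M = M := by omega
  have e2 : ¬ (M + 1 ≤ M) := by omega
  have e3 : moveHeights r (u * u * M) = heights (u * u * M) 0 := by
    funext q
    have : r - u * u * M = 0 := by rw [Nat.mul_comm]; omega
    simp only [moveHeights, heights, this]
    split_ifs <;> first | rfl | omega
  simp only [Nat.zero_min, Nat.zero_mul, Nat.zero_le, if_true, e1, e2, if_false,
    Nat.mul_comm M (u * u), e3] at this
  exact this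

/-- The initial part of the adversary: compute `u = (n + 1) ^ c` and count the qubits. -/
def prepProg (c : ℕ) : Prog :=
  .seq (transfer 0 1) (.seq (powProg c) (.seq (transfer 2 9) (.seq (fork 9 2 4) gatherProg)))

/-- The time for `prepProg c` with `M` groups. -/
def prepTime (n c M : ℕ) : ℕ :=
  5 * n + powTime n c + 12 * (n + 1) ^ c + gatherTime ((n + 1) ^ c) M + 10

theorem runs_prepProg {r : ℕ} {Q : ℕ → QState} (hQ : IsMove r Q) {n c u M : ℕ}
    (hu : u = (n + 1) ^ c) (h1 : ∀ j < M, j * (u * u) < r) (h2 : r ≤ M * (u * u)) :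
    Runs [prepProg c] ⟨fun v => if v = 0 then unary n else [], fun q => if q = 0 then r else 0,
      Q 0⟩ (prepTime n c M)
      [⟨stackList [[], unary n, unary u, [], unary u, [], unary M, [], [], [], [], [], [], []],
        heights (u * u * M) 0, Q (u * u * M)⟩] := by
  have e1 : (fun v => if v = 0 then unary n else []) =
      stackList [unary n, [], [], [], [], [], [], [], [], [], [], [], [], []] := by
    funext v
    have := glue_stackList (s := 0) (l := []) rfl (unary n)
    have h : (fun v => if v = 0 then unary n else []) = stackList [unary n] := by
      rw [List.nil_append] at this
      rw [← this]; funext v; simp [glue]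
    refine (congrFun h v).trans ?_
    rcases v with _ | v
    · rfl
    · simp only [stackList, List.getD_cons_succ]
      rcases Nat.lt_or_ge v 13 with hv | hv
      · interval_cases v <;> rfl
      · simp [List.getD_eq_getElem?_getD, hv]
  have e2 : (fun q => if q = 0 then r else 0) = moveHeights r 0 := by
    funext q; simp [moveHeights]
  rw [e1, e2]
  have hg := runs_gatherProg hQ h1 h2 (unary n)
  subst hu
  refine Runs.seq_le ((runs_transfer (a := 0) (b := 1) _ _ _ (by simp)
    (by simp) (by norm_num)).mono (M := 5 * n + 1) (by simp [length_unary]))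
    (M := powTime n c + ((5 * (n + 1) ^ c + 1) + ((7 * (n + 1) ^ c + 1) +
      gatherTime ((n + 1) ^ c) M + 1) + 1) + 1) ?_ (by unfold prepTime; omega)
  simp only [List.getD_cons_succ, List.getD_cons_zero, List.set_cons_succ, List.set_cons_zero,
    List.append_nil, reverse_unary]
  refine Runs.seq_one (runs_powProg n c _ _) ?_
  refine Runs.seq_one ((runs_transfer (a := 2) (b := 9) _ _ _ (by simp)
    (by simp) (by norm_num)).mono (by simp [length_unary])) ?_
  refine Runs.seq_one ((runs_fork (a := 9) (b := 2) (c := 4) _ _ _ (by simp)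
    (by simp) (by simp) (by norm_num) (by norm_num) (by norm_num)).mono
      (by simp [length_unary])) ?_
  simp only [List.getD_cons_succ, List.getD_cons_zero, List.set_cons_succ, List.set_cons_zero,
    List.append_nil, reverse_unary]
  exact hg

/-! ### The adversary: running time -/

/-- Functions that are given by a polynomial with natural coefficients. -/
def IsPoly (f : ℕ → ℕ) : Prop := ∃ p : Polynomial ℕ, ∀ x, p.eval x = f x

namespace IsPoly

variable {f g : ℕ → ℕ}

theorem const (a : ℕ) : IsPoly fun _ => a := ⟨Polynomial.C a, by simp⟩

theorem id : IsPoly fun x => x := ⟨Polynomial.X, by simp⟩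

theorem add (hf : IsPoly f) (hg : IsPoly g) : IsPoly fun x => f x + g x := by
  obtain ⟨p, hp⟩ := hf
  obtain ⟨q, hq⟩ := hg
  exact ⟨p + q, fun x => by simp [hp, hq]⟩

theorem mul (hf : IsPoly f) (hg : IsPoly g) : IsPoly fun x => f x * g x := by
  obtain ⟨p, hp⟩ := hf
  obtain ⟨q, hq⟩ := hg
  exact ⟨p * q, fun x => by simp [hp, hq]⟩

theorem pow (hf : IsPoly f) (c : ℕ) : IsPoly fun x => f x ^ c := by
  obtain ⟨p, hp⟩ := hf
  exact ⟨p ^ c, fun x => by simp [hp]⟩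

theorem comp (hf : IsPoly f) (hg : IsPoly g) : IsPoly fun x => f (g x) := by
  obtain ⟨p, hp⟩ := hf
  obtain ⟨q, hq⟩ := hg
  exact ⟨p.comp q, fun x => by simp [hp, hq, Polynomial.eval_comp]⟩

theorem eval (p : Polynomial ℕ) : IsPoly fun x => p.eval x := ⟨p, fun _ => rfl⟩

theorem monotone (hf : IsPoly f) : Monotone f := by
  obtain ⟨p, hp⟩ := hf
  intro x y hxy
  rw [← hp, ← hp, Polynomial.eval_eq_sum, Polynomial.eval_eq_sum]
  exact Finset.sum_le_sum fun i _ => Nat.mul_le_mul_left _ (Nat.pow_le_pow_left hxy i)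

end IsPoly

namespace QPT

variable {D : Set (List Bool × ℕ)} (A : QPT D)

theorem isPoly_heightBound : IsPoly A.heightBound := IsPoly.id.add (IsPoly.eval _)

theorem isPoly_cleanTime : IsPoly A.cleanTime :=
  ((IsPoly.eval _).add ((((IsPoly.const _).mul (((IsPoly.const 5).mul A.isPoly_heightBound).add
    (IsPoly.const 7))).add (IsPoly.const 1)).add (((IsPoly.const _).mul (((IsPoly.const 2).mul
    A.isPoly_heightBound).add (IsPoly.const 2))).add (IsPoly.const 1)) |>.add
    (IsPoly.const 1))).add (IsPoly.const 1)

end QPT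

section

variable (K : QPT {x | ∃ n, x = (unary n, 0)}) (V : QPT Set.univ) (c : ℕ)

/-- The adversary: search for a key that passes many tests. -/
def searchProg : Prog := .seq (prepProg c) (forLoop 2 3 (trialProg K.prog V.prog))

/-- The time of the adversary, for the security parameter `n` and `M` groups of input qubits. -/
noncomputable def searchTime (n M : ℕ) : ℕ :=
  prepTime n c M + ((n + 1) ^ c * (trialTime n ((n + 1) ^ c) M (K.heightBound n) (K.cleanTime n)
    (V.cleanTime (K.heightBound n + M)) (V.heightBound (K.heightBound n + M)) + 10) + 3) + 1

theorem isPoly_searchTime : IsPoly fun x => searchTime K V c x x := by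
  have hpow : IsPoly fun x => powTime x c := by
    induction c with
    | zero => exact IsPoly.const 1
    | succ c ih =>
      exact (ih.add ((((IsPoly.id.add (.const 1)).pow c).mul
        (((IsPoly.const 16).mul .id).add (.const 13))).add (.const 3))).add (.const 1)
  have hu : IsPoly fun x => (x + 1) ^ c := (IsPoly.id.add (.const 1)).pow c
  have hL := K.isPoly_heightBound
  have hT := V.isPoly_cleanTime.comp (hL.add .id)
  have hH := V.isPoly_heightBound.comp (hL.add .id)
  have hgather : IsPoly fun x => gatherTime ((x + 1) ^ c) x :=
    ((IsPoly.id.add (.const 1)).mul ((hu.mul ((hu.mul (.const 12)).add (.const 13))).add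
      (.const 8))).add (.const 3)
  have hprep : IsPoly fun x => prepTime x c x :=
    (((((IsPoly.const 5).mul .id).add hpow).add ((IsPoly.const 12).mul hu)).add hgather).add
      (.const 10)
  have htest : IsPoly fun x => testTime (K.heightBound x) x (V.cleanTime (K.heightBound x + x))
      (V.heightBound (K.heightBound x + x)) :=
    (((((IsPoly.const 12).mul hL).add ((IsPoly.const 15).mul .id)).add hT).add
      ((IsPoly.const 2).mul hH)).add (.const 50)
  have htrial : IsPoly fun x => trialTime x ((x + 1) ^ c) x (K.heightBound x) (K.cleanTime x)
      (V.cleanTime (K.heightBound x + x)) (V.heightBound (K.heightBound x + x)) :=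
    ((((((IsPoly.const 12).mul .id).add K.isPoly_cleanTime).add ((IsPoly.const 30).mul hL)).add
      ((IsPoly.const 10).mul hu)).add (hu.mul (htest.add (.const 10)))).add (.const 100)
  exact (hprep.add ((hu.mul (htrial.add (.const 10))).add (.const 3))).add (.const 1)

theorem searchTime_mono {n n' M M' : ℕ} (hn : n ≤ n') (hM : M ≤ M') :
    searchTime K V c n M ≤ searchTime K V c n' M' := by
  have hpow : powTime n c ≤ powTime n' c := by
    induction c with
    | zero => exact le_rfl
    | succ c ih => unfold powTime; gcongr
  have hL : K.heightBound n ≤ K.heightBound n' := K.isPoly_heightBound.monotone hn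
  have hK : K.cleanTime n ≤ K.cleanTime n' := K.isPoly_cleanTime.monotone hn
  have hT := V.isPoly_cleanTime.monotone (add_le_add hL hM)
  have hH := V.isPoly_heightBound.monotone (add_le_add hL hM)
  unfold searchTime prepTime gatherTime trialTime testTime
  gcongr

/-- The memories `Q` are left abstract so that the statement covers both the genuine input (`a = 1`)
and the zero memory (`a = 0`), which is used to prove termination. -/
theorem yields_search {r : ℕ} {Q : ℕ → ℝ → QState} (hQ : ∀ w, IsMove r fun i => Q i w)
    {n u M : ℕ} (hu : u = (n + 1) ^ c) (h1 : ∀ j < M, j * (u * u) < r) (h2 : r ≤ M * (u * u))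
    {φ : QMat M} (hφ : IsDensity φ) {a : ℝ}
    (hQφ : ∀ w : ℝ, Q (u * u * M) w = ((w * a : ℝ) : ℂ) • copies 13 φ (u * u)) (f : List Bool → ℝ) :
    Yields (searchProg K V c) (searchTime K V c n M)
      (fun w => ⟨fun v => if v = 0 then unary n else [], fun q => if q = 0 then r else 0, Q 0 w⟩)
      (fun (x : List Bool × ℕ) (w : ℝ) => ⟨stackList [x.1, unary n, unary u, [], unary u, [],
        unary M, [], [], [], [], [], unary x.2, []], heights 0 0,
        ((w * a : ℝ) : ℂ) • copies 13 φ 0⟩)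
      (fun _ => True) (fun x => f x.1)
      (trialsValue K (fun key => V.prob key φ [true]) n u (fun key _ => f key) u [] 0) := by
  have hL := fun l (hl : l ≤ K.heightBound n) => Nat.add_le_add_right hl M
  have hs := yields_trials K V hφ n u f le_rfl
    (fun l hl => V.isPoly_cleanTime.monotone (hL l hl))
    (fun l hl => V.isPoly_heightBound.monotone (hL l hl))
  have hs' : Yields (forLoop 2 3 (trialProg K.prog V.prog)) (u * (trialTime n u M (K.heightBound n)
      (K.cleanTime n) (V.cleanTime (K.heightBound n + M)) (V.heightBound (K.heightBound n + M))
      + 10) + 3)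
      (fun w => ⟨stackList [[], unary n, unary u, [], unary u, [], unary M, [], [], [], [], [], [],
        []], heights (u * u * M) 0, Q (u * u * M) w⟩)
      (fun (x : List Bool × ℕ) (w : ℝ) => ⟨stackList [x.1, unary n, unary u, [], unary u, [],
        unary M, [], [], [], [], [], unary x.2, []], heights 0 0,
        ((w * a : ℝ) : ℂ) • copies 13 φ 0⟩)
      (fun _ => True) (fun x => f x.1)
      (trialsValue K (fun key => V.prob key φ [true]) n u (fun key _ => f key) u [] 0) := by
    obtain ⟨D, d1, d2⟩ := hs
    refine ⟨D, fun w => ?_, d2⟩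
    dsimp only
    rw [hQφ w]
    have := d1 (w * a)
    simp only [mul_right_comm w a] at this
    exact this
  have := Yields.runs_seq (fun w => runs_prepProg (hQ w) hu h1 h2) hs'
  unfold searchTime
  rw [← hu]
  exact this

open scoped ComplexOrder in
theorem isDensity_diagonal_single (m : ℕ) :
    IsDensity (Matrix.diagonal (Pi.single (fun _ => false) 1) : QMat m) := by
  constructor
  · intro w
    have : ∑ u, ∑ v, (Matrix.diagonal (Pi.single (fun _ => false) 1) : QMat m) u v *
        (star (w u) * w v) = star (w fun _ => false) * w fun _ => false := by
      simp [Matrix.diagonal_apply, Pi.single_apply]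
    rw [this]
    exact star_mul_self_nonneg (w fun _ => false)
  · simp [Pi.single_apply]

theorem search_halts (n r : ℕ) (ρ : QMat r) :
    ∀ x ∈ run (searchTime K V c (n + r) (n + r)) (start (searchProg K V c) (unary n) ρ),
      x.ctrl = [] := by
  obtain ⟨u, hu⟩ : ∃ u, u = (n + 1) ^ c := ⟨_, rfl⟩
  have hu0 : 0 < u * u := by rw [hu]; positivity
  obtain ⟨M, h1, h2⟩ : ∃ M, (∀ j < M, j * (u * u) < r) ∧ r ≤ M * (u * u) := by
    classical
    have hex : ∃ M, r ≤ M * (u * u) := ⟨r, Nat.le_mul_of_pos_right r hu0⟩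
    exact ⟨Nat.find hex, fun j hj => not_le.1 (Nat.find_min hex hj), Nat.find_spec hex⟩
  have hM : M ≤ r := by
    by_contra h
    have := h1 r (not_le.1 h)
    exact absurd (Nat.le_mul_of_pos_right r hu0) (not_le.2 this)
  -- The run on the zero memory has the same control flow as the run on `ρ`; with `a = 0` any
  -- density matrix, here `|0…0⟩⟨0…0|`, can play the role of `φ`.
  obtain ⟨D, d1, -⟩ := yields_search K V c (Q := fun _ _ => 0) (r := r) (fun w =>
    ⟨fun i _ => by rw [← conjugateₗ_apply, map_zero], fun _ _ => rfl⟩) hu h1 h2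
    (isDensity_diagonal_single M) (a := 0) (by simp) (fun _ => 0)
  have := ((d1 1).mono (searchTime_mono K V c (n' := n + r) (M' := n + r) (by omega)
    (by omega))).halted
  exact run_halted_of_shape (sh := ⟨[searchProg K V c], fun v => if v = 0 then unary n else [],
    fun q => if q = 0 then r else 0⟩) this

/-- The adversary that searches for a key passing many tests. -/
noncomputable def searchAdversary : Adversary where
  prog := searchProg K V c
  time := (isPoly_searchTime K V c).choose
  halts := by
    rintro w r ⟨n, r', h⟩ ρ
    obtain ⟨rfl, rfl⟩ := Prod.mk.inj h
    rw [(isPoly_searchTime K V c).choose_spec, length_unary]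
    exact search_halts K V c n r ρ

/-- Here the input has exactly `u * u * m` qubits, so there are `M = m` groups and no padding. -/
theorem expect_searchAdversary {n u m t : ℕ} (hu : u = (n + 1) ^ c) (ht : t = u * u) {φ : QMat m}
    (hφ : IsDensity φ) (f : List Bool → ℝ) :
    (searchAdversary K V c).expect (unary n) (tensorPow φ t) f =
      trialsValue K (fun key => V.prob key φ [true]) n u (fun key _ => f key) u [] 0 := by
  subst ht
  have hu0 : 0 < u * u := by rw [hu]; positivity
  have hmin : ∀ i, i < u * u * m → min (i + 1) (u * u * m) = i + 1 := fun i hi => by omega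
  obtain ⟨D, d1, d2, d3⟩ := yields_search K V c (r := u * u * m)
    (Q := fun i w => ((w * 1 : ℝ) : ℂ) • reversing (tensorPow φ (u * u)) (min i (u * u * m)))
    (fun w => ⟨fun i hi => by
      dsimp only
      rw [conjugate_smul, hmin i hi, min_eq_left hi.le, reversing_succ _ hi], fun i hi => by
      have h1 : min (i + 1) (u * u * m) = u * u * m := by omega
      have h2 : min i (u * u * m) = u * u * m := by omega
      simp only [h1, h2]⟩) hu
    (fun j hj => by rw [mul_comm]; exact Nat.mul_lt_mul_of_pos_left hj hu0) (by rw [mul_comm])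
    hφ (a := 1) (fun w => by rw [min_self, reversing_eq_copies]) f
  have hm : m ≤ u * u * m := Nat.le_mul_of_pos_left m hu0
  have hrun := (d1 1).mono (searchTime_mono K V c (n' := n + u * u * m) (M' := n + u * u * m)
    (by omega) (by omega))
  rw [← d3]
  unfold QPT.expect QPT.final
  have htime : (searchAdversary K V c).time.eval ((unary n).length + u * u * m) =
      searchTime K V c (n + u * u * m) (n + u * u * m) := by
    rw [length_unary]; exact (isPoly_searchTime K V c).choose_spec _
  have hstart : start (searchAdversary K V c).prog (unary n) (tensorPow φ (u * u)) =
      Data.cfg ⟨fun v => if v = 0 then unary n else [], fun q => if q = 0 then u * u * m else 0,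
        ((1 * 1 : ℝ) : ℂ) • reversing (tensorPow φ (u * u)) (min 0 (u * u * m))⟩
        [searchProg K V c] := by
    rw [Nat.zero_min, ← ofMat_eq_reversing]
    simp [start, Data.cfg, searchAdversary]
  rw [htime, hstart, hrun, List.map_map, List.map_map]
  congr 1
  apply List.map_congr_left
  intro x _
  have : ((((1 * x.1) * 1 : ℝ) : ℂ) • copies 13 φ 0).tr.re = x.1 := by
    rw [tr_smul, tr_copies_zero, mul_one, mul_one, one_mul, Complex.ofReal_re]
  exact congrArg (· * f x.2.1) this

end

/-! ### Output states -/

theorem reduce_add (n : ℕ) (ρ σ : QState) : (ρ + σ).reduce n = ρ.reduce n + σ.reduce n := by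
  classical
  ext u v; simp [reduce_eq_pairing]

theorem reduce_zero (n : ℕ) : (0 : QState).reduce n = 0 := by
  classical
  ext u v; simp [reduce_eq_pairing]

theorem isDensity_outState {D : Set (List Bool × ℕ)} (A : QPT D) {w : List Bool} {n : ℕ}
    {ρ : QMat n} (hρ : IsDensity ρ) (m : ℕ) : IsDensity (A.outState w ρ m) := by
  have hstart : (start A.prog w ρ).qu.Pos := hρ.pos
  have hpos := Pos.run hstart (A.time.eval (w.length + n))
  have htr := sum_tr_run (A.time.eval (w.length + n)) (start A.prog w ρ)
  have hsum : ∀ L : List Config, (L.map fun c => c.qu.reduce m).sum =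
      ((L.map fun c : Config => c.qu).sum).reduce m := by
    intro L
    induction L with
    | nil => simp [reduce_zero]
    | cons c L ih => simp [reduce_add, ih]
  have hsum' : ∀ L : List Config, (L.map fun c => c.qu.tr).sum =
      ((L.map fun c : Config => c.qu).sum).tr := by
    intro L
    induction L with
    | nil => simp [tr_zero]
    | cons c L ih => simp [tr_add, ih]
  have hP : ∀ L : List Config, (∀ c ∈ L, c.qu.Pos) → ((L.map fun c : Config => c.qu).sum).Pos := by
    intro L
    induction L with
    | nil => intro _; simpa using QState.Pos.zero
    | cons c L ih =>
      intro h
      simpa using (h c (by simp)).add (ih fun c hc => h c (by simp [hc]))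
  unfold QPT.outState QPT.final
  rw [hsum]
  refine ⟨fun w => (hP _ hpos).reduce m w, ?_⟩
  rw [trace_reduce, ← hsum', htr]
  exact (tr_ofMat ρ).trans hρ.2

theorem ofMat_add {n : ℕ} (φ ψ : QMat n) :
    QState.ofMat (φ + ψ) = QState.ofMat φ + QState.ofMat ψ := by
  simp [QState.ofMat, Finset.sum_add_distrib]

theorem ofMat_smul {n : ℕ} (a : ℝ) (φ : QMat n) :
    QState.ofMat (a • φ) = (a : ℂ) • QState.ofMat φ := by
  simp only [QState.ofMat, Finset.smul_sum, Finsupp.smul_single, Matrix.smul_apply,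
    smul_eq_mul, Complex.real_smul]

/-- The source of the dimension bound: for each key the acceptance probability is a linear
functional of the state, on a space whose dimension does not depend on the number of keys. -/
theorem exists_expect_linear {D : Set (List Bool × ℕ)} (A : QPT D) (w : List Bool) (n : ℕ)
    (f : List Bool → ℝ) : ∃ Λ : QMat n →ₗ[ℝ] ℝ, ∀ φ, A.expect w φ f = Λ φ := by
  obtain ⟨L, hL⟩ := exists_run_linear (A.time.eval (w.length + n))
    ⟨[A.prog], fun v => if v = 0 then w else [], fun q => if q = 0 then n else 0⟩
  have h : ∀ φ : QMat n, A.expect w φ f =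
      (L.map fun x => (x.2 (QState.ofMat φ)).tr.re * f (x.1.cl 0)).sum := by
    intro φ
    have : A.final w φ = L.map fun x => x.1.cfg (x.2 (QState.ofMat φ)) := hL _
    unfold QPT.expect
    rw [this, List.map_map]; rfl
  refine ⟨⟨⟨fun φ => A.expect w φ f, fun φ ψ => ?_⟩, fun a φ => ?_⟩, fun φ => rfl⟩
  · simp only [h, ofMat_add, map_add, tr_add, Complex.add_re, add_mul, List.sum_map_add]
  · simp only [h, ofMat_smul, map_smul, tr_smul, Complex.re_ofReal_mul, mul_assoc,
      List.sum_map_mul_left, smul_eq_mul, RingHom.id_apply]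

/-! ### Nets -/

section Nets

open MeasureTheory Metric Module
open scoped ENNReal Function

/-- The balls of radius `δ / 2` around the points are disjoint and lie in the ball of radius `1 + δ
/ 2`; compare volumes. -/
theorem card_le_of_separated {E : Type*} [NormedAddCommGroup E] [NormedSpace ℝ E]
    [FiniteDimensional ℝ E] {ι : Type*} (s : Finset ι) (y : ι → E) (hs : ∀ i ∈ s, ‖y i‖ ≤ 1)
    {δ : ℝ} (hδ : 0 < δ) (h : ∀ i ∈ s, ∀ j ∈ s, i ≠ j → δ ≤ dist (y i) (y j)) :
    (s.card : ℝ) ≤ (1 + 2 / δ) ^ finrank ℝ E := by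
  borelize E
  let μ : Measure E := Measure.addHaar
  have hδ2 : 0 < δ / 2 := by positivity
  have hρ : 0 < 1 + δ / 2 := by positivity
  have hD : Set.Pairwise (s : Set ι) (Disjoint on fun i => ball (y i) (δ / 2)) := by
    rintro i hi j hj hij
    apply ball_disjoint_ball
    have := h i hi j hj hij
    linarith
  have hsub : (⋃ i ∈ s, ball (y i) (δ / 2)) ⊆ ball (0 : E) (1 + δ / 2) := by
    refine Set.iUnion₂_subset fun i hi => ball_subset_ball' ?_
    rw [dist_zero_right]
    linarith [hs i hi]
  have I : (s.card : ℝ≥0∞) * ENNReal.ofReal ((δ / 2) ^ finrank ℝ E) * μ (ball 0 1) ≤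
      ENNReal.ofReal ((1 + δ / 2) ^ finrank ℝ E) * μ (ball 0 1) :=
    calc
      _ = μ (⋃ i ∈ s, ball (y i) (δ / 2)) := by
        rw [measure_biUnion_finset hD fun c _ => measurableSet_ball]
        simp only [μ.addHaar_ball_of_pos _ hδ2, Finset.sum_const, nsmul_eq_mul, mul_assoc]
      _ ≤ μ (ball (0 : E) (1 + δ / 2)) := measure_mono hsub
      _ = _ := by simp only [μ.addHaar_ball_of_pos _ hρ]
  have J := (ENNReal.mul_le_mul_iff_left (measure_ball_pos _ _ zero_lt_one).ne'
    measure_ball_lt_top.ne).1 I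
  have K := ENNReal.toReal_le_of_le_ofReal (pow_nonneg hρ.le _) J
  rw [ENNReal.toReal_mul, ENNReal.toReal_natCast, ENNReal.toReal_ofReal (by positivity)] at K
  have e : 1 + 2 / δ = (1 + δ / 2) / (δ / 2) := by field_simp; ring
  rw [e, div_pow]
  exact (le_div_iff₀ (by positivity)).2 K

/-- Points `x j` can be grouped into few cells such that the functionals `Λ i` vary little in each
cell. -/
theorem exists_cells {E : Type*} [AddCommGroup E] [Module ℝ E] [FiniteDimensional ℝ E]
    {ι : Type*} [Fintype ι] (Λ : ι → E →ₗ[ℝ] ℝ) (x : ι → E) (hx : ∀ i j, |Λ i (x j)| ≤ 1)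
    {δ : ℝ} (hδ : 0 < δ) :
    ∃ (s : Finset ι) (c : ι → ι), (∀ j, c j ∈ s) ∧ (∀ i j, |Λ i (x j) - Λ i (x (c j))| ≤ δ) ∧
      (s.card : ℝ) ≤ (1 + 2 / δ) ^ finrank ℝ E := by
  classical
  -- The supremum norm on `ι → ℝ` controls all functionals at once, and the range has dimension at
  -- most `finrank ℝ E` however large `ι` is.
  let F := LinearMap.range (LinearMap.pi Λ)
  let y : ι → F := fun j => ⟨LinearMap.pi Λ (x j), LinearMap.mem_range_self _ _⟩
  have hy : ∀ j, ‖y j‖ ≤ 1 := fun j =>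
    (pi_norm_le_iff_of_nonneg zero_le_one).2 fun i => hx i j
  -- A `δ`-separated family of maximal size is a `δ`-net.
  obtain ⟨s, hs, hmax⟩ := Finset.exists_max_image ((Finset.univ : Finset (Finset ι)).filter
    fun s => ∀ i ∈ s, ∀ j ∈ s, i ≠ j → δ ≤ dist (y i) (y j)) Finset.card ⟨∅, by simp⟩
  simp only [Finset.mem_filter, Finset.mem_univ, true_and] at hs hmax
  have hcov : ∀ j, ∃ i ∈ s, dist (y j) (y i) ≤ δ := by
    intro j
    by_contra! hj
    have hjs : j ∉ s := fun h => absurd (hj j h) (by simp [hδ.le])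
    have := hmax (insert j s) (by
      intro i hi i' hi' hne
      rcases Finset.mem_insert.1 hi with rfl | h <;> rcases Finset.mem_insert.1 hi' with rfl | h'
      · exact absurd rfl hne
      · exact (hj _ h').le
      · rw [dist_comm]; exact (hj _ h).le
      · exact hs i h i' h' hne)
    rw [Finset.card_insert_of_notMem hjs] at this
    omega
  choose c hc hc' using hcov
  refine ⟨s, c, hc, fun i j => ?_, ?_⟩
  · have h1 := hc' j
    rw [dist_eq_norm] at h1
    exact (norm_le_pi_norm ((y j - y (c j) : F) : ι → ℝ) i).trans h1
  · refine (card_le_of_separated s y (fun i _ => hy i) hδ hs).trans ?_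
    have : 0 < 2 / δ := by positivity
    exact pow_le_pow_right₀ (by linarith) (LinearMap.finrank_range_le _)

theorem finrank_qMat (m : ℕ) : finrank ℝ (QMat m) = 2 * 4 ^ m := by
  rw [finrank_real_of_complex, Module.finrank_matrix]
  simp [← pow_add, ← two_mul, pow_mul]

end Nets

/-! ### The success probability of the adversary -/

theorem geo_mono {a : ℝ} (h0 : 0 ≤ a) (h1 : a ≤ 1) (u : ℕ) {h h' : ℕ → ℝ} (H : ∀ j, h j ≤ h' j) :
    geo a u h ≤ geo a u h' := by
  induction u generalizing h h' with
  | zero => exact H 0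
  | succ u ih =>
    exact add_le_add (mul_le_mul_of_nonneg_left (ih fun j => H (j + 1)) h0)
      (mul_le_mul_of_nonneg_left (H 0) (by linarith))

theorem geo_const (a : ℝ) (u : ℕ) (x : ℝ) : geo a u (fun _ => x) = x := by
  induction u with
  | zero => rfl
  | succ u ih => simp only [geo, ih]; ring

/-- The first `R` attempts all succeed with probability `a ^ R`. -/
theorem geo_ite (a : ℝ) {u R : ℕ} (hR : R ≤ u) (x y : ℝ) :
    geo a u (fun j => if R ≤ j then x else y) = a ^ R * x + (1 - a ^ R) * y := by
  induction u generalizing R with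
  | zero =>
    obtain rfl : R = 0 := by omega
    simp [geo]
  | succ u ih =>
    rcases R with _ | R
    · simp [geo_const]
    · simp only [geo, Nat.add_le_add_iff_right, ih (Nat.le_of_succ_le_succ hR)]
      simp only [Nat.le_zero, Nat.add_eq_zero_iff, one_ne_zero, and_false, if_false]
      ring

section

variable (K : QPT {x | ∃ n, x = (unary n, 0)}) {acc : List Bool → ℝ} {n u : ℕ}

theorem trialsValue_nonneg (h0 : ∀ k, 0 ≤ acc k) (h1 : ∀ k, acc k ≤ 1) {F : List Bool → ℕ → ℝ}
    (hF : ∀ k b, 0 ≤ F k b) (s : ℕ) (best : List Bool) (b : ℕ) :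
    0 ≤ trialsValue K acc n u F s best b := by
  induction s generalizing best b with
  | zero => exact hF _ _
  | succ s ih =>
    have := K.expect_mono ⟨n, rfl⟩ isDensity_noQubits (f := fun _ => 0 * 1) (g := fun key =>
      geo (acc key) u fun j => if b ≤ j then trialsValue K acc n u F s key j
        else trialsValue K acc n u F s best b) (fun key _ => by
      rw [zero_mul, ← geo_const (acc key) u 0]
      exact geo_mono (h0 key) (h1 key) u fun j => by split_ifs <;> exact ih _ _)
    rw [QPT.expect_mul, zero_mul] at this
    exact this

/-- If the keys that are accepted with probability at least `1 - γ` count as good, then the search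
leads with high probability to a good key. -/
theorem trialsValue_ge (h0 : ∀ k, 0 ≤ acc k) (h1 : ∀ k, acc k ≤ 1) {γ g : ℝ}
    (hγ1 : γ ≤ 1) {R : ℕ} (hR1 : 1 ≤ R) (hRu : R ≤ u) (hg1 : g ≤ 1)
    (hg : g ≤ K.expect (unary n) noQubits fun key => acc key ^ R) :
    (1 - γ) * (1 - u * (1 - γ) ^ R - (1 - g) ^ u) ≤
      trialsValue K acc n u (fun key _ => acc key) u [] 0 := by
  obtain ⟨β, hβ⟩ : ∃ β, β = (1 - γ) ^ R := ⟨_, rfl⟩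
  have hβ0 : 0 ≤ β := hβ ▸ pow_nonneg (by linarith) R
  have hbad : ∀ key, acc key < 1 - γ → acc key ^ R ≤ β := fun key h =>
    hβ ▸ pow_le_pow_left₀ (h0 key) h.le R
  have hpow0 : ∀ key, 0 ≤ acc key ^ R := fun key => pow_nonneg (h0 key) R
  have hpow1 : ∀ key, acc key ^ R ≤ 1 := fun key => pow_le_one₀ (h0 key) (h1 key)
  have hnn := trialsValue_nonneg K (n := n) (u := u) h0 h1 (F := fun key _ => acc key)
    (fun k _ => h0 k)
  have hγ' : 0 ≤ 1 - γ := by linarith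
  obtain ⟨W, hW⟩ : ∃ W, W = trialsValue K acc n u (fun key _ => acc key) := ⟨_, rfl⟩
  have hW0 : W 0 = fun key _ => acc key := by rw [hW]; rfl
  have hWs : ∀ s, W (s + 1) = trialValue K acc n u (W s) := by intro s; rw [hW]; rfl
  rw [← hW] at hnn ⊢
  -- Here `s` trials remain. Once a good key has a record of at least `R`, the only danger is a bad
  -- key with `R` successes, of probability at most `β` per trial. Before that, there is also the
  -- risk `(1 - g) ^ s` that no sampled key reaches `R`. States where a bad key holds a record of at
  -- least `R` are just bounded below by `0`.
  have key : ∀ s : ℕ, (∀ best b, R ≤ b → 1 - γ ≤ acc best → (1 - γ) * (1 - s * β) ≤ W s best b) ∧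
      ∀ best b, b < R → (1 - γ) * (1 - s * β - (1 - g) ^ s) ≤ W s best b := by
    intro s
    induction s with
    | zero =>
      refine ⟨fun best b _ hb => by simpa [hW0] using hb, fun best b _ => ?_⟩
      simpa [hW0] using h0 best
    | succ s ih =>
      obtain ⟨ih1, ih2⟩ := ih
      have hs : (0 : ℝ) ≤ s * β := by positivity
      have hgs : 0 ≤ (1 - g) ^ s := pow_nonneg (by linarith) s
      constructor
      · intro best b hb hbest
        have := K.expect_mono ⟨n, rfl⟩ isDensity_noQubits
          (f := fun _ => (1 - γ) * (1 - (s + 1 : ℕ) * β) * 1) (g := fun k =>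
          geo (acc k) u fun j => if b ≤ j then W s k j else W s best b) (fun k _ => by
          by_cases hk : 1 - γ ≤ acc k
          · rw [mul_one, ← geo_const (acc k) u ((1 - γ) * (1 - (s + 1 : ℕ) * β))]
            refine geo_mono (h0 k) (h1 k) u fun j => ?_
            have : (1 - γ) * (1 - (s + 1 : ℕ) * β) ≤ (1 - γ) * (1 - s * β) :=
              mul_le_mul_of_nonneg_left (by push_cast; linarith) hγ'
            split_ifs with hj
            · exact this.trans (ih1 k j (hb.trans hj) hk)
            · exact this.trans (ih1 best b hb hbest)
          · have hb' := hbad k (not_le.1 hk)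
            -- If the bad key reaches `R` successes, the value `0` is relaxed to a negative number
            -- so that the loss becomes exactly `(1 - γ) * acc k ^ R`.
            calc (1 - γ) * (1 - (s + 1 : ℕ) * β) * 1
                ≤ acc k ^ R * ((1 - γ) * (1 - s * β) - (1 - γ)) +
                  (1 - acc k ^ R) * ((1 - γ) * (1 - s * β)) := by
                  push_cast
                  nlinarith [mul_nonneg hγ' (sub_nonneg.2 hb')]
              _ = _ := (geo_ite (acc k) hRu _ _).symm
              _ ≤ _ := by
                refine geo_mono (h0 k) (h1 k) u fun j => ?_
                have h2 : (1 - γ) * (1 - s * β) - (1 - γ) ≤ 0 := by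
                  nlinarith [mul_nonneg hγ' hs]
                have h3 := ih1 best b hb hbest
                split_ifs with hj hj' hj'
                · exact h2.trans (hnn _ _ _)
                · exact (by linarith : _ ≤ (1 - γ) * (1 - s * β)).trans h3
                · exact absurd (hb.trans hj') hj
                · exact h3)
        rw [QPT.expect_mul, K.expect_one ⟨n, rfl⟩ isDensity_noQubits, mul_one] at this
        rw [hWs]
        exact this
      · intro best b hb
        have := K.expect_mono ⟨n, rfl⟩ isDensity_noQubits
          -- One lower bound for good and bad keys alike. By `hg` its expectation contracts `(1 - g)
          -- ^ s` to `(1 - g) ^ (s + 1)`.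
          (f := fun k => (1 - γ) * (1 - s * β - (1 - g) ^ s - β) * 1 +
            ((1 - γ) * (1 - g) ^ s) * acc k ^ R) (g := fun k =>
          geo (acc k) u fun j => if b ≤ j then W s k j else W s best b) (fun k _ => by
          by_cases hk : 1 - γ ≤ acc k
          · calc _ ≤ acc k ^ R * ((1 - γ) * (1 - s * β)) +
                  (1 - acc k ^ R) * ((1 - γ) * (1 - s * β - (1 - g) ^ s)) := by
                  nlinarith [mul_nonneg hγ' hβ0]
              _ = _ := (geo_ite (acc k) hRu _ _).symm
              _ ≤ _ := by
                refine geo_mono (h0 k) (h1 k) u fun j => ?_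
                split_ifs with hj hj' hj'
                · exact ih1 k j hj hk
                · exact absurd (hb.le.trans hj) hj'
                · exact ih2 k j (not_le.1 hj)
                · exact ih2 best b hb
          · have hb' := hbad k (not_le.1 hk)
            calc _ ≤ acc k ^ R * ((1 - γ) * (1 - s * β) - (1 - γ)) +
                  (1 - acc k ^ R) * ((1 - γ) * (1 - s * β - (1 - g) ^ s)) := by
                  nlinarith [mul_nonneg hγ' (sub_nonneg.2 hb')]
              _ = _ := (geo_ite (acc k) hRu _ _).symm
              _ ≤ _ := by
                refine geo_mono (h0 k) (h1 k) u fun j => ?_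
                have h2 : (1 - γ) * (1 - s * β) - (1 - γ) ≤ 0 := by
                  nlinarith [mul_nonneg hγ' hs]
                split_ifs with hj hj' hj'
                · exact h2.trans (hnn _ _ _)
                · exact absurd (hb.le.trans hj) hj'
                · exact ih2 k j (not_le.1 hj)
                · exact ih2 best b hb)
        rw [QPT.expect_add, QPT.expect_mul, QPT.expect_mul,
          K.expect_one ⟨n, rfl⟩ isDensity_noQubits, mul_one] at this
        rw [hWs]
        refine le_trans ?_ this
        have h4 := mul_le_mul_of_nonneg_left hg (mul_nonneg hγ' hgs)
        rw [pow_succ]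
        push_cast
        linarith
  have := (key u).2 [] 0 (by omega)
  rw [hβ] at this
  exact this

end

/-! ### Heavy cells and the number of tests. -/

/-- Here `w` is the distribution of keys and `d` their acceptance of their own states. Markov's
inequality discards the keys with small `d`, of weight at most `ν / η`; the cells in which the
remaining weight is below `τ` lose at most `τ` each. -/
theorem heavy_cells {ι : Type*} [Fintype ι] {w d : ι → ℝ} (hw : ∀ i, 0 ≤ w i)
    (hw1 : ∑ i, w i = 1) (hd : ∀ i, d i ≤ 1) {ν : ℝ} (hν : 1 - ν ≤ ∑ i, w i * d i)
    {s : Finset ι} {c : ι → ι} (hc : ∀ j, c j ∈ s) {η τ : ℝ} (hη : 0 < η) (hτ : 0 ≤ τ) :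
    ∃ H : Finset ι, (∀ i ∈ H, ∃ J : Finset ι, (∀ j ∈ J, c j = c i ∧ 1 - η ≤ d j) ∧
      τ ≤ ∑ j ∈ J, w j) ∧ 1 - ν / η - s.card * τ ≤ ∑ i ∈ H, w i := by
  classical
  let J : ι → Finset ι := fun B => Finset.univ.filter fun j => c j = B ∧ 1 - η ≤ d j
  let G : Finset ι := Finset.univ.filter fun i => 1 - η ≤ d i
  let H : Finset ι := G.filter fun i => τ ≤ ∑ j ∈ J (c i), w j
  refine ⟨H, fun i hi => ⟨J (c i), fun j hj => by simpa [J] using hj, (Finset.mem_filter.1 hi).2⟩,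
    ?_⟩
  have h1 : 1 - ν / η ≤ ∑ i ∈ G, w i := by
    have : ∑ i, w i * d i ≤ ∑ i, ((1 - η) * w i + η * if 1 - η ≤ d i then w i else 0) := by
      refine Finset.sum_le_sum fun i _ => ?_
      split_ifs with h
      · nlinarith [hw i, hd i]
      · nlinarith [hw i, not_le.1 h]
    rw [Finset.sum_add_distrib, ← Finset.mul_sum, ← Finset.mul_sum, hw1,
      ← Finset.sum_filter] at this
    have h2 : η - ν ≤ η * ∑ i ∈ G, w i := by linarith
    have e : 1 - ν / η = (η - ν) / η := by field_simp
    rw [e, div_le_iff₀ hη]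
    linarith
  have h2 : ∑ i ∈ G.filter (fun i => ¬ τ ≤ ∑ j ∈ J (c i), w j), w i ≤ s.card * τ := by
    rw [← Finset.sum_fiberwise_of_maps_to (g := c) (t := s) fun i _ => hc i, ← nsmul_eq_mul]
    refine Finset.sum_le_card_nsmul _ _ _ fun B _ => ?_
    by_cases hB : τ ≤ ∑ j ∈ J B, w j
    · rw [Finset.sum_eq_zero]
      · exact hτ
      · intro i hi
        simp only [Finset.mem_filter] at hi
        rw [hi.2] at hi
        exact absurd hB hi.1.2
    · refine le_trans (Finset.sum_le_sum_of_subset_of_nonneg (fun i hi => ?_)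
        fun i _ _ => hw i) (not_le.1 hB).le
      simp only [Finset.mem_filter, G, J] at hi ⊢
      exact ⟨hi.1.1.1, hi.2, hi.1.1.2⟩
  have h3 := Finset.sum_filter_add_sum_filter_not G (fun i => τ ≤ ∑ j ∈ J (c i), w j) w
  change _ ≤ ∑ i ∈ G.filter _, w i
  linarith

/-- Take the least `R` with `(1 - Δ / 2) ^ R ≤ θ = Δ / (16 * u)`, which makes bad keys harmless. By
minimality and `1 - Δ / 2 ≤ (1 - Δ / 8) ^ 4`, a good key still passes with probability of order `θ ^
(1 / 4)`, so the expected number of good keys that pass grows like `u ^ (3 / 4)`. -/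
theorem exists_threshold {Δ N : ℝ} {u : ℕ} (hΔ0 : 0 < Δ) (hΔ1 : Δ ≤ 1) (hN : 1 ≤ N)
    (hu : 2 ^ 37 * N ^ 4 ≤ u * Δ ^ 9) :
    ∃ R : ℕ, 1 ≤ R ∧ R ≤ u ∧ u * (1 - Δ / 2) ^ R ≤ Δ / 16 ∧
      (1 - Δ / (16 * N) * (1 - Δ / 8) ^ R) ^ u ≤ Δ / 16 := by
  have hN4 : 1 ≤ N ^ 4 := one_le_pow₀ hN
  have hΔ9 : Δ ^ 9 ≤ 1 := pow_le_one₀ hΔ0.le hΔ1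
  have hΔ93 : Δ ^ 9 ≤ Δ ^ 3 := pow_le_pow_of_le_one hΔ0.le hΔ1 (by norm_num)
  have hu' : (2 : ℝ) ^ 37 ≤ u := by
    have : (u : ℝ) * Δ ^ 9 ≤ u * 1 := mul_le_mul_of_nonneg_left hΔ9 (Nat.cast_nonneg u)
    nlinarith
  have hu0 : (0 : ℝ) < u := lt_of_lt_of_le (by positivity) hu'
  have hu1 : (1 : ℝ) ≤ u := le_trans (by norm_num) hu'
  obtain ⟨θ, hθ⟩ : ∃ θ, θ = Δ / (16 * u) := ⟨_, rfl⟩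
  have hθ0 : 0 < θ := by rw [hθ]; positivity
  have hex : (1 - Δ / 2) ^ u ≤ θ := by
    have h128 : 128 ≤ u * Δ ^ 3 := by
      have := mul_le_mul_of_nonneg_left hΔ93 hu0.le
      nlinarith
    obtain ⟨z, hz⟩ : ∃ z, z = u * (Δ / 2) := ⟨_, rfl⟩
    have hz0 : 0 < z := by rw [hz]; positivity
    have h1 : (1 - Δ / 2) ^ u ≤ Real.exp (-z) := by
      have := pow_le_pow_left₀ (by linarith) (Real.one_sub_le_exp_neg (Δ / 2)) u
      rwa [← Real.exp_nat_mul, mul_neg, ← hz] at this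
    have h2 : z ^ 2 / 2 ≤ Real.exp z := by
      have := Real.quadratic_le_exp_of_nonneg hz0.le
      linarith
    have h3 : Real.exp (-z) ≤ 1 / (z ^ 2 / 2) := by
      rw [Real.exp_neg, ← one_div]
      exact one_div_le_one_div_of_le (by positivity) h2
    refine h1.trans (h3.trans ?_)
    rw [hθ, hz, div_le_div_iff₀ (by positivity) (by positivity)]
    have := mul_le_mul_of_nonneg_left h128 hu0.le
    nlinarith
  classical
  have hex' : ∃ R, (1 - Δ / 2) ^ R ≤ θ := ⟨u, hex⟩
  obtain ⟨R, hR⟩ : ∃ R, R = Nat.find hex' := ⟨_, rfl⟩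
  have hRspec : (1 - Δ / 2) ^ R ≤ θ := hR ▸ Nat.find_spec hex'
  have hRu : R ≤ u := hR ▸ Nat.find_min' hex' hex
  have hR1 : 1 ≤ R := by
    by_contra h
    have : R = 0 := by omega
    rw [this, pow_zero, hθ, le_div_iff₀ (by positivity)] at hRspec
    linarith
  obtain ⟨r, rfl⟩ : ∃ r, R = r + 1 := ⟨R - 1, by omega⟩
  have hmin : θ < (1 - Δ / 2) ^ r := not_le.1 (Nat.find_min hex' (by omega))
  refine ⟨r + 1, hR1, hRu, ?_, ?_⟩
  · have := mul_le_mul_of_nonneg_left hRspec hu0.le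
    have e : u * θ = Δ / 16 := by rw [hθ]; field_simp
    linarith
  · obtain ⟨y, hy⟩ : ∃ y, y = (1 - Δ / 8) ^ r := ⟨_, rfl⟩
    have hy0 : 0 < y := hy ▸ pow_pos (by linarith) r
    have hy1 : y ≤ 1 := hy ▸ pow_le_one₀ (by linarith) (by linarith)
    -- Minimality of `R = r + 1`, combined with Bernoulli's inequality.
    have hy4 : θ ≤ y ^ 4 := by
      have hb : 1 - Δ / 2 ≤ (1 - Δ / 8) ^ 4 := by
        have := one_add_mul_le_pow (a := -(Δ / 8)) (by linarith) 4
        push_cast at this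
        calc 1 - Δ / 2 = 1 + 4 * -(Δ / 8) := by ring
          _ ≤ _ := this
          _ = _ := by ring
      rw [hy, ← pow_mul, mul_comm, pow_mul]
      exact hmin.le.trans (pow_le_pow_left₀ (by linarith) hb r)
    obtain ⟨g, hg⟩ : ∃ g, g = Δ / (16 * N) * (1 - Δ / 8) ^ (r + 1) := ⟨_, rfl⟩
    have hg7 : Δ / (16 * N) * (7 / 8 * y) ≤ g := by
      rw [hg, pow_succ, ← hy]
      refine mul_le_mul_of_nonneg_left ?_ (by positivity)
      nlinarith
    have hg1 : g ≤ 1 := by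
      rw [hg]
      refine mul_le_one₀ ((div_le_one (by positivity)).2 (by linarith))
        (pow_nonneg (by linarith) _) (pow_le_one₀ (by linarith) (by linarith))
    have hgu : 16 / Δ ≤ g * u := by
      -- Fourth powers avoid the root of `θ`. The constant `2 ^ 37` comes from `16 ^ 5 * 16 ^ 4 = 2
      -- ^ 36` and `(8 / 7) ^ 4 < 2`.
      have h4 : (16 / Δ) ^ 4 ≤ (Δ / (16 * N) * (7 / 8 * y) * u) ^ 4 := by
        have e1 : (Δ / (16 * N) * (7 / 8 * y) * u) ^ 4 =
            (Δ / (16 * N)) ^ 4 * (7 / 8) ^ 4 * u ^ 4 * y ^ 4 := by ring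
        rw [e1]
        refine le_trans ?_ (mul_le_mul_of_nonneg_left hy4 (by positivity))
        rw [hθ]
        have e2 : (Δ / (16 * N)) ^ 4 * (7 / 8) ^ 4 * u ^ 4 * (Δ / (16 * u)) =
            (7 / 8) ^ 4 * (u ^ 2 * (u * Δ ^ 9)) / (16 ^ 5 * N ^ 4 * Δ ^ 4) := by
          field_simp
        rw [e2, div_pow, div_le_div_iff₀ (by positivity) (by positivity)]
        have hu2 : (1 : ℝ) ≤ (u : ℝ) ^ 2 := one_le_pow₀ hu1
        have h5 : 2 ^ 37 * N ^ 4 ≤ u ^ 2 * (u * Δ ^ 9) :=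
          hu.trans (le_mul_of_one_le_left (by positivity) hu2)
        have hΔ4 : 0 ≤ Δ ^ 4 := by positivity
        have := mul_le_mul_of_nonneg_right h5 hΔ4
        nlinarith
      refine le_trans (le_of_pow_le_pow_left₀ (by norm_num) (by positivity) h4) ?_
      exact mul_le_mul_of_nonneg_right hg7 hu0.le
    rw [← hg]
    have h16 : 0 < 16 / Δ := by positivity
    have h1 : (1 - g) ^ u ≤ Real.exp (-(g * u)) := by
      have := pow_le_pow_left₀ (by linarith) (Real.one_sub_le_exp_neg g) u
      rwa [← Real.exp_nat_mul, mul_neg, mul_comm (u : ℝ)] at this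
    refine h1.trans ?_
    have h2 : 16 / Δ ≤ Real.exp (g * u) := by linarith [Real.add_one_le_exp (g * u)]
    rw [Real.exp_neg]
    have := inv_anti₀ h16 h2
    rwa [inv_div] at this

/-! ### The search breaks every scheme with few cells. -/

namespace QPT

theorem exists_expect_eq_sum {D : Set (List Bool × ℕ)} (A : QPT D) {w : List Bool} {n : ℕ}
    (h : (w, n) ∈ D) {φ : QMat n} (hφ : IsDensity φ) :
    ∃ (l : ℕ) (p : Fin l → ℝ) (y : Fin l → List Bool), (∀ i, 0 ≤ p i) ∧ ∑ i, p i = 1 ∧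
      ∀ f, A.expect w φ f = ∑ i, p i * f (y i) := by
  obtain ⟨L, -, h2, h3, h4⟩ := A.exists_runs_cleaned h hφ
  refine ⟨L.length, fun i => L[i].1, fun i => L[i].2, fun i => (h2 _ (List.getElem_mem _)).1, ?_,
    fun f => ?_⟩
  · rw [← h4, ← Fin.sum_univ_fun_getElem L fun x => x.1]; rfl
  · rw [← h3, ← Fin.sum_univ_fun_getElem L fun x => x.1 * f x.2]; rfl

end QPT

theorem isDensity_state (S : Scheme) (m : ℕ) (k : List Bool) : IsDensity (S.state m k) :=
  isDensity_outState _ isDensity_noQubits m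

theorem accept_nonneg (S : Scheme) {m : ℕ} {φ : QMat m} (hφ : IsDensity φ) (k : List Bool) :
    0 ≤ S.accept k φ :=
  S.ver.prob_nonneg (Set.mem_univ _) hφ _

theorem accept_le_one (S : Scheme) {m : ℕ} {φ : QMat m} (hφ : IsDensity φ) (k : List Bool) :
    S.accept k φ ≤ 1 :=
  S.ver.prob_le_one (Set.mem_univ _) hφ _

/-- The error `Δ` is spent as follows: cells of radius `Δ / 32`, own acceptance at least `1 - Δ /
16`, light cells of total weight at most `Δ / 16`, and good keys accepted with probability at least
`1 - Δ / 2`. -/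
theorem lt_expect_search (S : Scheme) {m n u c t : ℕ} (hu : u = (n + 1) ^ c) (ht : t = u * u)
    {Δ N ν : ℝ} (hΔ0 : 0 < Δ) (hΔ1 : Δ ≤ 1) (hN1 : 1 ≤ N)
    (hN : (1 + 2 / (Δ / 32)) ^ (2 * 4 ^ m) ≤ N) (huN : 2 ^ 37 * N ^ 4 ≤ u * Δ ^ 9)
    (hν : ν ≤ Δ ^ 2 / 256)
    (hS : 1 - ν ≤ S.keyGen.expect (unary n) noQubits fun k => S.accept k (S.state m k)) :
    1 - Δ < S.keyGen.expect (unary n) noQubits fun k =>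
      (searchAdversary S.keyGen S.ver c).expect (unary n) (tensorPow (S.state m k) t) fun k' =>
        S.accept k' (S.state m k) := by
  obtain ⟨l, w, y, hw, hw1, hE⟩ := S.keyGen.exists_expect_eq_sum (w := unary n) (n := 0) ⟨n, rfl⟩
    isDensity_noQubits
  have hst := isDensity_state S m
  choose Λ hΛ using fun k => exists_expect_linear S.ver k m fun z => if z = [true] then 1 else 0
  have hΛ' : ∀ k (φ : QMat m), S.accept k φ = Λ k φ := hΛ
  obtain ⟨s, cell, hcs, hcell, hcard⟩ := exists_cells (fun i => Λ (y i))
    (fun i => S.state m (y i)) (fun i j => by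
      rw [← hΛ', abs_of_nonneg (accept_nonneg S (hst _) _)]
      exact accept_le_one S (hst _) _) (δ := Δ / 32) (by positivity)
  rw [finrank_qMat] at hcard
  simp only [← hΛ'] at hcell
  have hcardN := hcard.trans hN
  obtain ⟨R, hR1, hRu, hRβ, hRg⟩ := exists_threshold hΔ0 hΔ1 hN1 huN
  obtain ⟨τ, hτ⟩ : ∃ τ, τ = Δ / (16 * N) := ⟨_, rfl⟩
  have hτ0 : 0 < τ := by rw [hτ]; positivity
  rw [← hτ] at hRg
  rw [hE] at hS
  obtain ⟨H, hH, hHw⟩ := heavy_cells hw hw1 (d := fun i => S.accept (y i) (S.state m (y i)))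
    (fun i => accept_le_one S (hst _) _) hS hcs (η := Δ / 16) (by positivity) hτ0.le
  have hexp : ∀ k, (searchAdversary S.keyGen S.ver c).expect (unary n) (tensorPow (S.state m k) t)
      (fun k' => S.accept k' (S.state m k)) = trialsValue S.keyGen
        (fun k' => S.accept k' (S.state m k)) n u (fun k' _ => S.accept k' (S.state m k)) u [] 0 :=
    fun k => expect_searchAdversary S.keyGen S.ver c hu ht (hst k) _
  rw [hE]
  simp only [hexp]
  have hv : ∀ i ∈ H, (1 - Δ / 2) * (1 - Δ / 8) ≤ trialsValue S.keyGen
      (fun k' => S.accept k' (S.state m (y i))) n u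
      (fun k' _ => S.accept k' (S.state m (y i))) u [] 0 := by
    intro i hi
    obtain ⟨J, hJ, hJw⟩ := hH i hi
    have hpow1 : (1 - Δ / 8) ^ R ≤ 1 := pow_le_one₀ (by linarith) (by linarith)
    have hpow0 : 0 ≤ (1 - Δ / 8) ^ R := pow_nonneg (by linarith) R
    have hτ1 : τ ≤ 1 := by rw [hτ, div_le_one (by positivity)]; linarith
    have hg : τ * (1 - Δ / 8) ^ R ≤ S.keyGen.expect (unary n) noQubits fun k' =>
        S.accept k' (S.state m (y i)) ^ R := by
      rw [hE]
      calc τ * (1 - Δ / 8) ^ R ≤ (∑ j ∈ J, w j) * (1 - Δ / 8) ^ R :=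
            mul_le_mul_of_nonneg_right hJw hpow0
        _ = ∑ j ∈ J, w j * (1 - Δ / 8) ^ R := Finset.sum_mul _ _ _
        _ ≤ ∑ j ∈ J, w j * S.accept (y j) (S.state m (y i)) ^ R := by
          refine Finset.sum_le_sum fun j hj => mul_le_mul_of_nonneg_left
            (pow_le_pow_left₀ (by linarith) ?_ R) (hw j)
          -- The states of `i` and `j` are both within `Δ / 32` of the state of their common centre,
          -- so key `j` accepts the state of `i` with probability at least `1 - Δ / 16 - 2 * (Δ /
          -- 32) = 1 - Δ / 8`.
          obtain ⟨h1, h2⟩ := hJ j hj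
          have h3 := (abs_le.1 (hcell j j)).2
          have h4 := (abs_le.1 (hcell j i)).1
          rw [h1] at h3
          linarith
        _ ≤ _ := Finset.sum_le_sum_of_subset_of_nonneg (Finset.subset_univ J) fun j _ _ =>
          mul_nonneg (hw j) (pow_nonneg (accept_nonneg S (hst _) _) R)
    refine le_trans ?_ (trialsValue_ge S.keyGen (fun k => accept_nonneg S (hst _) k)
      (fun k => accept_le_one S (hst _) k) (by linarith : Δ / 2 ≤ 1) hR1 hRu
      (mul_le_one₀ hτ1 hpow0 hpow1) hg)
    exact mul_le_mul_of_nonneg_left (by linarith) (by linarith)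
  have hmass : 1 - Δ / 8 ≤ ∑ i ∈ H, w i := by
    refine le_trans ?_ hHw
    -- This is where `ν ≤ Δ ^ 2 / 256` is needed; `τ = Δ / (16 * N)` is chosen for the next bound.
    have h1 : ν / (Δ / 16) ≤ Δ / 16 := by
      rw [div_le_iff₀ (by positivity)]; nlinarith
    have h2 : s.card * τ ≤ Δ / 16 := by
      refine (mul_le_mul_of_nonneg_right hcardN hτ0.le).trans (le_of_eq ?_)
      rw [hτ]; field_simp
    linarith
  have hnn := fun i => trialsValue_nonneg S.keyGen (n := n) (u := u)
    (fun k => accept_nonneg S (hst (y i)) k) (fun k => accept_le_one S (hst (y i)) k)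
    (F := fun k' _ => S.accept k' (S.state m (y i)))
    (fun k _ => accept_nonneg S (hst (y i)) k) u [] 0
  calc 1 - Δ < (1 - Δ / 8) * ((1 - Δ / 2) * (1 - Δ / 8)) := by nlinarith [sq_nonneg Δ]
    _ ≤ (∑ i ∈ H, w i) * ((1 - Δ / 2) * (1 - Δ / 8)) :=
      mul_le_mul_of_nonneg_right hmass (mul_nonneg (by linarith) (by linarith))
    _ = ∑ i ∈ H, w i * ((1 - Δ / 2) * (1 - Δ / 8)) := Finset.sum_mul _ _ _
    _ ≤ ∑ i ∈ H, w i * _ := Finset.sum_le_sum fun i hi => mul_le_mul_of_nonneg_left (hv i hi) (hw i)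
    _ ≤ _ := Finset.sum_le_sum_of_subset_of_nonneg (Finset.subset_univ H) fun i _ _ =>
      mul_nonneg (hw i) (hnn i)

/-- A scheme whose states are covered by polynomially many cells is not one-way. -/
theorem not_isOWSG_of_isBigO {C : ℝ} {Δ : ℕ → ℝ} {m : ℕ → ℕ} (hC : 1 ≤ C)
    (hΔ : ∀ n, 0 < Δ n ∧ Δ n ≤ 1) {a : ℕ} (hO : (fun n : ℕ => (6 * C / Δ n) ^ 2 ^ (2 * m n)) =O[atTop]
      fun n : ℕ => (n : ℝ) ^ a) (S : Scheme) : ¬ S.IsOWSG (fun n => 1 - Δ n) m := by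
  rintro ⟨-, ⟨ν, hν, hcorrect⟩, honeway⟩
  obtain ⟨κ, hκ, hO⟩ := hO.exists_pos
  rw [isBigOWith_iff] at hO
  have hsmall : ∀ᶠ n : ℕ in atTop, (n : ℝ) ^ (2 * a) * ν n ≤ 1 / (256 * κ ^ 2) :=
    (hν (2 * a)).eventually (ge_mem_nhds (by positivity))
  have hlarge : ∀ᶠ n : ℕ in atTop, 2 ^ 37 * κ ^ 33 ≤ (n : ℝ) :=
    tendsto_natCast_atTop_atTop.eventually_ge_atTop _
  -- The exponent is such that `2 ^ 37 * N ^ 4 ≤ u * Δ ^ 9` holds with `N = B ^ 6`, where `B = (6 *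
  -- C / Δ) ^ 4 ^ m` is at most `κ * n ^ a`. As `B * Δ ≥ 1`, it suffices that `2 ^ 37 * B ^ 33 ≤ u`,
  -- and the extra factor `n` absorbs `2 ^ 37 * κ ^ 33`.
  have hadv := honeway (searchAdversary S.keyGen S.ver (33 * a + 1))
    ((Polynomial.X + 1) ^ (2 * (33 * a + 1)))
  obtain ⟨n, hBn, hνn, hn, hwin⟩ := (hO.and (hsmall.and (hlarge.and hadv))).exists
  refine absurd hwin (not_le.2 ?_)
  change 1 - Δ n < _
  obtain ⟨hΔ0, hΔ1⟩ := hΔ n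
  obtain ⟨δ, hδ⟩ : ∃ δ, δ = Δ n := ⟨_, rfl⟩
  rw [← hδ] at hBn hΔ0 hΔ1 ⊢
  obtain ⟨B, hB⟩ : ∃ B, B = (6 * C / δ) ^ 2 ^ (2 * m n) := ⟨_, rfl⟩
  have hbase : 6 / δ ≤ 6 * C / δ := div_le_div_of_nonneg_right (by linarith) hΔ0.le
  have hδ1 : 1 ≤ 1 / δ := by rw [le_div_iff₀ hΔ0]; linarith
  have hbase1 : 1 / δ ≤ 6 * C / δ := div_le_div_of_nonneg_right (by linarith) hΔ0.le
  have hbase0 : 1 ≤ 6 * C / δ := hδ1.trans hbase1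
  have hBδ : 1 / δ ≤ B := by
    rw [hB]
    exact hbase1.trans (le_self_pow₀ hbase0 (by positivity))
  have hB1 : 1 ≤ B := hδ1.trans hBδ
  have hBn' : B ≤ κ * (n : ℝ) ^ a := by
    rw [← hB, Real.norm_of_nonneg (by linarith), Real.norm_of_nonneg (by positivity)] at hBn
    exact hBn
  have hBδ' : 1 ≤ B * δ := by rwa [div_le_iff₀ hΔ0] at hBδ
  have hκδ : 1 ≤ κ * (n : ℝ) ^ a * δ := hBδ'.trans (mul_le_mul_of_nonneg_right hBn' hΔ0.le)
  refine lt_expect_search S (u := (n + 1) ^ (33 * a + 1)) (c := 33 * a + 1) (N := B ^ 6) (ν := ν n)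
    rfl ?_ hΔ0 hΔ1 (one_le_pow₀ hB1) ?_ ?_ ?_ (hcorrect n)
  · simp only [Polynomial.eval_pow, Polynomial.eval_add, Polynomial.eval_X, Polynomial.eval_one]
    ring
  -- With the exponent `2 * 4 ^ m`, the cube becomes the sixth power of `B`.
  · have h1 : 1 + 2 / (δ / 32) ≤ (6 * C / δ) ^ 3 := by
      calc 1 + 2 / (δ / 32) = 1 + 64 * (1 / δ) := by field_simp; ring
        _ ≤ 216 * (1 / δ) := by linarith
        _ ≤ 216 * (1 / δ) ^ 3 :=
          mul_le_mul_of_nonneg_left (le_self_pow₀ hδ1 (by norm_num)) (by norm_num)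
        _ = (6 / δ) ^ 3 := by ring
        _ ≤ _ := pow_le_pow_left₀ (by positivity) hbase 3
    refine (pow_le_pow_left₀ (by positivity) h1 _).trans (le_of_eq ?_)
    rw [hB, ← pow_mul, ← pow_mul, pow_mul 2 2]
    congr 1
    ring
  · have h1 : 1 ≤ (B * δ) ^ 9 := one_le_pow₀ hBδ'
    have h2 : 2 ^ 37 * B ^ 33 ≤ ((n + 1 : ℕ) : ℝ) ^ (33 * a + 1) := by
      calc 2 ^ 37 * B ^ 33 ≤ 2 ^ 37 * (κ * (n : ℝ) ^ a) ^ 33 := by gcongr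
        _ = 2 ^ 37 * κ ^ 33 * (n : ℝ) ^ (33 * a) := by rw [mul_pow, ← pow_mul]; ring_nf
        _ ≤ n * (n : ℝ) ^ (33 * a) := by gcongr
        _ = (n : ℝ) ^ (33 * a + 1) := by rw [pow_succ]; ring
        _ ≤ _ := by gcongr; omega
    push_cast at h2 ⊢
    calc 2 ^ 37 * (B ^ 6) ^ 4 ≤ 2 ^ 37 * (B ^ 6) ^ 4 * (B * δ) ^ 9 :=
          le_mul_of_one_le_right (by positivity) h1
      _ = 2 ^ 37 * B ^ 33 * δ ^ 9 := by ring
      _ ≤ _ := mul_le_mul_of_nonneg_right h2 (by positivity)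
  · rcases le_or_gt (ν n) 0 with h | h
    · exact h.trans (by positivity)
    · rw [le_div_iff₀ (by positivity)] at hνn ⊢
      -- The bound on `B` forces `Δ` to be at least an inverse polynomial, so the negligible `ν` is
      -- eventually below `Δ ^ 2 / 256`.
      have h1 : 1 ≤ (κ * (n : ℝ) ^ a * δ) ^ 2 := one_le_pow₀ hκδ
      calc ν n * 256 ≤ ν n * 256 * (κ * (n : ℝ) ^ a * δ) ^ 2 :=
            le_mul_of_one_le_right (by positivity) h1
        _ = ((n : ℝ) ^ (2 * a) * ν n * (256 * κ ^ 2)) * δ ^ 2 := by rw [mul_comm 2 a, pow_mul]; ring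
        _ ≤ 1 * δ ^ 2 := mul_le_mul_of_nonneg_right hνn (by positivity)
        _ = δ ^ 2 := one_mul _

/-- The hypothesis gives `4 ^ m ≤ 4 ^ b * log₂ n`, and `c` to the power of a multiple of `log₂ n` is
a power of `n`. -/
theorem isBigO_pow_of_le_loglog {c b : ℝ} (hc : 1 < c) {m : ℕ → ℕ}
    (hm : ∀ᶠ n : ℕ in atTop, (m n : ℝ) ≤ 1 / 2 * Real.logb 2 (Real.logb 2 n) + b) :
    ∃ a : ℕ, (fun n : ℕ => c ^ 2 ^ (2 * m n)) =O[atTop] fun n : ℕ => (n : ℝ) ^ a := by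
  obtain ⟨a, ha⟩ := exists_nat_ge ((2 : ℝ) ^ (2 * b) * Real.logb 2 c)
  refine ⟨a, IsBigO.of_bound 1 ?_⟩
  filter_upwards [hm, eventually_ge_atTop 2] with n hn hn2
  have hn2' : (2 : ℝ) ≤ n := by exact_mod_cast hn2
  have hlog : 0 < Real.logb 2 n := Real.logb_pos (by norm_num) (by linarith)
  have hc0 : 0 < c := by linarith
  have h1 : (2 : ℝ) ^ (2 * m n) ≤ (2 : ℝ) ^ (2 * b) * Real.logb 2 n := by
    calc (2 : ℝ) ^ (2 * m n) = (2 : ℝ) ^ ((2 * m n : ℕ) : ℝ) := (Real.rpow_natCast _ _).symm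
      _ ≤ (2 : ℝ) ^ (2 * b + Real.logb 2 (Real.logb 2 n)) :=
        Real.rpow_le_rpow_of_exponent_le (by norm_num) (by push_cast; linarith)
      _ = _ := by
        rw [Real.rpow_add (by norm_num), Real.rpow_logb (by norm_num) (by norm_num) hlog]
  rw [Real.norm_of_nonneg (by positivity), Real.norm_of_nonneg (by positivity), one_mul]
  calc c ^ 2 ^ (2 * m n) = (2 : ℝ) ^ (Real.logb 2 c * ((2 : ℝ) ^ (2 * m n))) := by
        rw [Real.rpow_mul (by norm_num), Real.rpow_logb (by norm_num) (by norm_num) hc0,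
          ← Real.rpow_natCast]
        push_cast; rfl
    _ ≤ (2 : ℝ) ^ (Real.logb 2 n * a) := by
        refine Real.rpow_le_rpow_of_exponent_le (by norm_num) ?_
        have h2 := mul_le_mul_of_nonneg_left h1 (Real.logb_pos (b := 2) (by norm_num) hc).le
        have h3 := mul_le_mul_of_nonneg_left ha hlog.le
        linarith
    _ = (n : ℝ) ^ a := by
        rw [Real.rpow_mul (by norm_num), Real.rpow_logb (by norm_num) (by norm_num) (by linarith),
          Real.rpow_natCast]

end QOWSG

theorem mainTheorem3 :
    -- constant `ε`: no `ε`-OWSG with `(½ log log n + O(1))`-qubit outputs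
    (∀ (ε : ℝ) (m : ℕ → ℕ), 0 < ε → ε < 1 →
      (∃ b : ℝ, ∀ᶠ n : ℕ in atTop, (m n : ℝ) ≤ 1 / 2 * Real.logb 2 (Real.logb 2 n) + b) →
      ¬ ∃ S : QOWSG.Scheme, S.IsOWSG (fun _ => ε) m) ∧
    -- the general statement for `(1 - Δ)`-OWSGs
    (∀ (C : ℝ) (Δ : ℕ → ℝ) (m : ℕ → ℕ), 1 ≤ C → (∀ n, 0 < Δ n ∧ Δ n ≤ 1) →
      (∃ a : ℕ, (fun n : ℕ => (6 * C / Δ n) ^ 2 ^ (2 * m n)) =O[atTop]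
        fun n : ℕ => (n : ℝ) ^ a) →
      ¬ ∃ S : QOWSG.Scheme, S.IsOWSG (fun n => 1 - Δ n) m) := by
  refine ⟨fun ε m hε0 hε1 ⟨b, hb⟩ ⟨S, hS⟩ => ?_, fun C Δ m hC hΔ ⟨a, ha⟩ ⟨S, hS⟩ =>
    QOWSG.not_isOWSG_of_isBigO hC hΔ ha S hS⟩
  -- The constant case is the general one with `Δ = 1 - ε` and `C = 1`.
  have hc : 1 < 6 * 1 / (1 - ε) := by rw [lt_div_iff₀ (by linarith)]; linarith
  obtain ⟨a, ha⟩ := QOWSG.isBigO_pow_of_le_loglog hc hb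
  refine QOWSG.not_isOWSG_of_isBigO le_rfl (Δ := fun _ => 1 - ε)
    (fun _ => ⟨by linarith, by linarith⟩) ha S ?_
  simpa using hS
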